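/- **Setting.** Let $d\ge 1$, $n\in\mathbb N$, and let $\mathcal H=\mathrm L^2(\mathbb R^d,dx;\mathbb C^n)$ or $\mathcal H=\ell^2(\mathbb Z^d;\mathbb C^n)$. Put $\langle u\rangle=\sqrt{1+|u|^2}$ with the Euclidean norm $|\cdot|$, let $\Lambda_L(x)$ be the open cube of side $L$ centered at $x\in\mathbb Z^d$, let $\chi_{x,L}$ be multiplication by its characteristic function, and let $\chi_x=\chi_{x,1}$. For $\kappa>d/2$ let $T=T_\kappa$ be multiplication by $\langle u\rangle^\kappa$; let $\mathcal H_+$ be the domain of $T$ with norm $\|T\phi\|$ and $\mathcal H_-$ the completion of $\mathcal H$ in the norm $\|T^{-1}\phi\|$. Let $(\Omega,\mathbb P)$ be a probability space and $\omega\mapsto H_\omega$ a measurable family of self-adjoint operators on $\mathcal H$ (all $\omega\mapsto\langle\phi,P_{B,\omega}\psi\rangle$ are measurable, where $P_{B,\omega}=\chi_B(H_\omega)$, $B\subset\mathbb R$ Borel) which is $\mathbb Z^d$-ergodic: there is an ergodic measure preserving action $\{\tau_a\}_{a\in\mathbb Z^d}$ of $\mathbb Z^d$ on $\Omega$ with $U(a)H_\omega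 U(a)^*=H_{\tau_a\omega}$ almost surely, where $U(a)$ is translation by $a$, possibly composed with multiplication by a phase (magnetic translations). Set $\mu^{(\kappa)}_\omega(B)=\|T_\kappa^{-1}P_{B,\omega}\|_2^2$ (Hilbert–Schmidt norm). For $x\in\mathbb Z^d$ and even $L>0$ let $H_{\omega,x,L}$ be self-adjoint operators on the $\mathrm L^2$ space of $\Lambda_L(x)$ (finite volume operators). Let $\Gamma_{x,L}$ be multiplication by the characteristic function of the belt $\overline{\Lambda}_{L-1}(x)\setminus\Lambda_{L-3}(x)$ (on $\mathbb Z^d$: of $\overline\Lambda_L(x)\setminus\Lambda_{L-2}(x)$, the inner and outer boundary layers). Let $\mathcal J\subset\mathbb R$ be an open interval, $\kappa_0>d/2$ and $\varrho>0$, and assume, with $T=T_{\kappa_0}$: * almost surely, $\{\phi\in\mathcal D(H_\omega)\cap\mathcal H_+:\ H_\omega\phi\in\mathcal H_+\}$ is dense in $\mathcal H_+$ and is an operator core for $H_\omega$; * for every compact interval $K\subset\mathcal J$ there is a constant $C_K<\infty$ with $\mu^{(\kappa_0)}_\omega(K)\le C_K$ almost surely; * for every compact interval $K\subset\mathcal J$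 there is a constant $\gamma_K$ such that, almost surely, $\|\chi_x\psi\|\le\gamma_K\,\|\Gamma_{x,L}(H_{\omega,x,L}-E)^{-1}\chi_{x,L/3}\|\,\|\Gamma_{x,L}\psi\|$ for all $E\in K$, all generalized eigenfunctions $\psi$ of $H_\omega$ with generalized eigenvalue $E$ (nonzero $\psi\in\mathcal H_-$ that are eigenfunctions, with eigenvalue $E$, of the closure of $H_\omega$ in $\mathcal H_-$), all $x\in\mathbb Z^d$ and all $L\in6\mathbb N$ with $E\notin\sigma(H_{\omega,x,L})$. For $m>0$ the box $\Lambda_L(x)$ is called $(\omega,m,E)$-regular if $E\notin\sigma(H_{\omega,x,L})$ and $\|\Gamma_{x,L}(H_{\omega,x,L}-E)^{-1}\chi_{x,L/3}\|\le e^{-mL/2}$. The *region of complete localization* $\Xi\subset\mathcal J$ is the set of $E\in\mathcal J$ for which there is an open interval $I'\subset\mathcal J$ containing $E$ such that for all $\zeta\in(0,1)$ and $\alpha\in(1,\zeta^{-1})$ there are $L_0\in6\mathbb N$ and $m>0$ such that the scales $L_{k+1}=\max\{L\in6\mathbb N:\ L\le L_k^\alpha\}$ tend to infinity and, for all $k\ge0$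 and all $x,y\in\mathbb Z^d$ with $|x-y|_\infty>L_k+\varrho$, the event "for every $E'\in I'$, $\Lambda_{L_k}(x)$ or $\Lambda_{L_k}(y)$ is $(\omega,m,E')$-regular" has probability at least $1-e^{-L_k^\zeta}$. **Statement.** Let $I$ be a nonempty bounded open interval with $\overline I\subset\Xi$. Then for $\mathbb P$-almost every $\omega$ the following holds. $H_\omega$ has pure point spectrum in $I$ (the eigenvectors with eigenvalue in $I$ span a dense subspace of $\operatorname{Ran}P_{I,\omega}$), and its eigenvalues in $I$ are at most countably many and of finite multiplicity. Let $E_1,E_2,\dots$ be the (finite or infinite) list of the distinct eigenvalues in $I$, and $\nu_1,\nu_2,\dots$ their multiplicities. **(i) SUDEC.** For all $\zeta\in(0,1)$, $\varepsilon>0$ and $\kappa\in(\frac d2,\frac{d+\varepsilon}2)$ there is a constant $C<\infty$ (depending on $I,\zeta,\varepsilon,\kappa,\omega$) such that, with $T=T_\kappa$, $$\|\chi_x\phi\|\|\chi_y\psi\|\le C\|T^{-1}\phi\|\|T^{-1}\psi\|\langle y\rangle^{d+\varepsilon}e^{-|x-y|^\zeta},$$ $$\|\chi_x\phi\|\|\chi_y\psi\|\le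 C\|T^{-1}\phi\|\|T^{-1}\psi\|\langle x\rangle^{\frac{d+\varepsilon}2}\langle y\rangle^{\frac{d+\varepsilon}2}e^{-|x-y|^\zeta}$$ for all $n$, all $\phi,\psi\in\operatorname{Ran}P_{\{E_n\},\omega}$ and all $x,y\in\mathbb Z^d$. **(ii) SULE.** There are centers of localization $y_n=y_{n,\omega}\in\mathbb Z^d$ such that for all $\zeta\in(0,1)$, $\varepsilon>0$ and $\kappa\in(\frac d2,2(d+\varepsilon))$ there is $C<\infty$ (depending on $I,\zeta,\varepsilon,\kappa,\omega$) such that, with $T=T_\kappa$, $$\|\chi_x\phi\|\le C\|T^{-1}\phi\|\langle y_n\rangle^{2(d+\varepsilon)}e^{-|x-y_n|^\zeta}$$ for all $n$, all $\phi\in\operatorname{Ran}P_{\{E_n\},\omega}$ and all $x\in\mathbb Z^d$. Moreover there is $C=C_{I,\omega}<\infty$ with $\sum_{n:\,|y_n|\le L}\nu_n\le C L^d$ for all $L\ge1$. **(iii) Complete orthonormal sets.** For each $n$ let $\{\phi_{n,j}\}_{1\le j\le\nu_n}$ be an orthonormal basis of $\operatorname{Ran}P_{\{E_n\},\omega}$.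 Then $\{\phi_{n,j}\}_{n,j}$ is orthonormal with closed span $\operatorname{Ran}P_{I,\omega}$. Put $\alpha_{n,j}=\|T_\kappa^{-1}\phi_{n,j}\|^2$. For $\zeta,\varepsilon,\kappa$ as in (i) there is $C<\infty$ (depending on $I,\zeta,\varepsilon,\kappa,\omega$ only) such that $$\|\chi_x\phi_{n,i}\|\|\chi_y\phi_{n,j}\|\le C\sqrt{\alpha_{n,i}}\sqrt{\alpha_{n,j}}\langle y\rangle^{d+\varepsilon}e^{-|x-y|^\zeta},$$ $$\|\chi_x\phi_{n,i}\|\|\chi_y\phi_{n,j}\|\le C\sqrt{\alpha_{n,i}}\sqrt{\alpha_{n,j}}\langle x\rangle^{\frac{d+\varepsilon}2}\langle y\rangle^{\frac{d+\varepsilon}2}e^{-|x-y|^\zeta}$$ for all $n$, all $i,j\in\{1,\dots,\nu_n\}$ and all $x,y\in\mathbb Z^d$; for $\zeta,\varepsilon,\kappa$ as in (ii), and the same centers, there is such a $C$ with $$\|\chi_x\phi_{n,j}\|\le C\sqrt{\alpha_{n,j}}\langle y_n\rangle^{2(d+\varepsilon)}e^{-|x-y_n|^\zeta}$$ for all $n$,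 $j$ and $x$. Finally, for every $\kappa>\frac d2$, $\sum_{j}\alpha_{n,j}=\mu^{(\kappa)}_\omega(\{E_n\})$ for all $n$, and $\sum_{n,j}\alpha_{n,j}=\sum_n\mu^{(\kappa)}_\omega(\{E_n\})=\mu^{(\kappa)}_\omega(I)<\infty$. -/

import Mathlib

open MeasureTheory Filter Topology Set
open scoped ENNReal NNReal InnerProductSpace

noncomputable section

namespace RandomLoc

/-! ### Space -/

/-- The ambient Euclidean space `ℝ^d`. -/
abbrev Sp (d : ℕ) : Type := EuclideanSpace ℝ (Fin d)

/-- The lattice `ℤ^d`. Its norm `‖x‖` is the sup norm. -/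
abbrev Lat (d : ℕ) : Type := Fin d → ℤ

/-- The inclusion `ℤ^d ⊂ ℝ^d`. -/
def pt {d : ℕ} (x : Lat d) : Sp d := WithLp.toLp 2 fun i => (x i : ℝ)

/-- The bracket `⟨u⟩ = √(1 + |u|²)`, with the Euclidean norm. -/
def jap {d : ℕ} (u : Sp d) : ℝ := Real.sqrt (1 + ‖u‖ ^ 2)

/-- The open cube of side `L` centered at `x`. -/
def cube {d : ℕ} (x : Lat d) (L : ℝ) : Set (Sp d) := {u | ∀ i, |u i - x i| < L / 2}

/-- The closed cube of side `L` centered at `x`. -/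
def closedCube {d : ℕ} (x : Lat d) (L : ℝ) : Set (Sp d) := {u | ∀ i, |u i - x i| ≤ L / 2}

theorem measurableSet_cube {d : ℕ} (x : Lat d) (L : ℝ) : MeasurableSet (cube x L) := by
  have : cube x L = ⋂ i, {u : Sp d | |u i - x i| < L / 2} := by ext; simp [cube]
  rw [this]
  exact MeasurableSet.iInter fun i => measurableSet_lt (by fun_prop) measurable_const

theorem measurableSet_closedCube {d : ℕ} (x : Lat d) (L : ℝ) :
    MeasurableSet (closedCube x L) := by
  have : closedCube x L = ⋂ i, {u : Sp d | |u i - x i| ≤ L / 2} := by ext; simp [closedCube]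
  rw [this]
  exact MeasurableSet.iInter fun i => measurableSet_le (by fun_prop) measurable_const

/-- The two kinds of configuration space, `ℝ^d` and `ℤ^d`. -/
inductive Setting where
  | continuum
  | lattice

/-- Lebesgue measure on `ℝ^d`, respectively counting measure on `ℤ^d ⊂ ℝ^d`. -/
def Setting.vol (S : Setting) (d : ℕ) : Measure (Sp d) :=
  match S with
  | .continuum => volume
  | .lattice => Measure.sum fun x : Lat d => Measure.dirac (pt x)

/-- The belt along the boundary of the cube of side `L` centered at `x`. On the lattice it consists
of the inner and of the outer boundary layer of the box. -/
def Setting.belt (S : Setting) {d : ℕ} (x : Lat d) (L : ℝ) : Set (Sp d) :=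
  match S with
  | .continuum => closedCube x (L - 1) \ cube x (L - 3)
  | .lattice => closedCube x L \ cube x (L - 2)

theorem Setting.measurableSet_belt (S : Setting) {d : ℕ} (x : Lat d) (L : ℝ) :
    MeasurableSet (S.belt x L) := by
  cases S <;> exact (measurableSet_closedCube _ _).diff (measurableSet_cube _ _)

/-- The fibre `ℂ^n`. -/
abbrev Fib (n : ℕ) : Type := EuclideanSpace ℂ (Fin n)

/-- The Hilbert space `L²(ℝ^d, dx; ℂ^n)`, respectively `ℓ²(ℤ^d; ℂ^n)` (realized as `L²` of the
counting measure on `ℤ^d ⊂ ℝ^d`). -/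
abbrev Hilb (S : Setting) (d n : ℕ) : Type := Lp (Fib n) 2 (S.vol d)

/-- The Hilbert space of square integrable functions on the open cube of side `L` at `x`. -/
abbrev BoxHilb (S : Setting) (d n : ℕ) (x : Lat d) (L : ℝ) : Type :=
  Lp (Fib n) 2 ((S.vol d).restrict (cube x L))

/-- `‖χ_B f‖`, the `L²` norm of `f` on the set `B`. -/
def normOn (S : Setting) {d n : ℕ} (B : Set (Sp d)) (f : Sp d → Fib n) : ℝ :=
  (eLpNorm (B.indicator f) 2 (S.vol d)).toReal

/-- `‖χ_x f‖`, with `χ_x` the characteristic function of the open unit cube at `x ∈ ℤ^d`. -/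
def chiNorm (S : Setting) {d n : ℕ} (x : Lat d) (f : Sp d → Fib n) : ℝ := normOn S (cube x 1) f

/-- The function `u ↦ ⟨u⟩^s f(u)`. -/
def weighted {d n : ℕ} (s : ℝ) (f : Sp d → Fib n) : Sp d → Fib n := fun u => (jap u ^ s) • f u

/-- `f ∈ D(T^s)`, where `T^s` is multiplication by `⟨u⟩^s`: the weighted function is in `L²`.
With `T` multiplication by `⟨u⟩^κ`, the space `ℋ₊` is given by `s = κ`, the space `ℋ₋` (the
completion of `ℋ` in the norm `‖T⁻¹f‖`) by `s = -κ`. -/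
def MemW (S : Setting) {d n : ℕ} (s : ℝ) (f : Sp d → Fib n) : Prop :=
  MemLp (weighted s f) 2 (S.vol d)

/-- The norm `‖⟨u⟩^s f‖`. -/
def wNorm (S : Setting) {d n : ℕ} (s : ℝ) (f : Sp d → Fib n) : ℝ :=
  (eLpNorm (weighted s f) 2 (S.vol d)).toReal

/-- `‖T⁻¹ f‖`, with `T` multiplication by `⟨u⟩^κ`. -/
def TinvNorm (S : Setting) {d n : ℕ} (κ : ℝ) (f : Sp d → Fib n) : ℝ := wNorm S (-κ) f

/-- Multiplication by the characteristic function of `B`, as a linear map on `L²(μ)`. -/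
def mulIndLM {α F : Type*} [MeasurableSpace α] [NormedAddCommGroup F] [InnerProductSpace ℂ F]
    (μ : Measure α) {B : Set α} (hB : MeasurableSet B) : Lp F 2 μ →ₗ[ℂ] Lp F 2 μ where
  toFun f := ((Lp.memLp f).indicator hB).toLp (B.indicator f)
  map_add' f g := by
    rw [← MemLp.toLp_add]
    refine MemLp.toLp_congr _ _ ?_
    filter_upwards [Lp.coeFn_add f g] with u hu
    by_cases h : u ∈ B
    · simpa [h] using hu
    · simp [h]
  map_smul' c f := by
    rw [RingHom.id_apply, ← MemLp.toLp_const_smul]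
    refine MemLp.toLp_congr _ _ ?_
    filter_upwards [Lp.coeFn_smul c f] with u hu
    by_cases h : u ∈ B
    · simpa [h] using hu
    · simp [h]

theorem norm_mulIndLM_le {α F : Type*} [MeasurableSpace α] [NormedAddCommGroup F]
    [InnerProductSpace ℂ F] (μ : Measure α) {B : Set α} (hB : MeasurableSet B) (f : Lp F 2 μ) :
    ‖mulIndLM μ hB f‖ ≤ 1 * ‖f‖ := by
  have h1 : ‖mulIndLM μ hB f‖ = (eLpNorm (B.indicator f) 2 μ).toReal :=
    Lp.norm_toLp (B.indicator f) ((Lp.memLp f).indicator hB)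
  rw [one_mul, h1, Lp.norm_def]
  exact ENNReal.toReal_mono (Lp.memLp f).eLpNorm_ne_top (eLpNorm_indicator_le _)

/-- Multiplication by the characteristic function of `B`, as a bounded operator on `L²(μ)`. -/
def mulInd {α F : Type*} [MeasurableSpace α] [NormedAddCommGroup F] [InnerProductSpace ℂ F]
    (μ : Measure α) {B : Set α} (hB : MeasurableSet B) : Lp F 2 μ →L[ℂ] Lp F 2 μ :=
  (mulIndLM μ hB).mkContinuous 1 (norm_mulIndLM_le μ hB)

/-! ### Unbounded self-adjoint operators and their spectral measures -/

section Operators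

variable {K : Type*} [NormedAddCommGroup K] [InnerProductSpace ℂ K]

/-- The eigenspace `ker (A - E)`; this is the range of the spectral projection `χ_{{E}}(A)`. -/
def eigenspace (A : K →ₗ.[ℂ] K) (E : ℝ) : Submodule ℂ K where
  carrier := {φ | ∃ h : φ ∈ A.domain, A ⟨φ, h⟩ = (E : ℂ) • φ}
  zero_mem' := ⟨A.domain.zero_mem, by
    rw [smul_zero]; exact LinearPMap.map_zero A⟩
  add_mem' := by
    rintro φ ψ ⟨h, e⟩ ⟨h', e'⟩
    refine ⟨A.domain.add_mem h h', ?_⟩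
    rw [smul_add, ← e, ← e']
    exact LinearPMap.map_add A ⟨φ, h⟩ ⟨ψ, h'⟩
  smul_mem' := by
    rintro c φ ⟨h, e⟩
    refine ⟨A.domain.smul_mem c h, ?_⟩
    rw [smul_comm, ← e]
    exact LinearPMap.map_smul A c ⟨φ, h⟩

/-- The eigenvalues of `A` in `I`. -/
def eigenvaluesIn (A : K →ₗ.[ℂ] K) (I : Set ℝ) : Set ℝ := {E | E ∈ I ∧ eigenspace A E ≠ ⊥}

/-- `E` is not in the spectrum of `A`, and `R = (A - E)⁻¹`. -/
def IsResolvent (A : K →ₗ.[ℂ] K) (E : ℝ) (R : K →L[ℂ] K) : Prop :=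
  (∀ f : K, ∃ h : R f ∈ A.domain, A ⟨R f, h⟩ - (E : ℂ) • R f = f) ∧
  ∀ u : A.domain, R (A u - (E : ℂ) • (u : K)) = u

variable [CompleteSpace K]

/-- Projection-valued Borel measures on `ℝ` (only the values on Borel sets matter). -/
structure PVM (K : Type*) [NormedAddCommGroup K] [InnerProductSpace ℂ K] [CompleteSpace K] where
  proj : Set ℝ → K →L[ℂ] K
  selfAdjoint : ∀ B, MeasurableSet B → IsSelfAdjoint (proj B)
  inter : ∀ B C, MeasurableSet B → MeasurableSet C → proj (B ∩ C) = proj B ∘L proj C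
  univ : proj Set.univ = ContinuousLinearMap.id ℂ K
  iUnion : ∀ B : ℕ → Set ℝ, (∀ k, MeasurableSet (B k)) → Pairwise (fun j k => Disjoint (B j) (B k)) →
    ∀ φ, HasSum (fun k => proj (B k) φ) (proj (⋃ k, B k) φ)

theorem PVM.inner_nonneg (P : PVM K) {B : Set ℝ} (hB : MeasurableSet B) (φ : K) :
    0 ≤ (⟪φ, P.proj B φ⟫_ℂ).re := by
  have h1 : P.proj B φ = P.proj B (P.proj B φ) := by
    conv_lhs => rw [← Set.inter_self B, P.inter B B hB hB]
    rfl
  have h2 : ⟪φ, P.proj B (P.proj B φ)⟫_ℂ = ⟪P.proj B φ, P.proj B φ⟫_ℂ := by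
    rw [← ContinuousLinearMap.adjoint_inner_left, (P.selfAdjoint B hB).adjoint_eq]
  rw [h1, h2]
  exact inner_self_nonneg (𝕜 := ℂ)

/-- The scalar spectral measure `B ↦ ⟨φ, P(B) φ⟩`. -/
def PVM.scalarMeasure (P : PVM K) (φ : K) : Measure ℝ :=
  Measure.ofMeasurable (fun B _ => ENNReal.ofReal (⟪φ, P.proj B φ⟫_ℂ).re)
    (by
      have h := P.iUnion (fun _ => ∅) (fun _ => MeasurableSet.empty)
        (fun _ _ _ => disjoint_bot_left) φ
      have h0 : P.proj ∅ φ = 0 := tendsto_nhds_unique tendsto_const_nhds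
        h.summable.tendsto_atTop_zero
      simp [h0])
    (fun B hB hd => by
      have h := P.iUnion B hB hd φ
      have h1 : HasSum (fun k => (⟪φ, P.proj (B k) φ⟫_ℂ).re) (⟪φ, P.proj (⋃ k, B k) φ⟫_ℂ).re :=
        Complex.hasSum_re (h.mapL (innerSL ℂ φ))
      rw [← h1.tsum_eq]
      exact ENNReal.ofReal_tsum_of_nonneg (fun k => P.inner_nonneg (hB k) φ) h1.summable)

/-- `A = ∫ t dP(t)`, i.e. `P(B) = χ_B(A)` for all Borel sets `B`. For a given self-adjoint `A`
there is exactly one such `P`. -/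
def PVM.IsSpectralMeasureOf (P : PVM K) (A : K →ₗ.[ℂ] K) : Prop :=
  (∀ φ : K, φ ∈ A.domain ↔ ∫⁻ t, ENNReal.ofReal (t ^ 2) ∂(P.scalarMeasure φ) < ⊤) ∧
  ∀ φ : A.domain, ⟪(φ : K), A φ⟫_ℂ = ((∫ t, t ∂(P.scalarMeasure (φ : K)) : ℝ) : ℂ)

end Operators

/-! ### Random operators -/

/-- `φ' = U(a) φ`, where `(U(a) φ)(u) = exp(i θ(u)) φ(u - a)`. Ordinary translations have phase
`θ = 0`, magnetic translations have a nontrivial phase. -/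
def IsTranslate {S : Setting} {d n : ℕ} (a : Lat d) (θ : Sp d → ℝ) (φ φ' : Hilb S d n) : Prop :=
  ∀ᵐ u ∂(S.vol d), φ' u = Complex.exp (Complex.I * θ u) • φ (u - pt a)

/-- A `ℤ^d`-ergodic measurable family `ω ↦ H_ω` of self-adjoint operators on `ℋ`, together with the
spectral projections `P_{B,ω} = χ_B(H_ω)`. -/
structure RandomOperator (S : Setting) (d n : ℕ) {Ω : Type*} [MeasurableSpace Ω]
    (ℙ : Measure Ω) where
  /-- The operators `H_ω`. -/
  H : Ω → (Hilb S d n →ₗ.[ℂ] Hilb S d n)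
  selfAdjoint : ∀ ω, IsSelfAdjoint (H ω)
  /-- The spectral measure of `H_ω`. -/
  P : Ω → PVM (Hilb S d n)
  spectral : ∀ ω, (P ω).IsSpectralMeasureOf (H ω)
  measurable : ∀ B, MeasurableSet B → ∀ φ ψ : Hilb S d n,
    Measurable fun ω => ⟪φ, (P ω).proj B ψ⟫_ℂ
  /-- The measure preserving ergodic action of `ℤ^d` on the probability space. -/
  τ : Lat d → Ω → Ω
  τ_zero : τ 0 = id
  τ_add : ∀ a b, τ (a + b) = τ a ∘ τ b
  measurePreserving : ∀ a, MeasurePreserving (τ a) ℙ ℙ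
  ergodic : ∀ s, MeasurableSet s → (∀ a, τ a ⁻¹' s = s) → ℙ s = 0 ∨ ℙ s = 1
  /-- The phases of the (magnetic) translations. -/
  θ : Lat d → Sp d → ℝ
  measurable_θ : ∀ a, Measurable (θ a)
  /-- `U(a) H_ω U(a)* = H_{τ_a ω}`, expressed through the graphs. -/
  covariant : ∀ a, ∀ᵐ ω ∂ℙ, ∀ φ ψ φ' ψ' : Hilb S d n,
    IsTranslate a (θ a) φ φ' → IsTranslate a (θ a) ψ ψ' →
      ((φ, ψ) ∈ (H ω).graph ↔ (φ', ψ') ∈ (H (τ a ω)).graph)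

/-- A choice of finite volume operators `H_{ω,x,L}`, self-adjoint operators on the square integrable
functions on the cubes with center `x ∈ ℤ^d` and even side `L`. -/
structure FiniteVolume (S : Setting) (d n : ℕ) (Ω : Type*) where
  H : Ω → (x : Lat d) → (L : ℕ) → (BoxHilb S d n x L →ₗ.[ℂ] BoxHilb S d n x L)
  selfAdjoint : ∀ ω x L, 0 < L → Even L → IsSelfAdjoint (H ω x L)

/-- The random measure `μ_ω(B) = tr (T⁻¹ P_{B,ω} T⁻¹) = ‖T⁻¹ P_{B,ω}‖₂²`, where the square of the
Hilbert-Schmidt norm of `A` is the supremum of `∑ ‖A v_i‖²` over finite orthonormal families. -/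
def RandomOperator.mu {S : Setting} {d n : ℕ} {Ω : Type*} [MeasurableSpace Ω] {ℙ : Measure Ω}
    (X : RandomOperator S d n ℙ) (κ : ℝ) (ω : Ω) (B : Set ℝ) : ℝ≥0∞ :=
  ⨆ (k : ℕ) (v : Fin k → Hilb S d n) (_ : Orthonormal ℂ v),
    ∑ i, ENNReal.ofReal (TinvNorm S κ ((X.P ω).proj B (v i)) ^ 2)

/-- `ψ` is a generalized eigenfunction of `A` with generalized eigenvalue `E`: a nonzero element of
`ℋ₋` which is an eigenfunction of the closure of `A` in `ℋ₋`. -/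
def IsGenEigenfunction {S : Setting} {d n : ℕ} (κ : ℝ) (A : Hilb S d n →ₗ.[ℂ] Hilb S d n)
    (E : ℝ) (ψ : Sp d → Fib n) : Prop :=
  MemW S (-κ) ψ ∧ (¬ ψ =ᵐ[S.vol d] 0) ∧ ∃ φ : ℕ → A.domain,
    Tendsto (fun k => TinvNorm S κ fun u => (φ k : Hilb S d n) u - ψ u) atTop (𝓝 0) ∧
    Tendsto (fun k => TinvNorm S κ fun u => A (φ k) u - (E : ℂ) • ψ u) atTop (𝓝 0)

/-- `D₊ = {φ ∈ D(A) ∩ ℋ₊ ; A φ ∈ ℋ₊}`. -/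
def Dplus {S : Setting} {d n : ℕ} (κ : ℝ) (A : Hilb S d n →ₗ.[ℂ] Hilb S d n) : Set A.domain :=
  {φ | MemW S κ (φ : Hilb S d n) ∧ MemW S κ (A φ)}

/-- The operator `Γ_{x,L} R χ_{x,L/3}` on the functions on the cube of side `L` at `x`. -/
def beltOp {S : Setting} {d n : ℕ} (x : Lat d) (L : ℕ)
    (R : BoxHilb S d n x L →L[ℂ] BoxHilb S d n x L) :
    BoxHilb S d n x L →L[ℂ] BoxHilb S d n x L :=
  mulInd _ (S.measurableSet_belt x L) ∘L R ∘L mulInd _ (measurableSet_cube x ((L : ℝ) / 3))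

/-- The standing assumptions on the random operator and its finite volume operators in the open
energy interval `J` that concern the generalized eigenfunction expansion and the eigenfunction decay
inequality. The number `ϱ` is the range beyond which boxes are considered separated. -/
structure Assumptions {S : Setting} {d n : ℕ} {Ω : Type*} [MeasurableSpace Ω] {ℙ : Measure Ω}
    (X : RandomOperator S d n ℙ) (V : FiniteVolume S d n Ω) (J : Set ℝ) (κ ϱ : ℝ) : Prop where
  isOpen : IsOpen J
  ordConnected : J.OrdConnected
  kappa : (d : ℝ) / 2 < κ
  rho : 0 < ϱ
  /-- `D₊` is dense in `ℋ₊`. -/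
  dense_Dplus : ∀ᵐ ω ∂ℙ, ∀ φ : Hilb S d n, MemW S κ φ → ∀ δ > 0, ∃ v ∈ Dplus κ (X.H ω),
    wNorm S κ (fun u => (v : Hilb S d n) u - φ u) < δ
  /-- `D₊` is an operator core for `H_ω`. -/
  core : ∀ᵐ ω ∂ℙ, ∀ φ : (X.H ω).domain, ∀ δ > 0, ∃ v ∈ Dplus κ (X.H ω),
    ‖(v : Hilb S d n) - φ‖ < δ ∧ ‖X.H ω v - X.H ω φ‖ < δ
  /-- The trace estimate. -/
  trace_estimate : ∀ a b : ℝ, Icc a b ⊆ J → ∃ C : ℝ≥0, ∀ᵐ ω ∂ℙ, X.mu κ ω (Icc a b) ≤ C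
  /-- The eigenfunction decay inequality. -/
  edi : ∀ a b : ℝ, Icc a b ⊆ J → ∃ γ : ℝ, ∀ᵐ ω ∂ℙ, ∀ E ∈ Icc a b, ∀ ψ : Sp d → Fib n,
    IsGenEigenfunction κ (X.H ω) E ψ → ∀ (x : Lat d) (L : ℕ), 0 < L → 6 ∣ L →
      ∀ R, IsResolvent (V.H ω x L) E R →
        chiNorm S x ψ ≤ γ * ‖beltOp x L R‖ * normOn S (S.belt x L) ψ

/-! ### The region of complete localization -/

/-- The box of side `L` at `x` is `(ω, m, E)`-regular: `E` is not in the spectrum of `H_{ω,x,L}` and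
`‖Γ_{x,L} (H_{ω,x,L} - E)⁻¹ χ_{x,L/3}‖ ≤ exp(- m L / 2)`. -/
def IsRegular {S : Setting} {d n : ℕ} {Ω : Type*} (V : FiniteVolume S d n Ω) (ω : Ω) (m E : ℝ)
    (x : Lat d) (L : ℕ) : Prop :=
  ∃ R, IsResolvent (V.H ω x L) E R ∧ ‖beltOp x L R‖ ≤ Real.exp (-(m * (L : ℝ) / 2))

/-- The event `R(m, L, I, x, y)`: for every `E ∈ I`, the box of side `L` at `x` or the one at `y` is
`(ω, m, E)`-regular. -/
def regularEvent {S : Setting} {d n : ℕ} {Ω : Type*} (V : FiniteVolume S d n Ω) (m : ℝ) (L : ℕ)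
    (I : Set ℝ) (x y : Lat d) : Set Ω :=
  {ω | ∀ E ∈ I, IsRegular V ω m E x L ∨ IsRegular V ω m E y L}

/-- The scales `L_{k+1} = max {L ∈ 6ℕ ; L ≤ L_k ^ α}`. -/
def scale (α : ℝ) (L₀ : ℕ) : ℕ → ℕ
  | 0 => L₀
  | k + 1 => 6 * ⌊((scale α L₀ k : ℕ) : ℝ) ^ α / 6⌋₊

/-- The region of complete localization in the open interval `J`. The probability of the event
`R(m, L_k, I, x, y)` is required to be at least `1 - exp(- L_k ^ ζ)`; this is written through the
complement, so that it has the right meaning whether or not the event is measurable. -/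
def completeLocalization {S : Setting} {d n : ℕ} {Ω : Type*} [MeasurableSpace Ω] (ℙ : Measure Ω)
    (V : FiniteVolume S d n Ω) (J : Set ℝ) (ϱ : ℝ) : Set ℝ :=
  {E | E ∈ J ∧ ∃ I : Set ℝ, IsOpen I ∧ I.OrdConnected ∧ I ⊆ J ∧ E ∈ I ∧
    ∀ ζ ∈ Ioo (0 : ℝ) 1, ∀ α ∈ Ioo 1 ζ⁻¹, ∃ L₀ : ℕ, 0 < L₀ ∧ 6 ∣ L₀ ∧
      Tendsto (scale α L₀) atTop atTop ∧ ∃ m : ℝ, 0 < m ∧ ∀ (k : ℕ) (x y : Lat d),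
        (scale α L₀ k : ℝ) + ϱ < ‖x - y‖ →
          ℙ (regularEvent V m (scale α L₀ k) I x y)ᶜ ≤
            ENNReal.ofReal (Real.exp (-((scale α L₀ k : ℝ) ^ ζ)))}

/-- `exp(-|x - y|^ζ)`, with the Euclidean norm. -/
def subexp {d : ℕ} (ζ : ℝ) (x y : Lat d) : ℝ := Real.exp (-(‖pt x - pt y‖ ^ ζ))

/-- `α = ‖T⁻¹ φ‖²`. -/
def alpha (S : Setting) {d n : ℕ} (κ : ℝ) (φ : Hilb S d n) : ℝ := TinvNorm S κ φ ^ 2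

/-- A choice of an orthonormal basis of the eigenspace of each eigenvalue of `A` in `I`. -/
abbrev EigenBases {S : Setting} {d n : ℕ} (A : Hilb S d n →ₗ.[ℂ] Hilb S d n) (I : Set ℝ) : Type :=
  (E : eigenvaluesIn A I) →
    OrthonormalBasis (Fin (Module.finrank ℂ (eigenspace A (E : ℝ)))) ℂ (eigenspace A (E : ℝ))

/-- The eigenfunctions `φ_{E,j}` of such a choice. -/
def EigenBases.vec {S : Setting} {d n : ℕ} {A : Hilb S d n →ₗ.[ℂ] Hilb S d n} {I : Set ℝ}
    (b : EigenBases A I) (E : eigenvaluesIn A I)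
    (j : Fin (Module.finrank ℂ (eigenspace A (E : ℝ)))) : Hilb S d n := (b E j : Hilb S d n)

end RandomLoc

end

/-!
Almost sure localization for an ergodic random operator whose finite volume resolvents satisfy a
multiscale estimate.

The probabilistic input is used once. By compactness of `[a, b]` and a Borel–Cantelli argument over
pairs of lattice points, almost surely any two points `x`, `y` whose distance is large (compared
with a power of `log ⟨y⟩`) satisfy, at every energy, that a box of a suitable scale around `x` or
around `y` is regular; this is `ae_localized`, with `Localized` as conclusion. The eigenfunction
decay inequality turns a regular box around a point into smallness, there, of *all* generalized
eigenfunctions with that energy. So for every energy `E` and all `x`, `y`, either all of them are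
small at `x` or all of them are small at `y`, up to a polynomial factor in `⟨y⟩` which covers the
pairs that are not distant enough (`Localized.dichotomy`). This alternative does not mention an
individual function, and the rest of the argument reads everything off from it:

* a generalized eigenfunction that does not vanish at `y` decays around `y`, so that it is square
  integrable, and by the core hypothesis it is an eigenfunction;
* `‖χ_x φ‖ ‖χ_y ψ‖` is small, for eigenfunctions with the same energy, because one of the factors
  is, which is SUDEC (`Localized.sudec`);
* a point where the local norm of one eigenfunction of `E` is largest is a center of localization
  for the whole eigenspace, which is SULE (`Localized.exists_sule`).

For pure point spectrum, generalized eigenfunctions have to exist. The trace measure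
`B ↦ tr (T⁻¹ P(B) T⁻¹)` is finite on compact subsets of `J`, and up to constants it dominates the
spectral measures of the vectors `T⁻¹ g`. At almost every energy where such a spectral measure has
positive density with respect to the trace measure, the vectors `P(B) T⁻¹ g` divided by the trace
measure of `B`, with `B` shrinking to that energy, have weak limits (after applying `T⁻¹`) that give
nonzero generalized eigenfunctions (`PVM.IsSpectralMeasureOf.exists_generalized_eigenvector`).
Hence the spectral measures live on the set of eigenvalues, which is countable.

Finite multiplicity, the count of the centers and the finiteness of `μ(I)` come from covariance:
translating the trace estimate bounds `∑ ‖χ_x φ‖²`, over an orthonormal family of eigenfunctions,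
uniformly in `x`. By SULE a normalized eigenfunction with center within distance `L` of the origin
has at least half of its mass within a distance of order `L`, so that an orthonormal family has at
most `C L ^ d` of them. The trace identities are the Hilbert–Schmidt norm of `T⁻¹ P(B)` computed in
an orthonormal basis of eigenfunctions.
-/

noncomputable section

namespace RandomLoc

/-! ### Projection-valued measures and spectral calculus -/

section Spectral

variable {K : Type*} [NormedAddCommGroup K] [InnerProductSpace ℂ K] [CompleteSpace K]

theorem PVM.proj_proj (P : PVM K) {B C : Set ℝ} (hB : MeasurableSet B) (hC : MeasurableSet C)
    (φ : K) : P.proj B (P.proj C φ) = P.proj (B ∩ C) φ := by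
  rw [P.inter B C hB hC]; rfl

theorem PVM.proj_idem (P : PVM K) {B : Set ℝ} (hB : MeasurableSet B) (φ : K) :
    P.proj B (P.proj B φ) = P.proj B φ := by
  rw [P.proj_proj hB hB, Set.inter_self]

theorem PVM.inner_proj_left (P : PVM K) {B : Set ℝ} (hB : MeasurableSet B) (φ ψ : K) :
    ⟪P.proj B φ, ψ⟫_ℂ = ⟪φ, P.proj B ψ⟫_ℂ := by
  rw [← ContinuousLinearMap.adjoint_inner_right, (P.selfAdjoint B hB).adjoint_eq]

theorem PVM.inner_proj_self (P : PVM K) {B : Set ℝ} (hB : MeasurableSet B) (φ : K) :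
    ⟪φ, P.proj B φ⟫_ℂ = ((‖P.proj B φ‖ ^ 2 : ℝ) : ℂ) := by
  rw [← P.proj_idem hB, ← P.inner_proj_left hB, P.proj_idem hB, inner_self_eq_norm_sq_to_K]
  simp

theorem PVM.proj_empty (P : PVM K) (φ : K) : P.proj ∅ φ = 0 := by
  have h := P.iUnion (fun _ => ∅) (fun _ => MeasurableSet.empty)
    (fun _ _ _ => disjoint_bot_left) φ
  exact tendsto_nhds_unique tendsto_const_nhds h.summable.tendsto_atTop_zero

theorem PVM.scalarMeasure_apply (P : PVM K) {B : Set ℝ} (hB : MeasurableSet B) (φ : K) :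
    P.scalarMeasure φ B = ‖P.proj B φ‖ₑ ^ 2 := by
  rw [PVM.scalarMeasure, Measure.ofMeasurable_apply B hB, P.inner_proj_self hB, Complex.ofReal_re,
    ENNReal.ofReal_pow (norm_nonneg _), ofReal_norm]

theorem PVM.proj_univ (P : PVM K) (φ : K) : P.proj Set.univ φ = φ := by
  rw [P.univ]; rfl

theorem PVM.scalarMeasure_univ (P : PVM K) (φ : K) :
    P.scalarMeasure φ Set.univ = ‖φ‖ₑ ^ 2 := by
  rw [P.scalarMeasure_apply MeasurableSet.univ, P.proj_univ]

instance PVM.isFiniteMeasure_scalarMeasure (P : PVM K) (φ : K) :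
    IsFiniteMeasure (P.scalarMeasure φ) :=
  ⟨by rw [P.scalarMeasure_univ]; exact ENNReal.pow_lt_top enorm_lt_top⟩

theorem PVM.scalarMeasure_eq_zero_iff (P : PVM K) {B : Set ℝ} (hB : MeasurableSet B) (φ : K) :
    P.scalarMeasure φ B = 0 ↔ P.proj B φ = 0 := by
  rw [P.scalarMeasure_apply hB]; simp

theorem PVM.proj_add_proj_compl (P : PVM K) {B : Set ℝ} (hB : MeasurableSet B) (φ : K) :
    P.proj B φ + P.proj Bᶜ φ = φ := by
  set u := φ - (P.proj B φ + P.proj Bᶜ φ) with hu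
  have h1 : P.proj B u = 0 := by
    simp [hu, P.proj_proj hB hB, P.proj_proj hB hB.compl, P.proj_empty]
  have h2 : P.proj Bᶜ u = 0 := by
    simp [hu, P.proj_proj hB.compl hB.compl, P.proj_proj hB.compl hB, P.proj_empty]
  have h3 : P.scalarMeasure u Set.univ = 0 := by
    rw [← measure_add_measure_compl hB, (P.scalarMeasure_eq_zero_iff hB u).2 h1,
      (P.scalarMeasure_eq_zero_iff hB.compl u).2 h2, add_zero]
  rw [P.scalarMeasure_univ] at h3
  have h4 : u = 0 := by simpa using h3
  exact (sub_eq_zero.1 (hu ▸ h4)).symm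

theorem PVM.proj_compl (P : PVM K) {B : Set ℝ} (hB : MeasurableSet B) (φ : K) :
    P.proj Bᶜ φ = φ - P.proj B φ :=
  eq_sub_of_add_eq' (P.proj_add_proj_compl hB φ)

theorem PVM.proj_eq_self_of_subset (P : PVM K) {B C : Set ℝ} (hB : MeasurableSet B)
    (hC : MeasurableSet C) (hBC : B ⊆ C) {φ : K} (h : P.proj B φ = φ) : P.proj C φ = φ := by
  rw [← h, P.proj_proj hC hB, Set.inter_eq_right.2 hBC]

theorem PVM.scalarMeasure_proj (P : PVM K) {B : Set ℝ} (hB : MeasurableSet B) (φ : K) :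
    P.scalarMeasure (P.proj B φ) = (P.scalarMeasure φ).restrict B := by
  ext C hC
  rw [Measure.restrict_apply hC, P.scalarMeasure_apply hC, P.scalarMeasure_apply (hC.inter hB),
    P.proj_proj hC hB]

/-- Scalar spectral measures are additive on vectors with disjoint spectral supports. -/
theorem PVM.scalarMeasure_add (P : PVM K) {B : Set ℝ} (hB : MeasurableSet B) {u v : K}
    (hu : P.proj B u = u) (hv : P.proj B v = 0) :
    P.scalarMeasure (u + v) = P.scalarMeasure u + P.scalarMeasure v := by
  have hv' : P.proj Bᶜ v = v := by rw [P.proj_compl hB, hv, sub_zero]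
  ext C hC
  rw [Measure.add_apply]
  simp only [P.scalarMeasure_apply hC]
  have h0 : ⟪P.proj C u, P.proj C v⟫_ℂ = 0 := by
    rw [← hu, ← hv', P.inner_proj_left hC, P.proj_idem hC, P.inner_proj_left hB,
      P.proj_proj hC hB.compl, P.proj_proj hB (hC.inter hB.compl)]
    have : B ∩ (C ∩ Bᶜ) = ∅ := by ext; simp; tauto
    rw [this, P.proj_empty, inner_zero_right]
  have h1 := norm_add_sq_eq_norm_sq_add_norm_sq_of_inner_eq_zero _ _ h0
  rw [map_add, ← ofReal_norm, ← ofReal_norm, ← ofReal_norm,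
    ← ENNReal.ofReal_pow (norm_nonneg _), ← ENNReal.ofReal_pow (norm_nonneg _),
    ← ENNReal.ofReal_pow (norm_nonneg _), ← ENNReal.ofReal_add (by positivity) (by positivity)]
  congr 1
  linarith

/-- A self-adjoint operator is symmetric. -/
theorem inner_apply_symm {A : K →ₗ.[ℂ] K} (hA : IsSelfAdjoint A) (u v : A.domain) :
    ⟪A u, (v : K)⟫_ℂ = ⟪(u : K), A v⟫_ℂ := by
  have h := A.adjoint_isFormalAdjoint hA.dense_domain
  rw [LinearPMap.isSelfAdjoint_def.1 hA] at h
  exact h u v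

section SpectralMeasure

variable {P : PVM K} {A : K →ₗ.[ℂ] K} (hP : P.IsSpectralMeasureOf A)

include hP

theorem PVM.IsSpectralMeasureOf.proj_mem_domain {B : Set ℝ} (hB : MeasurableSet B) {φ : K}
    (hφ : φ ∈ A.domain) : P.proj B φ ∈ A.domain := by
  rw [hP.1, P.scalarMeasure_proj hB]
  exact (lintegral_mono' Measure.restrict_le_self le_rfl).trans_lt ((hP.1 φ).1 hφ)

theorem PVM.IsSpectralMeasureOf.proj_mem_domain_of_subset {B : Set ℝ} (hB : MeasurableSet B)
    {l r : ℝ} (hBr : B ⊆ Icc l r) (φ : K) : P.proj B φ ∈ A.domain := by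
  rw [hP.1, P.scalarMeasure_proj hB]
  have h : ∀ t ∈ B, ENNReal.ofReal (t ^ 2) ≤ ENNReal.ofReal (max (l ^ 2) (r ^ 2)) := by
    intro t ht
    apply ENNReal.ofReal_le_ofReal
    obtain ⟨h1, h2⟩ := hBr ht
    rcases le_total 0 t with h0 | h0
    · exact le_max_of_le_right (by nlinarith)
    · exact le_max_of_le_left (by nlinarith)
  calc _ ≤ ∫⁻ _ in B, ENNReal.ofReal (max (l ^ 2) (r ^ 2)) ∂(P.scalarMeasure φ) :=
        setLIntegral_mono measurable_const h
    _ < ⊤ := by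
        rw [setLIntegral_const]
        exact ENNReal.mul_lt_top ENNReal.ofReal_lt_top (measure_lt_top _ _)

theorem PVM.IsSpectralMeasureOf.integrable_id (φ : A.domain) :
    Integrable (fun t : ℝ => t) (P.scalarMeasure (φ : K)) := by
  have h : MemLp (fun t : ℝ => t) 2 (P.scalarMeasure (φ : K)) := by
    refine ⟨measurable_id.aestronglyMeasurable, ?_⟩
    rw [eLpNorm_lt_top_iff_lintegral_rpow_enorm_lt_top (by norm_num) (by norm_num)]
    have := (hP.1 φ).1 φ.2
    convert this using 3 with t
    rw [ENNReal.toReal_ofNat, ENNReal.rpow_ofNat, Real.enorm_eq_ofReal_abs,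
      ← ENNReal.ofReal_pow (abs_nonneg _), sq_abs]
  exact h.integrable (by norm_num)

/-- A spectral subspace and its orthogonal complement are not coupled by the operator. -/
theorem PVM.IsSpectralMeasureOf.inner_apply_eq_zero (hA : IsSelfAdjoint A) {B : Set ℝ}
    (hB : MeasurableSet B) {u v : A.domain} (hu : P.proj B (u : K) = u)
    (hv : P.proj B (v : K) = 0) : ⟪(u : K), A v⟫_ℂ = 0 := by
  have key : ∀ w : A.domain, P.proj B (w : K) = 0 → (⟪(u : K), A w⟫_ℂ).re = 0 := by
    intro w hw
    have h1 := hP.2 (u + w)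
    have h2 := hP.2 u
    have h3 := hP.2 w
    have hi := integral_add_measure (hP.integrable_id u) (hP.integrable_id w)
    rw [← P.scalarMeasure_add hB hu hw] at hi
    rw [LinearPMap.map_add, Submodule.coe_add, inner_add_left, inner_add_right, inner_add_right, hi,
      h2, h3, ← inner_apply_symm hA w u, ← inner_conj_symm (A w) (u : K)] at h1
    have h4 := congrArg Complex.re h1
    simp only [Complex.add_re, Complex.conj_re, Complex.ofReal_re] at h4
    linarith
  have hc := key (⟪A v, (u : K)⟫_ℂ • v) (by
    rw [Submodule.coe_smul, map_smul, hv, smul_zero])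
  rw [LinearPMap.map_smul, inner_smul_right, ← inner_conj_symm (A v) (u : K), mul_comm,
    Complex.mul_conj, Complex.ofReal_re] at hc
  exact Complex.normSq_eq_zero.1 hc

theorem PVM.IsSpectralMeasureOf.proj_apply_eq_zero (hA : IsSelfAdjoint A) {B : Set ℝ}
    (hB : MeasurableSet B) {v : A.domain} (hv : P.proj B (v : K) = 0) : P.proj B (A v) = 0 := by
  refine hA.dense_domain.eq_zero_of_inner_right (𝕜 := ℂ) fun φ hφ => ?_
  rw [← P.inner_proj_left hB]
  exact hP.inner_apply_eq_zero hA hB (u := ⟨P.proj B φ, hP.proj_mem_domain hB hφ⟩)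
    (P.proj_idem hB φ) hv

theorem PVM.IsSpectralMeasureOf.proj_apply_of_mem (hA : IsSelfAdjoint A) {B : Set ℝ}
    (hB : MeasurableSet B) {v : A.domain} (hv : P.proj B (v : K) = v) : P.proj B (A v) = A v := by
  have h := hP.proj_apply_eq_zero hA hB.compl (v := v) (by
    rw [P.proj_compl hB, hv, sub_self])
  rw [P.proj_compl hB, sub_eq_zero] at h
  exact h.symm

/-- Spectral projections commute with the operator. -/
theorem PVM.IsSpectralMeasureOf.proj_apply (hA : IsSelfAdjoint A) {B : Set ℝ}
    (hB : MeasurableSet B) (v : A.domain) :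
    P.proj B (A v) = A ⟨P.proj B (v : K), hP.proj_mem_domain hB v.2⟩ := by
  set u : A.domain := ⟨P.proj B (v : K), hP.proj_mem_domain hB v.2⟩ with hu
  have h0 : P.proj B ((v - u : A.domain) : K) = 0 := by
    rw [Submodule.coe_sub, map_sub]
    simp [hu, P.proj_idem hB]
  have h1 := hP.proj_apply_eq_zero hA hB h0
  rw [LinearPMap.map_sub, map_sub, sub_eq_zero] at h1
  rw [h1]
  exact hP.proj_apply_of_mem hA hB (P.proj_idem hB _)

theorem PVM.IsSpectralMeasureOf.abs_form_le {B : Set ℝ}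
    (hB : MeasurableSet B) {l r : ℝ} (hBr : B ⊆ Icc (l - r) (l + r)) {u : A.domain}
    (hu : P.proj B (u : K) = u) :
    |(⟪(u : K), A u⟫_ℂ).re - l * ‖(u : K)‖ ^ 2| ≤ r * ‖(u : K)‖ ^ 2 := by
  have hm : (P.scalarMeasure (u : K)).real Set.univ = ‖(u : K)‖ ^ 2 := by
    rw [Measure.real, P.scalarMeasure_univ]; simp
  have h1 : (⟪(u : K), A u⟫_ℂ).re - l * ‖(u : K)‖ ^ 2
      = ∫ t, (t - l) ∂(P.scalarMeasure (u : K)) := by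
    rw [hP.2 u, Complex.ofReal_re, integral_sub (hP.integrable_id u) (integrable_const _),
      integral_const, hm, smul_eq_mul, mul_comm l]
  rw [h1, ← hm, ← Real.norm_eq_abs]
  refine norm_integral_le_of_norm_le_const ?_
  rw [← hu, P.scalarMeasure_proj hB]
  filter_upwards [ae_restrict_mem hB] with t ht
  obtain ⟨h2, h3⟩ := hBr ht
  rw [Real.norm_eq_abs, abs_le]
  constructor <;> linarith

/-- On the spectral subspace of a set within distance `r` of `l`, the operator differs from `l` by
at most `r` in norm. -/
theorem PVM.IsSpectralMeasureOf.norm_apply_sub_le (hA : IsSelfAdjoint A) {B : Set ℝ}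
    (hB : MeasurableSet B) {l r : ℝ} (hr : 0 < r) (hBr : B ⊆ Icc (l - r) (l + r)) {u : A.domain}
    (hu : P.proj B (u : K) = u) : ‖A u - (l : ℂ) • (u : K)‖ ≤ r * ‖(u : K)‖ := by
  set w : K := A u - (l : ℂ) • (u : K) with hw
  have hPw : P.proj B w = w := by
    rw [hw, map_sub, map_smul, hu, hP.proj_apply_of_mem hA hB hu]
  have hwd : w ∈ A.domain := hPw ▸ hP.proj_mem_domain_of_subset hB hBr w
  set w' : A.domain := ⟨w, hwd⟩ with hw'
  set s : ℝ := 1 / r with hs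
  -- polarization of the quadratic form of `A - l` at the vectors `u ± s w`
  have hplus := hP.abs_form_le hB hBr (u := u + (s : ℂ) • w') (by simp [hw', hu, hPw])
  have hminus := hP.abs_form_le hB hBr (u := u - (s : ℂ) • w') (by simp [hw', hu, hPw])
  rw [LinearPMap.map_add, LinearPMap.map_smul, Submodule.coe_add, Submodule.coe_smul] at hplus
  rw [LinearPMap.map_sub, LinearPMap.map_smul, Submodule.coe_sub, Submodule.coe_smul] at hminus
  have e1 : (⟪w, A u⟫_ℂ).re = ‖w‖ ^ 2 + l * (⟪w, (u : K)⟫_ℂ).re := by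
    have : A u = w + (l : ℂ) • (u : K) := by rw [hw]; abel
    rw [this, inner_add_right, inner_smul_right, inner_self_eq_norm_sq_to_K]
    simp [← Complex.ofReal_pow]
  have e2 : (⟪(u : K), A w'⟫_ℂ).re = (⟪w, A u⟫_ℂ).re := by
    rw [← inner_apply_symm hA u w', ← inner_conj_symm, Complex.conj_re]
  have n1 := norm_add_sq (𝕜 := ℂ) (u : K) ((s : ℂ) • w)
  have n2 := norm_sub_sq (𝕜 := ℂ) (u : K) ((s : ℂ) • w)
  have e3 : (⟪(u : K), w⟫_ℂ).re = (⟪w, (u : K)⟫_ℂ).re := by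
    rw [← inner_conj_symm, Complex.conj_re]
  have n3 : ‖(s : ℂ) • w‖ ^ 2 = s ^ 2 * ‖w‖ ^ 2 := by
    rw [norm_smul, mul_pow]; simp
  have hww : (w' : K) = w := rfl
  rw [hww] at hplus hminus
  simp only [inner_add_left, inner_add_right, inner_sub_left, inner_sub_right, inner_smul_left,
    inner_smul_right, Complex.conj_ofReal, Complex.add_re, Complex.sub_re,
    Complex.re_ofReal_mul, RCLike.re_to_complex, e1, e2, e3, n3] at hplus hminus n1 n2
  rw [n1] at hplus
  rw [n2] at hminus
  have p1 := (abs_le.1 hplus).2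
  have p2 := (abs_le.1 hminus).1
  have hsr : r * s = 1 := by rw [hs]; field_simp
  have h5 : 4 * s * ‖w‖ ^ 2 ≤ 2 * r * (‖(u : K)‖ ^ 2 + s ^ 2 * ‖w‖ ^ 2) := by nlinarith
  have h6 : ‖w‖ ^ 2 ≤ (r * ‖(u : K)‖) ^ 2 := by
    have h7 := mul_le_mul_of_nonneg_left h5 hr.le
    have h8 : r * (4 * s * ‖w‖ ^ 2) = 4 * ‖w‖ ^ 2 := by linear_combination 4 * ‖w‖ ^ 2 * hsr
    have h9 : r * (2 * r * (‖(u : K)‖ ^ 2 + s ^ 2 * ‖w‖ ^ 2))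
        = 2 * (r * ‖(u : K)‖) ^ 2 + 2 * ‖w‖ ^ 2 := by
      linear_combination 2 * ‖w‖ ^ 2 * (r * s + 1) * hsr
    rw [h8, h9] at h7
    linarith
  exact abs_le_of_sq_le_sq' h6 (by positivity) |>.2

theorem PVM.IsSpectralMeasureOf.mem_eigenspace_of_proj (hA : IsSelfAdjoint A) {E : ℝ} {φ : K}
    (hφ : P.proj {E} φ = φ) : φ ∈ eigenspace A E := by
  have hd : φ ∈ A.domain :=
    hφ ▸ hP.proj_mem_domain_of_subset (measurableSet_singleton E) (l := E) (r := E) (by simp) φ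
  refine ⟨hd, ?_⟩
  have h : ∀ r > 0, ‖A ⟨φ, hd⟩ - (E : ℂ) • φ‖ ≤ r * ‖φ‖ := fun r hr =>
    hP.norm_apply_sub_le hA (measurableSet_singleton E) hr
      (by rw [Set.singleton_subset_iff]; constructor <;> linarith) (u := ⟨φ, hd⟩) hφ
  have h0 : Tendsto (fun r : ℝ => r * ‖φ‖) (𝓝[>] 0) (𝓝 0) := by
    have : Tendsto (fun r : ℝ => r * ‖φ‖) (𝓝 0) (𝓝 (0 * ‖φ‖)) := tendsto_id.mul_const _
    rw [zero_mul] at this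
    exact this.mono_left nhdsWithin_le_nhds
  have h1 : ‖A ⟨φ, hd⟩ - (E : ℂ) • φ‖ ≤ 0 :=
    ge_of_tendsto h0 (by filter_upwards [self_mem_nhdsWithin] with r hr using h r hr)
  exact sub_eq_zero.1 (norm_le_zero_iff.1 h1)

/-- The eigenspace of `E` is the range of the spectral projection of `{E}`. -/
theorem PVM.IsSpectralMeasureOf.mem_eigenspace_iff (hA : IsSelfAdjoint A) {E : ℝ} {φ : K} :
    φ ∈ eigenspace A E ↔ P.proj {E} φ = φ := by
  refine ⟨?_, hP.mem_eigenspace_of_proj hA⟩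
  rintro ⟨hd, he⟩
  have key : ∀ B : Set ℝ, MeasurableSet B → (∫ t in B, (t - E) ∂(P.scalarMeasure φ)) = 0 := by
    intro B hB
    have h1 := hP.2 ⟨P.proj B φ, hP.proj_mem_domain hB hd⟩
    have hi := hP.integrable_id ⟨P.proj B φ, hP.proj_mem_domain hB hd⟩
    have hm : ((P.scalarMeasure φ).restrict B).real Set.univ = ‖P.proj B φ‖ ^ 2 := by
      rw [Measure.real, ← P.scalarMeasure_proj hB, P.scalarMeasure_univ]; simp
    simp only at h1 hi
    rw [← hP.proj_apply hA hB ⟨φ, hd⟩, he, map_smul, inner_smul_right,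
      inner_self_eq_norm_sq_to_K, P.scalarMeasure_proj hB] at h1
    rw [P.scalarMeasure_proj hB] at hi
    rw [integral_sub hi (integrable_const _), integral_const, hm, smul_eq_mul, sub_eq_zero]
    have h2 := congrArg Complex.re h1
    simp [← Complex.ofReal_pow] at h2
    linarith
  have hint : Integrable (fun t : ℝ => t - E) (P.scalarMeasure φ) :=
    (hP.integrable_id ⟨φ, hd⟩).sub (integrable_const _)
  have hgt : P.scalarMeasure φ (Ioi E) = 0 := by
    have h := (setIntegral_eq_zero_iff_of_nonneg_ae (μ := P.scalarMeasure φ) (s := Ioi E)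
      (f := fun t => t - E) (by
        filter_upwards [ae_restrict_mem measurableSet_Ioi] with t ht
        simpa using le_of_lt ht) hint.integrableOn).1 (key _ measurableSet_Ioi)
    rw [Filter.EventuallyEq, ae_restrict_iff' measurableSet_Ioi] at h
    refine measure_mono_null (fun t ht => ?_) (ae_iff.1 h)
    simp only [mem_ofPred_eq, Pi.zero_apply, not_forall]
    exact ⟨ht, (sub_pos.2 ht).ne'⟩
  have hlt : P.scalarMeasure φ (Iio E) = 0 := by
    have h := (setIntegral_eq_zero_iff_of_nonneg_ae (μ := P.scalarMeasure φ) (s := Iio E)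
      (f := fun t => -(t - E)) (by
        filter_upwards [ae_restrict_mem measurableSet_Iio] with t ht
        simpa using le_of_lt ht) hint.neg.integrableOn).1
        (by rw [integral_neg, key _ measurableSet_Iio, neg_zero])
    rw [Filter.EventuallyEq, ae_restrict_iff' measurableSet_Iio] at h
    refine measure_mono_null (fun t ht => ?_) (ae_iff.1 h)
    simp only [mem_ofPred_eq, Pi.zero_apply, not_forall]
    exact ⟨ht, (neg_pos.2 (sub_neg.2 ht)).ne'⟩
  have hc : P.scalarMeasure φ {E}ᶜ = 0 := by
    rw [← Iio_union_Ioi]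
    exact measure_union_null hlt hgt
  rw [P.scalarMeasure_eq_zero_iff (measurableSet_singleton E).compl,
    P.proj_compl (measurableSet_singleton E), sub_eq_zero] at hc
  exact hc.symm

theorem PVM.IsSpectralMeasureOf.proj_of_mem_eigenspace (hA : IsSelfAdjoint A) {E : ℝ} {φ : K}
    (hφ : φ ∈ eigenspace A E) {B : Set ℝ} (hB : MeasurableSet B) (hE : E ∈ B) :
    P.proj B φ = φ :=
  P.proj_eq_self_of_subset (measurableSet_singleton E) hB (by simpa using hE)
    ((hP.mem_eigenspace_iff hA).1 hφ)

end SpectralMeasure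

/-- Eigenvectors of a self-adjoint operator for distinct eigenvalues are orthogonal. -/
theorem inner_eq_zero_of_mem_eigenspace {A : K →ₗ.[ℂ] K} (hA : IsSelfAdjoint A) {E E' : ℝ}
    (hE : E ≠ E') {φ ψ : K} (hφ : φ ∈ eigenspace A E) (hψ : ψ ∈ eigenspace A E') :
    ⟪φ, ψ⟫_ℂ = 0 := by
  obtain ⟨h1, e1⟩ := hφ
  obtain ⟨h2, e2⟩ := hψ
  have h := inner_apply_symm hA ⟨φ, h1⟩ ⟨ψ, h2⟩
  rw [e1, e2, inner_smul_left, inner_smul_right, Complex.conj_ofReal] at h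
  have h3 : ((E : ℂ) - E') * ⟪φ, ψ⟫_ℂ = 0 := by rw [sub_mul, sub_eq_zero]; exact h
  rcases mul_eq_zero.1 h3 with h4 | h4
  · exact absurd (by exact_mod_cast sub_eq_zero.1 h4) hE
  · exact h4

end Spectral

/-! ### Hilbert-Schmidt sums -/

section HilbertSchmidt

variable {K : Type*} [NormedAddCommGroup K] [InnerProductSpace ℂ K]

theorem HilbertBasis.enorm_sq_eq_tsum {ι : Type*} (f : HilbertBasis ι ℂ K) (x : K) :
    ‖x‖ₑ ^ 2 = ∑' i, ‖⟪f i, x⟫_ℂ‖ₑ ^ 2 := by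
  have h := lp.hasSum_norm (p := 2) (by norm_num) (f.repr x)
  simp only [ENNReal.toReal_ofNat, Real.rpow_ofNat, LinearIsometryEquiv.norm_map,
    f.repr_apply_apply] at h
  have h2 := ENNReal.ofReal_tsum_of_nonneg (fun i => by positivity) h.summable
  rw [h.tsum_eq] at h2
  simpa [ENNReal.ofReal_pow, ofReal_norm] using h2

/-- Bessel's inequality for finite orthonormal families. -/
theorem Orthonormal.sum_enorm_inner_sq_le {ι : Type*} [Fintype ι] {v : ι → K}
    (hv : Orthonormal ℂ v) (x : K) : ∑ i, ‖⟪v i, x⟫_ℂ‖ₑ ^ 2 ≤ ‖x‖ₑ ^ 2 := by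
  have h := hv.sum_inner_products_le x (s := Finset.univ)
  have h2 := ENNReal.ofReal_le_ofReal h
  rw [ENNReal.ofReal_sum_of_nonneg (fun i _ => by positivity)] at h2
  simpa [ENNReal.ofReal_pow, ofReal_norm] using h2

variable [CompleteSpace K]

/-- Parseval's identity for an orthonormal family, on the closed span of the family. -/
theorem Orthonormal.enorm_sq_eq_tsum {ι : Type*} {e : ι → K} (he : Orthonormal ℂ e) {x : K}
    (hx : x ∈ (Submodule.span ℂ (Set.range e)).topologicalClosure) :
    ‖x‖ₑ ^ 2 = ∑' i, ‖⟪e i, x⟫_ℂ‖ₑ ^ 2 := by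
  set M := (Submodule.span ℂ (Set.range e)).topologicalClosure with hM
  have : CompleteSpace M := (Submodule.isClosed_topologicalClosure _).completeSpace_coe
  have hmem : ∀ i, e i ∈ M := fun i =>
    Submodule.le_topologicalClosure _ (Submodule.subset_span (Set.mem_range_self i))
  let e' : ι → M := fun i => ⟨e i, hmem i⟩
  have he' : Orthonormal ℂ e' := by
    refine ⟨fun i => he.1 i, fun i j hij => ?_⟩
    simpa [e', Submodule.coe_inner] using he.2 hij
  have hbot : (Submodule.span ℂ (Set.range e'))ᗮ = ⊥ := by
    rw [Submodule.eq_bot_iff]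
    intro y hy
    have h1 : ∀ i, ⟪e i, (y : K)⟫_ℂ = 0 := fun i =>
      (Submodule.mem_orthogonal _ y).1 hy (e' i) (Submodule.subset_span (Set.mem_range_self i))
    have h2 : (y : K) ∈ (Submodule.span ℂ (Set.range e))ᗮ := by
      rw [Submodule.mem_orthogonal]
      intro u hu
      induction hu using Submodule.span_induction with
      | mem u hu => obtain ⟨i, rfl⟩ := hu; exact h1 i
      | zero => simp
      | add u v _ _ hu hv => rw [inner_add_left, hu, hv, add_zero]
      | smul c u _ hu => rw [inner_smul_left, hu, mul_zero]
    rw [← Submodule.orthogonal_closure] at h2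
    have h3 := (Submodule.mem_orthogonal _ _).1 h2 (y : K) y.2
    exact Subtype.ext (inner_self_eq_zero.1 h3)
  have h := HilbertBasis.enorm_sq_eq_tsum (HilbertBasis.mkOfOrthogonalEqBot he' hbot) ⟨x, hx⟩
  have e1 : ‖(⟨x, hx⟩ : M)‖ₑ = ‖x‖ₑ := rfl
  rw [e1] at h
  simpa [e', Submodule.coe_inner] using h

theorem tsum_enorm_adjoint_sq {ι ι' : Type*} (f : HilbertBasis ι ℂ K) (f' : HilbertBasis ι' ℂ K)
    (A : K →L[ℂ] K) : ∑' i, ‖A (f i)‖ₑ ^ 2 = ∑' i, ‖A.adjoint (f' i)‖ₑ ^ 2 := by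
  simp_rw [HilbertBasis.enorm_sq_eq_tsum f' (A _), HilbertBasis.enorm_sq_eq_tsum f (A.adjoint _)]
  rw [ENNReal.tsum_comm]
  refine tsum_congr fun i => tsum_congr fun j => ?_
  rw [ContinuousLinearMap.adjoint_inner_right, ← inner_conj_symm, RCLike.enorm_conj]

/-- The operator norm is bounded by the Hilbert-Schmidt norm. -/
theorem enorm_apply_sq_le_tsum {ι : Type*} (f : HilbertBasis ι ℂ K) (A : K →L[ℂ] K) (h : K) :
    ‖A h‖ₑ ^ 2 ≤ (∑' i, ‖A (f i)‖ₑ ^ 2) * ‖h‖ₑ ^ 2 := by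
  rw [tsum_enorm_adjoint_sq f f, HilbertBasis.enorm_sq_eq_tsum f (A h), ← ENNReal.tsum_mul_right]
  refine ENNReal.tsum_le_tsum fun i => ?_
  rw [← ContinuousLinearMap.adjoint_inner_left, ← mul_pow]
  gcongr
  simpa [enorm_eq_nnnorm, ← ENNReal.coe_mul] using nnnorm_inner_le_nnnorm (𝕜 := ℂ) (A.adjoint (f i)) h

/-- The square of the Hilbert-Schmidt norm, as a supremum over finite orthonormal families. -/
def hsSq (A : K →L[ℂ] K) : ℝ≥0∞ :=
  ⨆ (k : ℕ) (v : Fin k → K) (_ : Orthonormal ℂ v), ∑ i, ‖A (v i)‖ₑ ^ 2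

omit [CompleteSpace K] in
theorem tsum_enorm_sq_le_hsSq (A : K →L[ℂ] K) {ι : Type*} {e : ι → K} (he : Orthonormal ℂ e) :
    ∑' i, ‖A (e i)‖ₑ ^ 2 ≤ hsSq A := by
  rw [ENNReal.tsum_eq_iSup_sum]
  refine iSup_le fun s => ?_
  have hv : Orthonormal ℂ fun i : Fin s.card => e (s.equivFin.symm i) :=
    he.comp _ (Subtype.val_injective.comp s.equivFin.symm.injective)
  calc ∑ i ∈ s, ‖A (e i)‖ₑ ^ 2 = ∑ i : Fin s.card, ‖A (e (s.equivFin.symm i))‖ₑ ^ 2 := by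
        rw [← Finset.sum_coe_sort s (fun i => ‖A (e i)‖ₑ ^ 2)]
        exact (Equiv.sum_comp s.equivFin.symm (fun i : s => ‖A (e i)‖ₑ ^ 2)).symm
    _ ≤ hsSq A := le_iSup_of_le s.card (le_iSup_of_le _ (le_iSup_of_le hv le_rfl))

/-- The Hilbert-Schmidt norm of `T Q`, with `Q` an orthogonal projection, computed in an
orthonormal basis of the range of `Q`. -/
theorem hsSq_comp_eq_tsum (T Q : K →L[ℂ] K) (hQ : IsSelfAdjoint Q) {ι : Type*} {e : ι → K}
    (he : Orthonormal ℂ e) (hQe : ∀ i, Q (e i) = e i)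
    (hspan : ∀ x, Q x ∈ (Submodule.span ℂ (Set.range e)).topologicalClosure) :
    hsSq (T ∘L Q) = ∑' i, ‖T (e i)‖ₑ ^ 2 := by
  apply le_antisymm
  · obtain ⟨w, f, hf⟩ := exists_hilbertBasis ℂ K
    refine iSup_le fun k => iSup_le fun v => iSup_le fun hv => ?_
    calc ∑ i, ‖(T ∘L Q) (v i)‖ₑ ^ 2
        = ∑ i, ∑' j, ‖⟪f j, T (Q (v i))⟫_ℂ‖ₑ ^ 2 :=
          Finset.sum_congr rfl fun i _ => HilbertBasis.enorm_sq_eq_tsum f _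
      _ = ∑' j, ∑ i, ‖⟪f j, T (Q (v i))⟫_ℂ‖ₑ ^ 2 :=
          (Summable.tsum_finsetSum fun _ _ => ENNReal.summable).symm
      _ = ∑' j, ∑ i, ‖⟪v i, Q (T.adjoint (f j))⟫_ℂ‖ₑ ^ 2 := by
          refine tsum_congr fun j => Finset.sum_congr rfl fun i _ => ?_
          rw [← ContinuousLinearMap.adjoint_inner_left, ← inner_conj_symm, RCLike.enorm_conj,
            ← ContinuousLinearMap.adjoint_inner_right, hQ.adjoint_eq]
      _ ≤ ∑' j, ‖Q (T.adjoint (f j))‖ₑ ^ 2 :=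
          ENNReal.tsum_le_tsum fun j => Orthonormal.sum_enorm_inner_sq_le hv _
      _ = ∑' j, ∑' i, ‖⟪e i, Q (T.adjoint (f j))⟫_ℂ‖ₑ ^ 2 :=
          tsum_congr fun j => Orthonormal.enorm_sq_eq_tsum he (hspan _)
      _ = ∑' i, ∑' j, ‖⟪f j, T (e i)⟫_ℂ‖ₑ ^ 2 := by
          rw [ENNReal.tsum_comm]
          refine tsum_congr fun i => tsum_congr fun j => ?_
          rw [← ContinuousLinearMap.adjoint_inner_left, hQ.adjoint_eq, hQe,
            ContinuousLinearMap.adjoint_inner_right, ← inner_conj_symm, RCLike.enorm_conj]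
      _ = ∑' i, ‖T (e i)‖ₑ ^ 2 :=
          tsum_congr fun i => (HilbertBasis.enorm_sq_eq_tsum f _).symm
  · have h := tsum_enorm_sq_le_hsSq (T ∘L Q) he
    simpa [hQe] using h

end HilbertSchmidt

/-! ### Generalized eigenvectors from the spectral measure -/

section Expansion

variable {K : Type*} [NormedAddCommGroup K] [InnerProductSpace ℂ K] [CompleteSpace K]

/-- A bounded family in a Hilbert space converges weakly along some ultrafilter. -/
theorem exists_ultrafilter_tendsto_inner {ι : Type*} {l : Filter ι} [l.NeBot] {v : ι → K} {R : ℝ}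
    (hv : ∀ᶠ i in l, ‖v i‖ ≤ R) : ∃ F : Ultrafilter ι, (F : Filter ι) ≤ l ∧
      ∃ w : K, ∀ h : K, Tendsto (fun i => ⟪v i, h⟫_ℂ) F (𝓝 ⟪w, h⟫_ℂ) := by
  set F := Ultrafilter.of l with hF
  have hle : (F : Filter ι) ≤ l := Ultrafilter.of_le l
  refine ⟨F, hle, ?_⟩
  let u : ι → WeakDual ℂ K := fun i => StrongDual.toWeakDual (InnerProductSpace.toDual ℂ K (v i))
  have hc := WeakDual.isCompact_closedBall (𝕜 := ℂ) (E := K) 0 R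
  have hmem : ∀ᶠ i in (F : Filter ι), u i ∈
      WeakDual.toStrongDual ⁻¹' Metric.closedBall (0 : StrongDual ℂ K) R := by
    filter_upwards [hle hv] with i hi
    simpa [u] using hi
  obtain ⟨x, -, hx⟩ := hc.ultrafilter_le_nhds (F.map u) (by
    rw [Filter.le_principal_iff]; exact hmem)
  refine ⟨(InnerProductSpace.toDual ℂ K).symm (WeakDual.toStrongDual x), fun h => ?_⟩
  have hx' : Tendsto u F (𝓝 x) := hx
  have h1 := ((WeakDual.eval_continuous h).tendsto x).comp hx'
  rw [InnerProductSpace.toDual_symm_apply]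
  exact h1

/-- The trace measure `B ↦ tr (T P(B) T)`, computed in a Hilbert basis. -/
def PVM.traceMeasure (P : PVM K) (T : K →L[ℂ] K) {ι : Type*} (f : HilbertBasis ι ℂ K) :
    Measure ℝ :=
  Measure.sum fun i => P.scalarMeasure (T (f i))

theorem PVM.traceMeasure_apply (P : PVM K) {T : K →L[ℂ] K} (hT : IsSelfAdjoint T) {ι : Type*}
    (f : HilbertBasis ι ℂ K) {B : Set ℝ} (hB : MeasurableSet B) :
    P.traceMeasure T f B = ∑' i, ‖(T ∘L P.proj B) (f i)‖ₑ ^ 2 := by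
  have hadj : (T ∘L P.proj B).adjoint = P.proj B ∘L T := by
    rw [ContinuousLinearMap.adjoint_comp, hT.adjoint_eq, (P.selfAdjoint B hB).adjoint_eq]
  rw [tsum_enorm_adjoint_sq f f, hadj, PVM.traceMeasure, Measure.sum_apply _ hB]
  exact tsum_congr fun i => P.scalarMeasure_apply hB _

theorem PVM.traceMeasure_le (P : PVM K) {T : K →L[ℂ] K} (hT : IsSelfAdjoint T) {ι : Type*}
    (f : HilbertBasis ι ℂ K) {B : Set ℝ} (hB : MeasurableSet B) :
    P.traceMeasure T f B ≤ hsSq (T ∘L P.proj B) := by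
  rw [P.traceMeasure_apply hT f hB]
  exact tsum_enorm_sq_le_hsSq _ f.orthonormal

theorem PVM.norm_T_proj_le (P : PVM K) {T : K →L[ℂ] K} (hT : IsSelfAdjoint T) {ι : Type*}
    (f : HilbertBasis ι ℂ K) {B : Set ℝ} (hB : MeasurableSet B)
    (hfin : P.traceMeasure T f B ≠ ⊤) (h : K) :
    ‖T (P.proj B h)‖ ^ 2 ≤ (P.traceMeasure T f B).toReal * ‖h‖ ^ 2 := by
  have h1 := enorm_apply_sq_le_tsum f (T ∘L P.proj B) h
  rw [← P.traceMeasure_apply hT f hB] at h1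
  have h2 := ENNReal.toReal_mono
    (ENNReal.mul_ne_top hfin (ENNReal.pow_ne_top enorm_ne_top)) h1
  simpa [ENNReal.toReal_mul] using h2

theorem PVM.norm_proj_T_le (P : PVM K) {T : K →L[ℂ] K} (hT : IsSelfAdjoint T) {ι : Type*}
    (f : HilbertBasis ι ℂ K) {B : Set ℝ} (hB : MeasurableSet B)
    (hfin : P.traceMeasure T f B ≠ ⊤) (h : K) :
    ‖P.proj B (T h)‖ ^ 2 ≤ (P.traceMeasure T f B).toReal * ‖h‖ ^ 2 := by
  have h1 : ‖P.proj B (T h)‖ ^ 2 ≤ ‖h‖ * ‖T (P.proj B (P.proj B (T h)))‖ := by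
    have h2 : ((‖P.proj B (T h)‖ ^ 2 : ℝ) : ℂ) = ⟪h, T (P.proj B (P.proj B (T h)))⟫_ℂ := by
      rw [← P.inner_proj_self hB, P.proj_idem hB]
      conv_rhs => rw [← hT.adjoint_eq, ContinuousLinearMap.adjoint_inner_right]
      rw [hT.adjoint_eq]
    have h3 := norm_inner_le_norm (𝕜 := ℂ) h (T (P.proj B (P.proj B (T h))))
    rw [← h2, Complex.norm_real, Real.norm_of_nonneg (by positivity)] at h3
    exact h3
  have h4 := P.norm_T_proj_le hT f hB hfin (P.proj B (T h))
  set m := (P.traceMeasure T f B).toReal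
  set a := ‖P.proj B (T h)‖
  set z := ‖T (P.proj B (P.proj B (T h)))‖
  have hm : 0 ≤ m := ENNReal.toReal_nonneg
  have h5 : a ^ 2 * a ^ 2 ≤ a ^ 2 * (m * ‖h‖ ^ 2) := by
    calc a ^ 2 * a ^ 2 ≤ (‖h‖ * z) * (‖h‖ * z) := mul_self_le_mul_self (by positivity) h1
      _ = ‖h‖ ^ 2 * z ^ 2 := by ring
      _ ≤ ‖h‖ ^ 2 * (m * a ^ 2) := by gcongr
      _ = a ^ 2 * (m * ‖h‖ ^ 2) := by ring
  rcases eq_or_lt_of_le (sq_nonneg a) with h6 | h6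
  · rw [← h6]; positivity
  · exact le_of_mul_le_mul_left h5 h6

/-- If the spectral measure of `T g` has positive lower density at `l` with respect to the trace
measure, then the weak limits of `T P(B) T g / tr (T P(B) T)`, as `B` shrinks to `l`, are nonzero
vectors `w` such that `T⁻¹ w` is a generalized eigenvector with eigenvalue `l`. -/
theorem PVM.IsSpectralMeasureOf.exists_generalized_eigenvector {P : PVM K} {A : K →ₗ.[ℂ] K}
    (hP : P.IsSpectralMeasureOf A) (hA : IsSelfAdjoint A) {T : K →L[ℂ] K} (hT : IsSelfAdjoint T)
    {ι : Type*} (f : HilbertBasis ι ℂ K) {g : K} {l c : ℝ} (hc : 0 < c)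
    (hpos : ∀ᶠ r in 𝓝[>] (0 : ℝ), 0 < P.traceMeasure T f (Metric.closedBall l r) ∧
      P.traceMeasure T f (Metric.closedBall l r) ≠ ⊤ ∧
      c * (P.traceMeasure T f (Metric.closedBall l r)).toReal ≤
        ‖P.proj (Metric.closedBall l r) (T g)‖ ^ 2) :
    ∃ w : K, w ≠ 0 ∧ ∃ φ : ℕ → A.domain, Tendsto (fun k => T (φ k : K)) atTop (𝓝 w) ∧
      Tendsto (fun k => T (A (φ k))) atTop (𝓝 ((l : ℂ) • w)) := by
  let B : ℝ → Set ℝ := fun r => Metric.closedBall l r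
  have hB : ∀ r, MeasurableSet (B r) := fun r => Metric.isClosed_closedBall.measurableSet
  have hBI : ∀ r, B r ⊆ Icc (l - r) (l + r) := fun r => (Real.closedBall_eq_Icc).subset
  let m : ℝ → ℝ := fun r => (P.traceMeasure T f (B r)).toReal
  have hdom : ∀ r, P.proj (B r) (T g) ∈ A.domain := fun r =>
    hP.proj_mem_domain_of_subset (hB r) (hBI r) _
  let u : ℝ → A.domain := fun r => ((m r)⁻¹ : ℂ) • ⟨P.proj (B r) (T g), hdom r⟩
  have hu : ∀ r, (u r : K) = ((m r)⁻¹ : ℂ) • P.proj (B r) (T g) := fun r => rfl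
  have hPu : ∀ r, P.proj (B r) (u r : K) = u r := fun r => by
    rw [hu, map_smul, P.proj_idem (hB r)]
  have hun : ∀ᶠ r in 𝓝[>] (0 : ℝ), m r * ‖(u r : K)‖ ^ 2 ≤ ‖g‖ ^ 2 := by
    filter_upwards [hpos] with r hr
    have hm : 0 < m r := ENNReal.toReal_pos hr.1.ne' hr.2.1
    have h1 := P.norm_proj_T_le hT f (hB r) hr.2.1 g
    rw [hu, norm_smul, mul_pow, norm_inv, Complex.norm_real, Real.norm_of_nonneg hm.le]
    calc m r * ((m r)⁻¹ ^ 2 * ‖P.proj (B r) (T g)‖ ^ 2)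
        ≤ m r * ((m r)⁻¹ ^ 2 * (m r * ‖g‖ ^ 2)) := by gcongr
      _ = ‖g‖ ^ 2 := by field_simp
  have hTP : ∀ᶠ r in 𝓝[>] (0 : ℝ), ∀ h : K, P.proj (B r) h = h → ‖T h‖ ^ 2 ≤ m r * ‖h‖ ^ 2 := by
    filter_upwards [hpos] with r hr h hh
    have h1 := P.norm_T_proj_le hT f (hB r) hr.2.1 h
    rwa [hh] at h1
  have hbound : ∀ᶠ r in 𝓝[>] (0 : ℝ), ‖T (u r)‖ ≤ ‖g‖ := by
    filter_upwards [hun, hTP] with r h1 h2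
    exact (abs_le_of_sq_le_sq' ((h2 _ (hPu r)).trans h1) (norm_nonneg _)).2
  have hdiff : ∀ᶠ r in 𝓝[>] (0 : ℝ), ‖T (A (u r)) - (l : ℂ) • T (u r)‖ ≤ r * ‖g‖ := by
    filter_upwards [hun, hTP, self_mem_nhdsWithin] with r h1 h2 h3
    have hr : 0 < r := h3
    have h4 := hP.norm_apply_sub_le hA (hB r) hr (hBI r) (hPu r)
    have h5 := h2 (A (u r) - (l : ℂ) • (u r : K)) (by
      rw [map_sub, map_smul, hPu, hP.proj_apply_of_mem hA (hB r) (hPu r)])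
    rw [map_sub, map_smul] at h5
    refine (abs_le_of_sq_le_sq' (h5.trans ?_) (by positivity)).2
    calc m r * ‖A (u r) - (l : ℂ) • (u r : K)‖ ^ 2 ≤ m r * (r * ‖(u r : K)‖) ^ 2 := by
          have : 0 ≤ m r := ENNReal.toReal_nonneg
          gcongr
      _ = r ^ 2 * (m r * ‖(u r : K)‖ ^ 2) := by ring
      _ ≤ r ^ 2 * ‖g‖ ^ 2 := by gcongr
      _ = (r * ‖g‖) ^ 2 := by ring
  obtain ⟨F, hF, w, hw⟩ := exists_ultrafilter_tendsto_inner hbound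
  have hw2 : ∀ h : K, Tendsto (fun r => ⟪T (A (u r)), h⟫_ℂ) F (𝓝 ⟪(l : ℂ) • w, h⟫_ℂ) := by
    intro h
    have h1 : Tendsto (fun r => ⟪T (A (u r)) - (l : ℂ) • T (u r), h⟫_ℂ) F (𝓝 0) := by
      have h2 : Tendsto (fun r : ℝ => r * ‖g‖ * ‖h‖) F (𝓝 0) := by
        have : Tendsto (fun r : ℝ => r * ‖g‖ * ‖h‖) (𝓝 0) (𝓝 (0 * ‖g‖ * ‖h‖)) :=
          (tendsto_id.mul_const _).mul_const _
        rw [zero_mul, zero_mul] at this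
        exact this.mono_left (hF.trans nhdsWithin_le_nhds)
      refine squeeze_zero_norm' ?_ h2
      filter_upwards [hF hdiff] with r hr
      exact (norm_inner_le_norm _ _).trans (by gcongr)
    have h3 := h1.add ((hw h).const_mul ((starRingEnd ℂ) (l : ℂ)))
    rw [zero_add] at h3
    rw [inner_smul_left]
    refine h3.congr fun r => ?_
    rw [inner_sub_left, inner_smul_left]
    ring
  have hw0 : w ≠ 0 := by
    rintro rfl
    have h1 := (Complex.continuous_re.tendsto _).comp (hw g)
    rw [inner_zero_left, Complex.zero_re] at h1
    have h2 : ∀ᶠ r in (F : Filter ℝ), c ≤ (⟪T (u r), g⟫_ℂ).re := by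
      filter_upwards [hF hpos] with r hr
      have hm : 0 < m r := ENNReal.toReal_pos hr.1.ne' hr.2.1
      have h3 : (⟪T (u r), g⟫_ℂ).re = (m r)⁻¹ * ‖P.proj (B r) (T g)‖ ^ 2 := by
        rw [← ContinuousLinearMap.adjoint_inner_right, hT.adjoint_eq, hu, inner_smul_left,
          P.inner_proj_left (hB r), P.inner_proj_self (hB r), ← Complex.ofReal_inv,
          Complex.conj_ofReal, ← Complex.ofReal_mul, Complex.ofReal_re]
      rw [h3, le_inv_mul_iff₀ hm, mul_comm]
      exact hr.2.2
    exact absurd (ge_of_tendsto h1 h2) (not_le.2 hc)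
  refine ⟨w, hw0, ?_⟩
  -- the graph of `A`, seen through `T`, is a subspace, so its weak and strong closures agree
  let G : Submodule ℂ (WithLp 2 (K × K)) :=
    { carrier := {z | ∃ φ : A.domain, z = WithLp.toLp 2 (T (φ : K), T (A φ))}
      zero_mem' := ⟨0, by rw [LinearPMap.map_zero]; simp; rfl⟩
      add_mem' := by
        rintro _ _ ⟨φ, rfl⟩ ⟨ψ, rfl⟩
        refine ⟨φ + ψ, ?_⟩
        rw [LinearPMap.map_add, Submodule.coe_add, map_add, map_add]; rfl
      smul_mem' := by
        rintro a _ ⟨φ, rfl⟩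
        refine ⟨a • φ, ?_⟩
        rw [LinearPMap.map_smul, Submodule.coe_smul, map_smul, map_smul]; rfl }
  have hcl : WithLp.toLp 2 (w, (l : ℂ) • w) ∈ G.topologicalClosure := by
    rw [← Submodule.orthogonal_orthogonal_eq_closure, Submodule.mem_orthogonal']
    intro z hz
    have h1 : ∀ r, ⟪T (u r), z.fst⟫_ℂ + ⟪T (A (u r)), z.snd⟫_ℂ = 0 := by
      intro r
      have := (Submodule.mem_orthogonal _ _).1 hz _ ⟨u r, rfl⟩
      simpa [WithLp.prod_inner_apply] using this
    have h2 := (hw z.fst).add (hw2 z.snd)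
    have h3 : ⟪w, z.fst⟫_ℂ + ⟪(l : ℂ) • w, z.snd⟫_ℂ = 0 :=
      tendsto_nhds_unique h2 (by simp_rw [h1]; exact tendsto_const_nhds)
    rw [WithLp.prod_inner_apply]
    exact h3
  rw [← SetLike.mem_coe, Submodule.topologicalClosure_coe, mem_closure_iff_seq_limit] at hcl
  obtain ⟨z, hz, hzlim⟩ := hcl
  choose φ hφ using hz
  refine ⟨φ, ?_, ?_⟩
  · have h1 := ((WithLp.prod_continuous_ofLp 2 K K).fst.tendsto _).comp hzlim
    refine h1.congr fun k => ?_
    simp [hφ k]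
  · have h1 := ((WithLp.prod_continuous_ofLp 2 K K).snd.tendsto _).comp hzlim
    refine h1.congr fun k => ?_
    simp [hφ k]

end Expansion

/-! ### The bracket, lattice sums and stretched exponentials -/

section Growth

variable {d : ℕ}

theorem one_le_jap (u : Sp d) : 1 ≤ jap u := by
  rw [jap, Real.one_le_sqrt]
  nlinarith [sq_nonneg ‖u‖]

theorem jap_pos (u : Sp d) : 0 < jap u := one_pos.trans_le (one_le_jap u)

theorem norm_le_jap (u : Sp d) : ‖u‖ ≤ jap u := by
  rw [jap]
  exact Real.le_sqrt_of_sq_le (by linarith)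

theorem jap_sq (u : Sp d) : jap u ^ 2 = 1 + ‖u‖ ^ 2 := by
  rw [jap, Real.sq_sqrt (by positivity)]

theorem jap_le_mul (u v : Sp d) : jap u ≤ (1 + ‖u - v‖) * jap v := by
  refine (abs_le_of_sq_le_sq' ?_ (by have := jap_pos v; positivity)).2
  rw [mul_pow, jap_sq, jap_sq]
  have h : ‖u‖ ≤ ‖v‖ + ‖u - v‖ := by
    have := norm_add_le v (u - v)
    rwa [add_sub_cancel] at this
  nlinarith [norm_nonneg u, norm_nonneg v, norm_nonneg (u - v), sq_nonneg (‖v‖ * ‖u - v‖),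
    sq_nonneg (‖v‖ - 1), mul_nonneg (norm_nonneg (u - v)) (sq_nonneg (‖v‖ - 1)),
    mul_nonneg (norm_nonneg (u - v)) (sq_nonneg ‖v‖)]

theorem jap_rpow_le_mul {s : ℝ} (hs : 0 ≤ s) (u v : Sp d) :
    jap u ^ s ≤ (1 + ‖u - v‖) ^ s * jap v ^ s := by
  rw [← Real.mul_rpow (by positivity) (jap_pos v).le]
  exact Real.rpow_le_rpow (jap_pos u).le (jap_le_mul u v) hs

theorem jap_le_of_norm_le {u : Sp d} {L : ℝ} (hL : 1 ≤ L) (hu : ‖u‖ ≤ L) : jap u ≤ 2 * L := by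
  refine (abs_le_of_sq_le_sq' ?_ (by linarith)).2
  rw [jap_sq]
  nlinarith [norm_nonneg u]

theorem continuous_jap : Continuous (jap : Sp d → ℝ) := by
  unfold jap
  fun_prop

theorem measurable_jap_rpow (s : ℝ) : Measurable fun u : Sp d => jap u ^ s :=
  continuous_jap.measurable.pow_const s

theorem pt_sub (x y : Lat d) : pt (x - y) = pt x - pt y := by
  ext i; simp [pt]

theorem pt_zero : pt (0 : Lat d) = 0 := by
  ext i; simp [pt]

theorem pt_injective : Function.Injective (pt : Lat d → Sp d) := by
  intro x y h
  funext i
  have := congrArg (fun u : Sp d => u i) h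
  simpa [pt] using this

theorem norm_le_of_forall_abs_le {u : Sp d} {M : ℝ} (hM : 0 ≤ M) (h : ∀ i, |u i| ≤ M) :
    ‖u‖ ≤ d * M := by
  refine (abs_le_of_sq_le_sq' ?_ (by positivity)).2
  rw [EuclideanSpace.norm_sq_eq]
  have h : ∀ i ∈ (Finset.univ : Finset (Fin d)), ‖u i‖ ^ 2 ≤ M ^ 2 := by
    intro i _
    rw [Real.norm_eq_abs]
    exact pow_le_pow_left₀ (abs_nonneg _) (h i) 2
  refine (Finset.sum_le_card_nsmul _ _ _ h).trans ?_
  rw [Finset.card_univ, Fintype.card_fin, nsmul_eq_mul, mul_pow]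
  gcongr
  exact_mod_cast Nat.le_self_pow two_ne_zero d

theorem norm_pt_le (x : Lat d) : ‖pt x‖ ≤ d * ‖x‖ := by
  refine norm_le_of_forall_abs_le (norm_nonneg x) fun i => ?_
  have h1 : |pt x i| = ‖x i‖ := by simp [pt, Int.norm_eq_abs]
  rw [h1]
  exact norm_le_pi_norm x i

/-- A stretched exponential scale with larger exponent dominates one with smaller exponent. -/
theorem exists_mul_rpow_le (A : ℝ) {c ζ θ : ℝ} (hc : 0 < c) (hζ : 0 < ζ) (hζθ : ζ < θ) :
    ∃ C : ℝ, 0 ≤ C ∧ ∀ t : ℝ, 0 ≤ t → A * t ^ ζ ≤ C + c * t ^ θ := by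
  have hA : 0 ≤ |A| / c := by positivity
  set T := (|A| / c) ^ (θ - ζ)⁻¹ with hT
  have hT0 : 0 ≤ T := Real.rpow_nonneg hA _
  refine ⟨|A| * T ^ ζ, by positivity, fun t ht => ?_⟩
  have h0 : A * t ^ ζ ≤ |A| * t ^ ζ := by gcongr; exact le_abs_self A
  refine h0.trans ?_
  rcases le_total t T with h | h
  · have : |A| * t ^ ζ ≤ |A| * T ^ ζ := by gcongr
    have h2 : 0 ≤ c * t ^ θ := by positivity
    linarith
  · rcases ht.eq_or_lt with rfl | ht'
    · rw [Real.zero_rpow hζ.ne', Real.zero_rpow (hζ.trans hζθ).ne']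
      simp; positivity
    have h1 : |A| / c ≤ t ^ (θ - ζ) := by
      have : T ^ (θ - ζ) ≤ t ^ (θ - ζ) := Real.rpow_le_rpow hT0 h (by linarith)
      rwa [hT, ← Real.rpow_mul hA, inv_mul_cancel₀ (by linarith), Real.rpow_one] at this
    rw [div_le_iff₀ hc] at h1
    have h2 : |A| * t ^ ζ ≤ c * t ^ θ := by
      calc |A| * t ^ ζ ≤ (t ^ (θ - ζ) * c) * t ^ ζ := by gcongr
        _ = c * (t ^ (θ - ζ) * t ^ ζ) := by ring
        _ = c * t ^ θ := by rw [← Real.rpow_add ht', sub_add_cancel]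
    have h3 : 0 ≤ |A| * T ^ ζ := by positivity
    linarith

theorem exists_log_le (s : ℝ) {c θ : ℝ} (hc : 0 < c) (hθ : 0 < θ) :
    ∃ C : ℝ, 0 ≤ C ∧ ∀ t : ℝ, 0 ≤ t → s * Real.log (1 + t) ≤ C + c * t ^ θ := by
  obtain ⟨C, hC0, hC⟩ := exists_mul_rpow_le (|s| * (2 / θ)) hc (half_pos hθ) (half_lt_self hθ)
  refine ⟨|s| + C, by positivity, fun t ht => ?_⟩
  have h1 : Real.log (1 + t) ≤ 1 + 2 / θ * t ^ (θ / 2) := by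
    rcases le_total t 1 with h | h
    · have h2 : Real.log (1 + t) ≤ t := by
        have := Real.log_le_sub_one_of_pos (show 0 < 1 + t by linarith)
        linarith
      have : 0 ≤ 2 / θ * t ^ (θ / 2) := by positivity
      linarith
    · have h2 : Real.log (1 + t) ≤ Real.log (2 * t) := Real.log_le_log (by linarith) (by linarith)
      rw [Real.log_mul two_ne_zero (by linarith)] at h2
      have h3 := Real.log_le_rpow_div ht (half_pos hθ)
      have h4 : Real.log 2 ≤ 1 := by
        have := Real.log_le_sub_one_of_pos (show (0 : ℝ) < 2 by norm_num)
        linarith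
      have h5 : t ^ (θ / 2) / (θ / 2) = 2 / θ * t ^ (θ / 2) := by field_simp
      linarith
  have h0 : 0 ≤ Real.log (1 + t) := Real.log_nonneg (by linarith)
  calc s * Real.log (1 + t) ≤ |s| * Real.log (1 + t) := by gcongr; exact le_abs_self s
    _ ≤ |s| * (1 + 2 / θ * t ^ (θ / 2)) := by gcongr
    _ = |s| + |s| * (2 / θ) * t ^ (θ / 2) := by ring
    _ ≤ |s| + C + c * t ^ θ := by linarith [hC t ht]

theorem exists_rpow_le_exp (s : ℝ) {c θ : ℝ} (hc : 0 < c) (hθ : 0 < θ) :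
    ∃ C : ℝ, 0 < C ∧ ∀ t : ℝ, 0 ≤ t → (1 + t) ^ s ≤ C * Real.exp (c * t ^ θ) := by
  obtain ⟨C, -, hC⟩ := exists_log_le s hc hθ
  refine ⟨Real.exp C, Real.exp_pos _, fun t ht => ?_⟩
  rw [Real.rpow_def_of_pos (by linarith), ← Real.exp_add, mul_comm]
  exact Real.exp_le_exp.2 (hC t ht)

theorem summable_jap_rpow {s : ℝ} (hs : (d : ℝ) < s) :
    Summable fun x : Lat d => jap (pt x) ^ (-s) := by
  let b := (EuclideanSpace.basisFun (Fin d) ℝ).toBasis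
  let L : Submodule ℤ (Sp d) := Submodule.span ℤ (Set.range b)
  have hrank : Module.finrank ℤ L = d := by
    have := ZLattice.rank ℝ L
    rw [this]; simp
  have hmem : ∀ x : Lat d, pt x ∈ L := by
    intro x
    have h1 : pt x = ∑ i, x i • b i := by
      ext j
      simp [pt, b, Finset.sum_apply, Pi.single_apply]
    rw [h1]
    exact Submodule.sum_mem _ fun i _ => Submodule.smul_mem _ _
      (Submodule.subset_span (Set.mem_range_self i))
  have h := ZLattice.summable_norm_rpow L (-s) (by rw [hrank]; linarith)
  have hinj : Function.Injective fun x : Lat d => (⟨pt x, hmem x⟩ : L) := fun x y hxy =>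
    pt_injective (congrArg Subtype.val hxy)
  have h2 := h.comp_injective hinj
  have hs0 : 0 < s := (Nat.cast_nonneg d).trans_lt hs
  refine Summable.of_norm_bounded_eventually h2 ?_
  filter_upwards [(Set.finite_singleton (0 : Lat d)).compl_mem_cofinite] with x hx
  have hx0 : pt x ≠ 0 := fun h => hx (pt_injective (h.trans pt_zero.symm))
  rw [Real.norm_of_nonneg (Real.rpow_nonneg (jap_pos _).le _)]
  exact Real.rpow_le_rpow_of_nonpos (show 0 < ‖pt x‖ from norm_pos_iff.2 hx0) (norm_le_jap _) (by linarith)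

theorem summable_exp_neg_rpow {c θ : ℝ} (hc : 0 < c) (hθ : 0 < θ) :
    Summable fun x : Lat d => Real.exp (-(c * ‖pt x‖ ^ θ)) := by
  obtain ⟨C, hC, h⟩ := exists_rpow_le_exp ((d : ℝ) + 1) hc hθ
  have hs := (summable_jap_rpow (d := d) (s := (d : ℝ) + 1) (by linarith)).mul_left C
  refine Summable.of_nonneg_of_le (fun _ => (Real.exp_pos _).le) (fun x => ?_) hs
  have h1 := h ‖pt x‖ (norm_nonneg _)
  have h2 : jap (pt x) ^ ((d : ℝ) + 1) ≤ (1 + ‖pt x‖) ^ ((d : ℝ) + 1) := by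
    refine Real.rpow_le_rpow (jap_pos _).le ?_ (by positivity)
    have := jap_le_mul (pt x) 0
    simpa [jap] using this
  have h3 := h2.trans h1
  rw [Real.exp_neg, Real.rpow_neg (jap_pos _).le, ← div_eq_mul_inv, inv_eq_one_div,
    div_le_div_iff₀ (Real.exp_pos _) (Real.rpow_pos_of_pos (jap_pos _) _), one_mul]
  exact h3

theorem subexp_pos (ζ : ℝ) (x y : Lat d) : 0 < subexp ζ x y := Real.exp_pos _

end Growth

/-! ### Local and weighted norms -/

section Norms

variable {S : Setting} {d n : ℕ}

theorem pt_mem_cube (x : Lat d) : pt x ∈ cube x 1 := by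
  intro i; simp [pt]

theorem disjoint_cube {x y : Lat d} (h : x ≠ y) : Disjoint (cube x 1) (cube y 1) := by
  rw [Set.disjoint_left]
  intro u hx hy
  apply h
  funext i
  have h1 := abs_lt.1 (hx i)
  have h2 := abs_lt.1 (hy i)
  have h3 : |((x i - y i : ℤ) : ℝ)| < 1 := by
    push_cast
    rw [abs_lt]; constructor <;> linarith
  have h4 : |x i - y i| < 1 := by exact_mod_cast h3
  have := Int.abs_lt_one_iff.1 h4
  omega

/-- The unit cubes centered at the lattice points cover the space up to a null set. -/
theorem ae_mem_iUnion_cube (S : Setting) (d : ℕ) :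
    ∀ᵐ u ∂(S.vol d), u ∈ ⋃ x : Lat d, cube x 1 := by
  cases S with
  | lattice =>
    rw [Setting.vol, Measure.ae_sum_iff]
    intro x
    rw [ae_dirac_eq]
    exact Filter.eventually_pure.2 (Set.mem_iUnion.2 ⟨x, pt_mem_cube x⟩)
  | continuum =>
    have h0 : ∀ (i : Fin d) (k : ℤ), ∀ᵐ u : Sp d ∂volume, u i ≠ k + 1 / 2 := by
      intro i k
      have h1 := Measure.pi_hyperplane (fun _ : Fin d => (volume : Measure ℝ)) i (k + 1 / 2 : ℝ)
      have h2 := (PiLp.volume_preserving_ofLp (Fin d)).quasiMeasurePreserving.preimage_null h1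
      rw [ae_iff]
      refine measure_mono_null (fun u hu => ?_) h2
      simpa using hu
    have h1 : ∀ᵐ u : Sp d ∂volume, ∀ (i : Fin d) (k : ℤ), u i ≠ k + 1 / 2 :=
      ae_all_iff.2 fun i => ae_all_iff.2 fun k => h0 i k
    rw [Setting.vol]
    filter_upwards [h1] with u hu
    refine Set.mem_iUnion.2 ⟨fun i => ⌊u i + 1 / 2⌋, fun i => ?_⟩
    have h2 := Int.floor_le (u i + 1 / 2)
    have h3 := Int.lt_floor_add_one (u i + 1 / 2)
    have h4 := hu i (⌊u i + 1 / 2⌋ - 1)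
    push_cast at h4
    rw [abs_lt]
    constructor
    · rcases lt_or_eq_of_le h2 with h5 | h5
      · linarith
      · exact absurd (by linarith) h4
    · linarith

theorem lintegral_eq_tsum_cube (S : Setting) (g : Sp d → ℝ≥0∞) :
    ∫⁻ u, g u ∂(S.vol d) = ∑' x : Lat d, ∫⁻ u in cube x 1, g u ∂(S.vol d) := by
  rw [← lintegral_iUnion (fun x => measurableSet_cube x 1) (fun x y h => disjoint_cube h),
    setLIntegral_congr (t := Set.univ), Measure.restrict_univ]
  rw [eventuallyEq_univ]
  exact ae_mem_iUnion_cube S d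

theorem eLpNorm_two_sq {α F : Type*} [MeasurableSpace α] [NormedAddCommGroup F] (f : α → F)
    (μ : Measure α) : eLpNorm f 2 μ ^ 2 = ∫⁻ u, ‖f u‖ₑ ^ 2 ∂μ := by
  have h := eLpNorm_nnreal_pow_eq_lintegral (f := f) (μ := μ) (p := 2) two_ne_zero
  simpa using h

/-- `‖χ_x f‖` as an extended nonnegative number. -/
def chiE (S : Setting) {d n : ℕ} (x : Lat d) (f : Sp d → Fib n) : ℝ≥0∞ :=
  eLpNorm ((cube x 1).indicator f) 2 (S.vol d)

theorem chiE_sq (x : Lat d) (f : Sp d → Fib n) :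
    chiE S x f ^ 2 = ∫⁻ u in cube x 1, ‖f u‖ₑ ^ 2 ∂(S.vol d) := by
  rw [chiE, eLpNorm_indicator_eq_eLpNorm_restrict (measurableSet_cube x 1), eLpNorm_two_sq]

theorem chiNorm_eq (x : Lat d) (f : Sp d → Fib n) : chiNorm S x f = (chiE S x f).toReal := rfl

theorem chiNorm_nonneg (x : Lat d) (f : Sp d → Fib n) : 0 ≤ chiNorm S x f :=
  ENNReal.toReal_nonneg

theorem TinvNorm_nonneg (κ : ℝ) (f : Sp d → Fib n) : 0 ≤ TinvNorm S κ f :=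
  ENNReal.toReal_nonneg

theorem normOn_congr (B : Set (Sp d)) {f g : Sp d → Fib n} (h : f =ᵐ[S.vol d] g) :
    normOn S B f = normOn S B g := by
  rw [normOn, normOn, eLpNorm_congr_ae h.indicator]

theorem eLpNorm_sq_eq_tsum (f : Sp d → Fib n) :
    eLpNorm f 2 (S.vol d) ^ 2 = ∑' x : Lat d, chiE S x f ^ 2 := by
  rw [eLpNorm_two_sq, lintegral_eq_tsum_cube]
  exact tsum_congr fun x => (chiE_sq x f).symm

theorem norm_sub_pt_le {u : Sp d} {x : Lat d} {L : ℝ} (hL : 0 ≤ L) (hu : u ∈ closedCube x L) :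
    ‖u - pt x‖ ≤ d * L := by
  refine norm_le_of_forall_abs_le hL fun i => ?_
  have := hu i
  simp only [PiLp.sub_apply, pt]
  linarith

theorem cube_subset_closedCube (x : Lat d) (L : ℝ) : cube x L ⊆ closedCube x L :=
  fun _ hu i => (hu i).le

theorem closedCube_mono (x : Lat d) {L M : ℝ} (h : L ≤ M) : closedCube x L ⊆ closedCube x M :=
  fun _ hu i => (hu i).trans (by linarith)

theorem Setting.belt_subset (S : Setting) (x : Lat d) (L : ℝ) : S.belt x L ⊆ closedCube x L := by
  cases S
  · exact Set.sdiff_subset.trans (closedCube_mono x (by linarith))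
  · exact Set.sdiff_subset

theorem jap_le_of_mem_closedCube {u : Sp d} {x : Lat d} {L : ℝ} (hL : 0 ≤ L)
    (hu : u ∈ closedCube x L) : jap u ≤ (1 + d * L) * jap (pt x) := by
  have h1 := jap_le_mul u (pt x)
  have h2 := norm_sub_pt_le hL hu
  have h3 := jap_pos (pt x)
  exact h1.trans (by gcongr)

theorem enorm_weighted (s : ℝ) (f : Sp d → Fib n) (u : Sp d) :
    ‖weighted s f u‖ₑ = ENNReal.ofReal (jap u ^ s) * ‖f u‖ₑ := by
  rw [weighted, enorm_smul, Real.enorm_of_nonneg (Real.rpow_nonneg (jap_pos u).le s)]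

theorem eLpNorm_indicator_le_weighted {κ M : ℝ} (hκ : 0 ≤ κ) (hM0 : 0 ≤ M) {B : Set (Sp d)}
    (hM : ∀ u ∈ B, jap u ≤ M) (f : Sp d → Fib n) : eLpNorm (B.indicator f) 2 (S.vol d) ≤
      ENNReal.ofReal (M ^ κ) * eLpNorm (weighted (-κ) f) 2 (S.vol d) := by
  refine eLpNorm_le_mul_eLpNorm_of_ae_le_mul (ae_of_all _ fun u => ?_) 2
  by_cases hu : u ∈ B
  · rw [Set.indicator_of_mem hu, weighted, norm_smul,
      Real.norm_of_nonneg (Real.rpow_nonneg (jap_pos u).le _), ← mul_assoc]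
    refine le_mul_of_one_le_left (norm_nonneg _) ?_
    rw [Real.rpow_neg (jap_pos u).le, ← div_eq_mul_inv,
      one_le_div (Real.rpow_pos_of_pos (jap_pos u) κ)]
    exact Real.rpow_le_rpow (jap_pos u).le (hM u hu) hκ
  · rw [Set.indicator_of_notMem hu, norm_zero]
    positivity

theorem normOn_le_weighted {κ M : ℝ} (hκ : 0 ≤ κ) (hM0 : 0 ≤ M) {B : Set (Sp d)}
    (hM : ∀ u ∈ B, jap u ≤ M) {f : Sp d → Fib n} (hf : MemW S (-κ) f) :
    normOn S B f ≤ M ^ κ * TinvNorm S κ f := by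
  have h := ENNReal.toReal_mono (ENNReal.mul_ne_top ENNReal.ofReal_ne_top hf.eLpNorm_ne_top)
    (eLpNorm_indicator_le_weighted (S := S) hκ hM0 hM f)
  rwa [ENNReal.toReal_mul, ENNReal.toReal_ofReal (by positivity)] at h

theorem chiE_ne_top {κ : ℝ} (hκ : 0 ≤ κ) {f : Sp d → Fib n} (hf : MemW S (-κ) f) (x : Lat d) :
    chiE S x f ≠ ⊤ := by
  refine ne_top_of_le_ne_top (ENNReal.mul_ne_top ENNReal.ofReal_ne_top hf.eLpNorm_ne_top)
    (eLpNorm_indicator_le_weighted (S := S) (M := (1 + d * 1) * jap (pt x)) hκ ?_ ?_ f)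
  · have := jap_pos (pt x); positivity
  · exact fun u hu => jap_le_of_mem_closedCube zero_le_one (cube_subset_closedCube x 1 hu)

theorem normOn_belt_le {κ : ℝ} (hκ : 0 ≤ κ) (x : Lat d) {L : ℝ} (hL : 0 ≤ L)
    {f : Sp d → Fib n} (hf : MemW S (-κ) f) :
    normOn S (S.belt x L) f ≤ ((1 + d * L) * jap (pt x)) ^ κ * TinvNorm S κ f := by
  have h0 := jap_pos (pt x)
  exact normOn_le_weighted hκ (by positivity)
    (fun u hu => jap_le_of_mem_closedCube hL (S.belt_subset x L hu)) hf

theorem chiNorm_le {κ : ℝ} (hκ : 0 ≤ κ) (x : Lat d) {f : Sp d → Fib n} (hf : MemW S (-κ) f) :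
    chiNorm S x f ≤ (1 + d) ^ κ * jap (pt x) ^ κ * TinvNorm S κ f := by
  have h0 := jap_pos (pt x)
  rw [← Real.mul_rpow (by positivity) h0.le]
  refine normOn_le_weighted hκ (by positivity) (fun u hu => ?_) hf
  simpa using jap_le_of_mem_closedCube zero_le_one (cube_subset_closedCube x 1 hu)

/-- The weighted norm is controlled by a weighted sum of the norms on the unit cubes. -/
theorem eLpNorm_weighted_sq_le {κ : ℝ} (hκ : 0 ≤ κ) (f : Sp d → Fib n) :
    eLpNorm (weighted (-κ) f) 2 (S.vol d) ^ 2 ≤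
      ∑' x : Lat d, ENNReal.ofReal ((1 + d) ^ (2 * κ) * jap (pt x) ^ (-(2 * κ))) *
        chiE S x f ^ 2 := by
  rw [eLpNorm_two_sq, lintegral_eq_tsum_cube]
  refine ENNReal.tsum_le_tsum fun x => ?_
  rw [chiE_sq, ← lintegral_const_mul' _ _ ENNReal.ofReal_ne_top]
  refine setLIntegral_mono' (measurableSet_cube x 1) fun u hu => ?_
  rw [enorm_weighted, mul_pow, ← ENNReal.ofReal_pow (Real.rpow_nonneg (jap_pos u).le _)]
  gcongr
  have hx := jap_pos (pt x)
  have hu' := jap_pos u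
  have h1 : jap (pt x) ≤ (1 + d) * jap u := by
    have h2 := jap_le_mul (pt x) u
    have h3 := norm_sub_pt_le zero_le_one (cube_subset_closedCube x 1 hu)
    rw [mul_one, norm_sub_rev] at h3
    exact h2.trans (by gcongr)
  rw [← Real.rpow_mul_natCast hu'.le, Real.rpow_neg hx.le, ← div_eq_mul_inv,
    show -κ * ((2 : ℕ) : ℝ) = -(2 * κ) by push_cast; ring, Real.rpow_neg hu'.le,
    inv_eq_one_div, div_le_div_iff₀ (by positivity) (by positivity), one_mul,
    ← Real.mul_rpow (by positivity) hu'.le]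
  exact Real.rpow_le_rpow hx.le h1 (by positivity)

theorem aestronglyMeasurable_weighted {f : Sp d → Fib n} (s : ℝ)
    (hf : AEStronglyMeasurable f (S.vol d)) :
    AEStronglyMeasurable (weighted s f) (S.vol d) :=
  (measurable_jap_rpow s).aestronglyMeasurable.smul hf

theorem weighted_weighted (s t : ℝ) (f : Sp d → Fib n) :
    weighted s (weighted t f) = weighted (s + t) f := by
  funext u
  simp only [weighted]
  rw [smul_smul, ← Real.rpow_add (jap_pos u)]

theorem weighted_zero (f : Sp d → Fib n) : weighted 0 f = f := by
  funext u
  simp [weighted]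

theorem MemW.aestronglyMeasurable {s : ℝ} {f : Sp d → Fib n} (hf : MemW S s f) :
    AEStronglyMeasurable f (S.vol d) := by
  have h := aestronglyMeasurable_weighted (-s) hf.1
  rwa [weighted_weighted, neg_add_cancel, weighted_zero] at h

theorem norm_weighted_le {κ : ℝ} (hκ : 0 ≤ κ) (f : Sp d → Fib n) (u : Sp d) :
    ‖weighted (-κ) f u‖ ≤ ‖f u‖ := by
  rw [weighted, norm_smul, Real.norm_of_nonneg (Real.rpow_nonneg (jap_pos u).le _)]
  refine mul_le_of_le_one_left (norm_nonneg _) ?_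
  exact Real.rpow_le_one_of_one_le_of_nonpos (one_le_jap u) (by linarith)

theorem memW_of_memLp {κ : ℝ} (hκ : 0 ≤ κ) {f : Sp d → Fib n} (hf : MemLp f 2 (S.vol d)) :
    MemW S (-κ) f :=
  hf.of_le (aestronglyMeasurable_weighted _ hf.1) (ae_of_all _ (norm_weighted_le hκ f))

theorem memW_coe {κ : ℝ} (hκ : 0 ≤ κ) (φ : Hilb S d n) : MemW S (-κ) φ :=
  memW_of_memLp hκ (Lp.memLp φ)

theorem ofReal_chiNorm {κ : ℝ} (hκ : 0 ≤ κ) {f : Sp d → Fib n} (hf : MemW S (-κ) f) (x : Lat d) :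
    ENNReal.ofReal (chiNorm S x f) = chiE S x f := by
  rw [chiNorm_eq, ENNReal.ofReal_toReal (chiE_ne_top hκ hf x)]

/-- For `κ > d/2`, a bound on the norms on all unit cubes bounds the weighted norm. -/
theorem exists_TinvNorm_le (S : Setting) (d n : ℕ) {κ : ℝ} (hκ : (d : ℝ) / 2 < κ) :
    ∃ C : ℝ, 0 < C ∧ ∀ (f : Sp d → Fib n), MemW S (-κ) f → ∀ M : ℝ, 0 ≤ M →
      (∀ x : Lat d, chiNorm S x f ≤ M) → TinvNorm S κ f ≤ C * M := by
  have hκ0 : 0 ≤ κ := le_trans (by positivity) hκ.le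
  have hs := (summable_jap_rpow (d := d) (s := 2 * κ) (by linarith)).mul_left
    ((1 + (d : ℝ)) ^ (2 * κ))
  have hnn : ∀ x : Lat d, 0 ≤ (1 + (d : ℝ)) ^ (2 * κ) * jap (pt x) ^ (-(2 * κ)) := fun x => by
    have := jap_pos (pt x); positivity
  set Q : ℝ := ∑' x : Lat d, (1 + (d : ℝ)) ^ (2 * κ) * jap (pt x) ^ (-(2 * κ)) with hQ
  have hQ0 : 0 ≤ Q := tsum_nonneg hnn
  refine ⟨√Q + 1, by positivity, fun f hf M hM h => ?_⟩
  have h1 := eLpNorm_weighted_sq_le (S := S) hκ0 f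
  have h2 : eLpNorm (weighted (-κ) f) 2 (S.vol d) ^ 2 ≤ ENNReal.ofReal (Q * M ^ 2) := by
    refine h1.trans ?_
    rw [ENNReal.ofReal_mul hQ0, hQ, ENNReal.ofReal_tsum_of_nonneg hnn hs,
      ← ENNReal.tsum_mul_right]
    refine ENNReal.tsum_le_tsum fun x => ?_
    gcongr
    rw [← ofReal_chiNorm hκ0 hf, ← ENNReal.ofReal_pow (chiNorm_nonneg x f)]
    exact ENNReal.ofReal_le_ofReal (pow_le_pow_left₀ (chiNorm_nonneg x f) (h x) 2)
  have h3 := ENNReal.toReal_mono ENNReal.ofReal_ne_top h2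
  rw [ENNReal.toReal_pow, ENNReal.toReal_ofReal (by positivity)] at h3
  have h4 : TinvNorm S κ f ^ 2 ≤ ((√Q + 1) * M) ^ 2 := by
    refine le_trans h3 ?_
    rw [mul_pow]
    gcongr
    nlinarith [Real.sq_sqrt hQ0, Real.sqrt_nonneg Q]
  exact (abs_le_of_sq_le_sq' h4 (by positivity)).2

theorem exists_chiNorm_pos {κ : ℝ} (hκ : 0 ≤ κ) {f : Sp d → Fib n} (hf : MemW S (-κ) f)
    (h0 : ¬ f =ᵐ[S.vol d] 0) : ∃ y : Lat d, 0 < chiNorm S y f := by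
  by_contra hcon
  push Not at hcon
  apply h0
  rw [← eLpNorm_eq_zero_iff hf.aestronglyMeasurable two_ne_zero]
  have h1 : eLpNorm f 2 (S.vol d) ^ 2 = 0 := by
    rw [eLpNorm_sq_eq_tsum, ENNReal.tsum_eq_zero]
    intro x
    rw [← ofReal_chiNorm hκ hf, ENNReal.ofReal_of_nonpos (hcon x)]
    simp
  simpa using h1

theorem norm_sq_eq_tsum_chiE (φ : Hilb S d n) : ‖φ‖ₑ ^ 2 = ∑' x : Lat d, chiE S x φ ^ 2 := by
  rw [Lp.enorm_def, eLpNorm_sq_eq_tsum]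

theorem hasSum_chiNorm_sq (φ : Hilb S d n) :
    HasSum (fun x : Lat d => chiNorm S x φ ^ 2) (‖φ‖ ^ 2) := by
  have h1 := norm_sq_eq_tsum_chiE φ
  have h2 : ∀ x : Lat d, chiE S x φ ^ 2 = ENNReal.ofReal (chiNorm S x φ ^ 2) := fun x => by
    rw [ENNReal.ofReal_pow (chiNorm_nonneg _ _), ofReal_chiNorm le_rfl (memW_coe le_rfl φ)]
  have h3 : ∑' x : Lat d, ENNReal.ofReal (chiNorm S x φ ^ 2) ≠ ⊤ := by
    simp_rw [← h2]
    rw [← h1]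
    exact ENNReal.pow_ne_top enorm_ne_top
  have h4 : Summable fun x : Lat d => chiNorm S x φ ^ 2 := by
    have := ENNReal.summable_toReal h3
    simpa [ENNReal.toReal_ofReal, sq_nonneg] using this
  have h5 : ∑' x : Lat d, chiNorm S x φ ^ 2 = ‖φ‖ ^ 2 := by
    simp_rw [h2] at h1
    rw [← ENNReal.ofReal_tsum_of_nonneg (fun _ => sq_nonneg _) h4] at h1
    have h6 := congrArg ENNReal.toReal h1
    rw [ENNReal.toReal_ofReal (tsum_nonneg fun _ => sq_nonneg _)] at h6
    simpa using h6.symm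
  rw [← h5]
  exact h4.hasSum

theorem exists_chiNorm_max (φ : Hilb S d n) :
    ∃ y : Lat d, ∀ x : Lat d, chiNorm S x φ ≤ chiNorm S y φ := by
  have h := (hasSum_chiNorm_sq φ).summable.tendsto_cofinite_zero
  by_cases h0 : ∃ y, 0 < chiNorm S y φ
  · obtain ⟨y, hy⟩ := h0
    have h1 : ∀ᶠ x in cofinite, chiNorm S x φ ^ 2 < chiNorm S y φ ^ 2 :=
      h.eventually_lt_const (by positivity)
    have hfin : {x | ¬ chiNorm S x φ ^ 2 < chiNorm S y φ ^ 2}.Finite := h1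
    obtain ⟨z, hz, hmax⟩ := Set.exists_max_image _ (fun x => chiNorm S x φ) hfin
      ⟨y, by simp⟩
    refine ⟨z, fun x => ?_⟩
    by_cases hx : chiNorm S x φ ^ 2 < chiNorm S y φ ^ 2
    · have h2 : chiNorm S x φ ≤ chiNorm S y φ :=
        (abs_le_of_sq_le_sq' hx.le (chiNorm_nonneg _ _)).2
      exact h2.trans (hmax y (by simp))
    · exact hmax x hx
  · push Not at h0
    exact ⟨0, fun x => (h0 x).trans (chiNorm_nonneg _ _)⟩

/-- Stretched exponential decay of the norms on unit cubes implies square integrability. -/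
theorem memLp_of_chiNorm_le {κ C ζ : ℝ} (hκ : 0 ≤ κ) (hζ : 0 < ζ) {f : Sp d → Fib n}
    (hf : MemW S (-κ) f) (y : Lat d) (h : ∀ x : Lat d, chiNorm S x f ≤ C * subexp ζ x y) :
    MemLp f 2 (S.vol d) := by
  refine ⟨hf.aestronglyMeasurable, ?_⟩
  have h1 : eLpNorm f 2 (S.vol d) ^ 2 < ⊤ := by
    rw [eLpNorm_sq_eq_tsum]
    have hs : Summable fun x : Lat d => C ^ 2 * Real.exp (-(2 * ‖pt (x - y)‖ ^ ζ)) :=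
      ((summable_exp_neg_rpow (d := d) two_pos hζ).comp_injective
        (sub_left_injective (b := y))).mul_left _
    refine lt_of_le_of_lt (ENNReal.tsum_le_tsum fun x => ?_) hs.tsum_ofReal_lt_top
    rw [← ofReal_chiNorm hκ hf, ← ENNReal.ofReal_pow (chiNorm_nonneg x f)]
    apply ENNReal.ofReal_le_ofReal
    refine (pow_le_pow_left₀ (chiNorm_nonneg x f) (h x) 2).trans (le_of_eq ?_)
    rw [subexp, mul_pow, ← Real.exp_nat_mul, pt_sub]
    congr 2
    push_cast
    ring
  exact (ENNReal.pow_lt_top_iff.1 h1).resolve_right two_ne_zero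

end Norms

/-! ### The weight operator and the trace measure -/

section Weight

variable {S : Setting} {d n : ℕ}

theorem weighted_congr_ae (s : ℝ) {f g : Sp d → Fib n} (h : f =ᵐ[S.vol d] g) :
    weighted s f =ᵐ[S.vol d] weighted s g := by
  filter_upwards [h] with u hu
  simp only [weighted, hu]

theorem TinvNorm_congr (κ : ℝ) {f g : Sp d → Fib n} (h : f =ᵐ[S.vol d] g) :
    TinvNorm S κ f = TinvNorm S κ g := by
  rw [TinvNorm, TinvNorm, wNorm, wNorm, eLpNorm_congr_ae (weighted_congr_ae _ h)]

theorem TinvNorm_zero (κ : ℝ) : TinvNorm S κ (fun _ => 0 : Sp d → Fib n) = 0 := by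
  have h : weighted (-κ) (fun _ => 0 : Sp d → Fib n) = 0 := by
    funext u; simp [weighted]
  rw [TinvNorm, wNorm, h, eLpNorm_zero, ENNReal.toReal_zero]

theorem memLp_weighted {κ : ℝ} (hκ : 0 ≤ κ) (f : Hilb S d n) :
    MemLp (weighted (-κ) f) 2 (S.vol d) := memW_coe hκ f

/-- The operator `T⁻¹` of multiplication by `⟨u⟩^(-κ)`, as a linear map. -/
def tinvLM (S : Setting) (d n : ℕ) {κ : ℝ} (hκ : 0 ≤ κ) : Hilb S d n →ₗ[ℂ] Hilb S d n where
  toFun f := MemLp.toLp (weighted (-κ) f) (memLp_weighted hκ f)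
  map_add' f g := by
    rw [← MemLp.toLp_add]
    refine MemLp.toLp_congr _ _ ?_
    filter_upwards [Lp.coeFn_add f g] with u hu
    simp only [weighted, hu, Pi.add_apply, smul_add]
  map_smul' c f := by
    rw [RingHom.id_apply, ← MemLp.toLp_const_smul]
    refine MemLp.toLp_congr _ _ ?_
    filter_upwards [Lp.coeFn_smul c f] with u hu
    simp only [weighted, hu, Pi.smul_apply]
    rw [smul_comm]

theorem norm_tinvLM {κ : ℝ} (hκ : 0 ≤ κ) (f : Hilb S d n) :
    ‖tinvLM S d n hκ f‖ = TinvNorm S κ f :=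
  Lp.norm_toLp _ (memW_coe hκ f)

/-- The bounded operator `T⁻¹` of multiplication by `⟨u⟩^(-κ)`, for `κ ≥ 0`. -/
def tinv (S : Setting) (d n : ℕ) {κ : ℝ} (hκ : 0 ≤ κ) : Hilb S d n →L[ℂ] Hilb S d n :=
  (tinvLM S d n hκ).mkContinuous 1 fun f => by
    rw [norm_tinvLM, one_mul, Lp.norm_def]
    exact ENNReal.toReal_mono (Lp.memLp f).eLpNorm_ne_top
      (eLpNorm_mono (norm_weighted_le hκ f))

theorem norm_tinv {κ : ℝ} (hκ : 0 ≤ κ) (f : Hilb S d n) : ‖tinv S d n hκ f‖ = TinvNorm S κ f :=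
  norm_tinvLM hκ f

theorem coeFn_tinv {κ : ℝ} (hκ : 0 ≤ κ) (f : Hilb S d n) :
    tinv S d n hκ f =ᵐ[S.vol d] weighted (-κ) f :=
  MemLp.coeFn_toLp (memLp_weighted hκ f)

theorem isSelfAdjoint_tinv {κ : ℝ} (hκ : 0 ≤ κ) : IsSelfAdjoint (tinv S d n hκ) := by
  rw [ContinuousLinearMap.isSelfAdjoint_iff_isSymmetric]
  intro f g
  rw [ContinuousLinearMap.coe_coe, L2.inner_def, L2.inner_def]
  refine integral_congr_ae ?_
  filter_upwards [coeFn_tinv hκ f, coeFn_tinv hκ g] with u hf hg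
  rw [hf, hg, weighted, weighted, ← Complex.coe_smul, ← Complex.coe_smul, inner_smul_left,
    inner_smul_right, Complex.conj_ofReal]

theorem tinv_injective {κ : ℝ} (hκ : 0 ≤ κ) : Function.Injective (tinv S d n hκ) := by
  rw [injective_iff_map_eq_zero]
  intro f hf
  rw [Lp.eq_zero_iff_ae_eq_zero] at hf ⊢
  filter_upwards [hf, coeFn_tinv hκ f] with u h1 h2
  rw [h1, weighted, Pi.zero_apply] at h2
  exact (smul_eq_zero.1 h2.symm).resolve_left (Real.rpow_pos_of_pos (jap_pos u) _).ne'

theorem RandomOperator.mu_eq_hsSq {Ω : Type*} [MeasurableSpace Ω] {ℙ : Measure Ω}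
    (X : RandomOperator S d n ℙ) {κ : ℝ} (hκ : 0 ≤ κ) (ω : Ω) (B : Set ℝ) :
    X.mu κ ω B = hsSq (tinv S d n hκ ∘L (X.P ω).proj B) := by
  simp only [RandomOperator.mu, hsSq]
  refine iSup_congr fun k => iSup_congr fun v => iSup_congr fun _ =>
    Finset.sum_congr rfl fun i _ => ?_
  rw [ENNReal.ofReal_pow (TinvNorm_nonneg _ _), ← norm_tinv hκ, ofReal_norm]
  rfl

/-- Eigenfunctions are generalized eigenfunctions. -/
theorem isGenEigenfunction_of_mem_eigenspace {κ : ℝ} (hκ : 0 ≤ κ)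
    {A : Hilb S d n →ₗ.[ℂ] Hilb S d n} {E : ℝ} {φ : Hilb S d n} (hφ : φ ∈ eigenspace A E)
    (h0 : φ ≠ 0) : IsGenEigenfunction κ A E φ := by
  obtain ⟨hd, he⟩ := hφ
  refine ⟨memW_coe hκ φ, fun h => h0 ((Lp.eq_zero_iff_ae_eq_zero).2 h), fun _ => ⟨φ, hd⟩, ?_, ?_⟩
  · have : TinvNorm S κ (fun u => φ u - φ u) = 0 := by
      simp only [sub_self]
      exact TinvNorm_zero κ
    simp only [this]
    exact tendsto_const_nhds
  · have h1 : (fun u => A ⟨φ, hd⟩ u - (E : ℂ) • φ u) =ᵐ[S.vol d] 0 := by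
      rw [he]
      filter_upwards [Lp.coeFn_smul (E : ℂ) φ] with u hu
      rw [hu]; simp
    have : TinvNorm S κ (fun u => A ⟨φ, hd⟩ u - (E : ℂ) • φ u) = 0 := by
      rw [TinvNorm_congr κ h1]
      exact TinvNorm_zero κ
    simp only [this]
    exact tendsto_const_nhds

/-- If `T⁻¹ φ_k` converges to a nonzero `w` and `T⁻¹ A φ_k` to `E w`, then `T w` is a generalized
eigenfunction. -/
theorem isGenEigenfunction_weighted {κ : ℝ} (hκ : 0 ≤ κ)
    {A : Hilb S d n →ₗ.[ℂ] Hilb S d n} {E : ℝ} {w : Hilb S d n} (hw : w ≠ 0)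
    {φ : ℕ → A.domain}
    (h1 : Tendsto (fun k => tinv S d n hκ (φ k : Hilb S d n)) atTop (𝓝 w))
    (h2 : Tendsto (fun k => tinv S d n hκ (A (φ k))) atTop (𝓝 ((E : ℂ) • w))) :
    IsGenEigenfunction κ A E (weighted κ w) := by
  have hww : weighted (-κ) (weighted κ w) = w := by
    rw [weighted_weighted, neg_add_cancel, weighted_zero]
  have key : ∀ (f g : Hilb S d n) (c : ℂ),
      TinvNorm S κ (fun u => f u - c • weighted κ w u) = ‖tinv S d n hκ f - c • w‖ := by
    intro f g c
    rw [Lp.norm_def, TinvNorm, wNorm]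
    congr 1
    refine eLpNorm_congr_ae ?_
    filter_upwards [Lp.coeFn_sub (tinv S d n hκ f) (c • w), Lp.coeFn_smul c w,
      coeFn_tinv hκ f] with u e1 e2 e3
    rw [e1, Pi.sub_apply, e2, e3, Pi.smul_apply, ← congrFun hww u]
    simp only [weighted, smul_sub]
    rw [smul_comm (jap u ^ (-κ)) c]
  refine ⟨?_, ?_, φ, ?_, ?_⟩
  · rw [MemW, hww]
    exact Lp.memLp w
  · intro h
    apply hw
    rw [Lp.eq_zero_iff_ae_eq_zero]
    filter_upwards [h] with u hu
    exact (smul_eq_zero.1 hu).resolve_left (Real.rpow_pos_of_pos (jap_pos u) _).ne'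
  · have h3 := tendsto_iff_norm_sub_tendsto_zero.1 h1
    refine h3.congr fun k => ?_
    have := key (φ k) w 1
    simp only [one_smul] at this
    exact this.symm
  · have h3 := tendsto_iff_norm_sub_tendsto_zero.1 h2
    exact h3.congr fun k => (key (A (φ k)) w E).symm

theorem wNorm_pairing_tendsto {κ : ℝ} {g : Hilb S d n} (hg : MemW S κ g) {ψ : Hilb S d n}
    {φ : ℕ → Hilb S d n} (hκ : 0 ≤ κ)
    (h : Tendsto (fun k => TinvNorm S κ fun u => φ k u - ψ u) atTop (𝓝 0)) :
    Tendsto (fun k => ⟪g, φ k⟫_ℂ) atTop (𝓝 ⟪g, ψ⟫_ℂ) := by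
  set g' : Hilb S d n := MemLp.toLp (weighted κ g) hg with hg'
  have hgg : tinv S d n hκ g' = g := by
    apply Lp.ext
    filter_upwards [coeFn_tinv hκ g', MemLp.coeFn_toLp hg] with u e1 e2
    rw [e1]
    simp only [weighted, hg', e2]
    rw [smul_smul, ← Real.rpow_add (jap_pos u), neg_add_cancel, Real.rpow_zero, one_smul]
  have hT : ∀ f, ⟪g, f⟫_ℂ = ⟪g', tinv S d n hκ f⟫_ℂ := fun f => by
    rw [← hgg, ← ContinuousLinearMap.adjoint_inner_left, (isSelfAdjoint_tinv hκ).adjoint_eq, hgg]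
  have h1 : Tendsto (fun k => tinv S d n hκ (φ k)) atTop (𝓝 (tinv S d n hκ ψ)) := by
    rw [tendsto_iff_norm_sub_tendsto_zero]
    refine h.congr fun k => ?_
    rw [← map_sub, norm_tinv]
    exact TinvNorm_congr κ (Lp.coeFn_sub (φ k) ψ).symm
  simp_rw [hT]
  exact Filter.Tendsto.inner tendsto_const_nhds h1

/-- A square integrable generalized eigenfunction is an eigenfunction, if the domain `D₊` is an
operator core. -/
theorem mem_eigenspace_of_isGenEigenfunction {κ : ℝ} (hκ : 0 ≤ κ)
    {A : Hilb S d n →ₗ.[ℂ] Hilb S d n} (hA : IsSelfAdjoint A)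
    (hcore : ∀ φ : A.domain, ∀ δ > 0, ∃ v ∈ Dplus κ A,
      ‖(v : Hilb S d n) - φ‖ < δ ∧ ‖A v - A φ‖ < δ)
    {E : ℝ} {ψ : Hilb S d n} (hψ : IsGenEigenfunction κ A E ψ) : ψ ∈ eigenspace A E := by
  obtain ⟨-, -, φ, h1, h2⟩ := hψ
  have hplus : ∀ v ∈ Dplus κ A, ⟪A v, ψ⟫_ℂ = ⟪(v : Hilb S d n), (E : ℂ) • ψ⟫_ℂ := by
    intro v hv
    have t1 := wNorm_pairing_tendsto hv.2 hκ h1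
    have t2 := wNorm_pairing_tendsto (ψ := (E : ℂ) • ψ) hv.1 hκ (φ := fun k => A (φ k)) (by
      refine h2.congr fun k => TinvNorm_congr κ ?_
      filter_upwards [Lp.coeFn_smul (E : ℂ) ψ] with u hu
      rw [hu, Pi.smul_apply])
    refine tendsto_nhds_unique t1 (t2.congr fun k => ?_)
    exact (inner_apply_symm hA v (φ k)).symm
  have hall : ∀ v : A.domain, ⟪(E : ℂ) • ψ, (v : Hilb S d n)⟫_ℂ = ⟪ψ, A v⟫_ℂ := by
    intro v
    choose w hw using fun k : ℕ => hcore v (1 / ((k : ℝ) + 1)) (by positivity)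
    have t1 : Tendsto (fun k => (w k : Hilb S d n)) atTop (𝓝 v) := by
      rw [tendsto_iff_norm_sub_tendsto_zero]
      exact squeeze_zero (fun _ => norm_nonneg _) (fun k => (hw k).2.1.le)
        tendsto_one_div_add_atTop_nhds_zero_nat
    have t2 : Tendsto (fun k => A (w k)) atTop (𝓝 (A v)) := by
      rw [tendsto_iff_norm_sub_tendsto_zero]
      exact squeeze_zero (fun _ => norm_nonneg _) (fun k => (hw k).2.2.le)
        tendsto_one_div_add_atTop_nhds_zero_nat
    have t3 : Tendsto (fun k => ⟪A (w k), ψ⟫_ℂ) atTop (𝓝 ⟪A v, ψ⟫_ℂ) :=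
      t2.inner tendsto_const_nhds
    have t4 : Tendsto (fun k => ⟪(w k : Hilb S d n), (E : ℂ) • ψ⟫_ℂ) atTop
        (𝓝 ⟪(v : Hilb S d n), (E : ℂ) • ψ⟫_ℂ) := t1.inner tendsto_const_nhds
    have h3 := tendsto_nhds_unique t3 (t4.congr fun k => (hplus _ (hw k).1).symm)
    rw [← inner_conj_symm, ← h3, inner_conj_symm]
  have hadj := LinearPMap.isSelfAdjoint_def.1 hA
  have hd : ψ ∈ A.adjoint.domain := LinearPMap.mem_adjoint_domain_of_exists ψ ⟨_, hall⟩
  have he : A.adjoint ⟨ψ, hd⟩ = (E : ℂ) • ψ :=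
    LinearPMap.adjoint_apply_eq hA.dense_domain ⟨ψ, hd⟩ hall
  have hd' : ψ ∈ A.domain := hadj ▸ hd
  refine ⟨hd', ?_⟩
  rw [← he]
  have hle : A ≤ A.adjoint := hadj.ge
  exact hle.2 rfl

end Weight

/-! ### Pure point spectrum -/

section PurePoint

variable {K : Type*} [NormedAddCommGroup K] [InnerProductSpace ℂ K] [CompleteSpace K]
  {P : PVM K} {A : K →ₗ.[ℂ] K}

theorem orthonormal_of_eigenvectors (hA : IsSelfAdjoint A) {I : Set ℝ}
    {e : eigenvaluesIn A I → K} (he : ∀ E : eigenvaluesIn A I, e E ∈ eigenspace A (E : ℝ)) (hn : ∀ E, ‖e E‖ = 1) :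
    Orthonormal ℂ e :=
  ⟨hn, fun E E' h => inner_eq_zero_of_mem_eigenspace hA
    (fun h' => h (Subtype.ext h')) (he E) (he E')⟩

theorem PVM.IsSpectralMeasureOf.countable_eigenvaluesIn (hP : P.IsSpectralMeasureOf A)
    (hA : IsSelfAdjoint A) {T : K →L[ℂ] K} (hTi : Function.Injective T) {I B : Set ℝ}
    (hB : MeasurableSet B) (hIB : I ⊆ B) (hfin : hsSq (T ∘L P.proj B) < ⊤) :
    (eigenvaluesIn A I).Countable := by
  have hex : ∀ E : eigenvaluesIn A I, ∃ φ ∈ eigenspace A (E : ℝ), ‖φ‖ = 1 := by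
    intro E
    obtain ⟨φ, hφ, h0⟩ := Submodule.exists_mem_ne_zero_of_ne_bot E.2.2
    refine ⟨((‖φ‖⁻¹ : ℝ) : ℂ) • φ, Submodule.smul_mem _ _ hφ, ?_⟩
    rw [norm_smul, Complex.norm_real, norm_inv, norm_norm,
      inv_mul_cancel₀ (norm_ne_zero_iff.2 h0)]
  choose e he hn using hex
  have ho := orthonormal_of_eigenvectors hA he hn
  have h1 := (tsum_enorm_sq_le_hsSq (T ∘L P.proj B) ho).trans_lt hfin
  have h2 := Summable.countable_support_ennreal h1.ne
  have h3 : (Function.support fun E => ‖(T ∘L P.proj B) (e E)‖ₑ ^ 2) = Set.univ := by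
    rw [Set.eq_univ_iff_forall]
    intro E
    rw [Function.mem_support, ContinuousLinearMap.comp_apply,
      hP.proj_of_mem_eigenspace hA (he E) hB (hIB E.2.1)]
    have h4 : T (e E) ≠ 0 := by
      rw [Ne, map_eq_zero_iff T hTi, ← norm_eq_zero, hn E]
      exact one_ne_zero
    simpa using h4
  rw [h3, Set.countable_univ_iff] at h2
  exact h2

/-- If almost all generalized eigenvalues, in the sense of limits in the weighted space, are
eigenvalues, then the spectral measure is carried by the eigenvalues. -/
theorem PVM.IsSpectralMeasureOf.proj_diff_eigenvaluesIn_eq_zero (hP : P.IsSpectralMeasureOf A)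
    (hA : IsSelfAdjoint A) {T : K →L[ℂ] K} (hT : IsSelfAdjoint T) (hTi : Function.Injective T)
    {a b : ℝ} (hfin : hsSq (T ∘L P.proj (Icc a b)) < ⊤)
    (hloc : ∀ l ∈ Ioo a b, (∃ w : K, w ≠ 0 ∧ ∃ φ : ℕ → A.domain,
      Tendsto (fun k => T (φ k : K)) atTop (𝓝 w) ∧
      Tendsto (fun k => T (A (φ k))) atTop (𝓝 ((l : ℂ) • w))) → eigenspace A l ≠ ⊥) (φ : K) :
    P.proj (Ioo a b \ eigenvaluesIn A (Ioo a b)) φ = 0 := by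
  obtain ⟨s, f, -⟩ := exists_hilbertBasis ℂ K
  set D := eigenvaluesIn A (Ioo a b) with hD
  have hDc : D.Countable :=
    hP.countable_eigenvaluesIn hA hTi measurableSet_Icc Ioo_subset_Icc_self hfin
  have hN : MeasurableSet (Ioo a b \ D) := measurableSet_Ioo.diff hDc.measurableSet
  set μ : Measure ℝ := (P.traceMeasure T f).restrict (Ioo a b) with hμ
  have hμfin : P.traceMeasure T f (Ioo a b) < ⊤ :=
    (measure_mono Ioo_subset_Icc_self).trans_lt
      ((P.traceMeasure_le hT f measurableSet_Icc).trans_lt hfin)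
  have : IsFiniteMeasure μ := ⟨by rwa [hμ, Measure.restrict_apply_univ]⟩
  -- it suffices to treat vectors in the dense range of `T`
  suffices hg : ∀ g : K, P.proj (Ioo a b \ D) (T g) = 0 by
    apply hTi
    rw [map_zero, ← inner_self_eq_zero (𝕜 := ℂ)]
    conv_lhs => rw [← hT.adjoint_eq, ContinuousLinearMap.adjoint_inner_left, hT.adjoint_eq]
    rw [P.inner_proj_left hN, hg, inner_zero_right]
  intro g
  set ρ : Measure ℝ := (P.scalarMeasure (T g)).restrict (Ioo a b) with hρ
  have hac : ρ ≪ μ := by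
    refine Measure.AbsolutelyContinuous.mk fun B hB h0 => ?_
    rw [hμ, Measure.restrict_apply hB] at h0
    have h1 := P.norm_proj_T_le hT f (hB.inter measurableSet_Ioo) (by rw [h0]; simp) g
    rw [h0, ENNReal.toReal_zero, zero_mul] at h1
    rw [hρ, Measure.restrict_apply hB, P.scalarMeasure_eq_zero_iff (hB.inter measurableSet_Ioo)]
    exact norm_eq_zero.1 (pow_eq_zero_iff two_ne_zero |>.1 (le_antisymm h1 (sq_nonneg _)))
  have hae : ∀ᵐ l ∂ρ, l ∈ D := by
    filter_upwards [hac.ae_le (Besicovitch.ae_tendsto_rnDeriv ρ μ), Measure.rnDeriv_pos hac,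
      ae_restrict_mem measurableSet_Ioo] with l h1 h2 h3
    refine ⟨h3, hloc l h3 ?_⟩
    obtain ⟨c, hc0, hcl⟩ : ∃ c : ℝ, 0 < c ∧ ENNReal.ofReal c < ρ.rnDeriv μ l := by
      obtain ⟨c, hc1, hc2⟩ := ENNReal.lt_iff_exists_nnreal_btwn.1 h2
      exact ⟨c, by exact_mod_cast hc1, by simpa using hc2⟩
    refine hP.exists_generalized_eigenvector hA hT f (g := g) (l := l) hc0 ?_
    have hball : ∀ᶠ r in 𝓝[>] (0 : ℝ), Metric.closedBall l r ⊆ Ioo a b :=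
      (Metric.eventually_nhds_iff.1 (isOpen_Ioo.mem_nhds h3)).elim fun δ hδ => by
        filter_upwards [Ioo_mem_nhdsGT hδ.1] with r hr x hx
        exact hδ.2 ((Metric.mem_closedBall.1 hx).trans_lt hr.2)
    filter_upwards [hball, h1.eventually_const_lt hcl] with r hr1 hr2
    have hBm : MeasurableSet (Metric.closedBall l r) := Metric.isClosed_closedBall.measurableSet
    rw [hμ, hρ, Measure.restrict_apply hBm, Measure.restrict_apply hBm,
      Set.inter_eq_left.2 hr1] at hr2
    have hft : P.traceMeasure T f (Metric.closedBall l r) ≠ ⊤ :=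
      ((measure_mono hr1).trans_lt hμfin).ne
    have hpos : 0 < P.traceMeasure T f (Metric.closedBall l r) := by
      rw [pos_iff_ne_zero]
      intro h0
      have h4 := P.norm_proj_T_le hT f hBm hft g
      rw [h0, ENNReal.toReal_zero, zero_mul] at h4
      have h5 : P.scalarMeasure (T g) (Metric.closedBall l r) = 0 := by
        rw [P.scalarMeasure_eq_zero_iff hBm]
        exact norm_eq_zero.1 (pow_eq_zero_iff two_ne_zero |>.1 (le_antisymm h4 (sq_nonneg _)))
      rw [h5, ENNReal.zero_div] at hr2
      exact not_lt_zero hr2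
    refine ⟨hpos, hft, ?_⟩
    rw [ENNReal.lt_div_iff_mul_lt (Or.inl hpos.ne') (Or.inl hft)] at hr2
    have h6 := ENNReal.toReal_mono (measure_ne_top _ _) hr2.le
    rw [ENNReal.toReal_mul, ENNReal.toReal_ofReal hc0.le, P.scalarMeasure_apply hBm] at h6
    simpa using h6
  rw [← P.scalarMeasure_eq_zero_iff hN]
  rw [ae_iff, hρ, Measure.restrict_apply' measurableSet_Ioo] at hae
  refine measure_mono_null (fun x hx => ?_) hae
  exact ⟨hx.2, hx.1⟩

/-- A spectral measure carried by countably many eigenvalues has pure point spectrum. -/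
theorem PVM.IsSpectralMeasureOf.closure_iSup_eigenspace (hP : P.IsSpectralMeasureOf A)
    (hA : IsSelfAdjoint A) {I : Set ℝ} (hI : MeasurableSet I)
    (hDc : (eigenvaluesIn A I).Countable)
    (h0 : ∀ φ, P.proj (I \ eigenvaluesIn A I) φ = 0) :
    (⨆ E ∈ I, eigenspace A E).topologicalClosure
      = LinearMap.range (P.proj I).toLinearMap := by
  have hmem : ∀ x, x ∈ LinearMap.range (P.proj I).toLinearMap ↔ P.proj I x = x := by
    intro x
    refine ⟨?_, fun h => ⟨x, h⟩⟩
    rintro ⟨y, rfl⟩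
    exact P.proj_idem hI y
  have hle : (⨆ E ∈ I, eigenspace A E).topologicalClosure
      ≤ LinearMap.range (P.proj I).toLinearMap := by
    apply Submodule.topologicalClosure_minimal
    · refine iSup₂_le fun E hE x hx => (hmem x).2 ?_
      exact hP.proj_of_mem_eigenspace hA hx hI hE
    · have : ((LinearMap.range (P.proj I).toLinearMap : Submodule ℂ K) : Set K)
          = {x | P.proj I x = x} := by
        ext x; exact hmem x
      rw [this]
      exact isClosed_eq (P.proj I).continuous continuous_id
  refine le_antisymm hle fun x hx => ?_
  set M := (⨆ E ∈ I, eigenspace A E).topologicalClosure with hM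
  have : CompleteSpace M := (Submodule.isClosed_topologicalClosure _).completeSpace_coe
  obtain ⟨y, hy, z, hz, rfl⟩ := M.exists_add_mem_mem_orthogonal x
  have hzI : P.proj I z = z := by
    have h1 := (hmem _).1 hx
    rw [map_add, (hmem y).1 (hle hy)] at h1
    exact add_left_cancel h1
  have hzE : ∀ E ∈ I, P.scalarMeasure z {E} = 0 := by
    intro E hE
    have hm := measurableSet_singleton E
    rw [P.scalarMeasure_eq_zero_iff hm, ← inner_self_eq_zero (𝕜 := ℂ), P.inner_proj_left hm,
      P.proj_idem hm, ← inner_conj_symm]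
    have h1 : P.proj {E} z ∈ M := Submodule.le_topologicalClosure _
      ((le_iSup₂_of_le (f := fun E (_ : E ∈ I) => eigenspace A E) E hE le_rfl)
        ((hP.mem_eigenspace_iff hA).2 (P.proj_idem hm z)))
    rw [(Submodule.mem_orthogonal _ _).1 hz _ h1, map_zero]
  have hzD : P.scalarMeasure z (eigenvaluesIn A I) = 0 :=
    (measure_null_iff_singleton hDc).2 fun E hE => hzE E hE.1
  have hz0 : P.scalarMeasure z I = 0 := by
    refine measure_mono_null ?_ (measure_union_null hzD
      ((P.scalarMeasure_eq_zero_iff (hI.diff hDc.measurableSet) z).2 (h0 z)))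
    rw [Set.union_sdiff_self]
    exact Set.subset_union_right
  rw [P.scalarMeasure_eq_zero_iff hI, hzI] at hz0
  rw [hz0, add_zero]
  exact hy

end PurePoint

/-! ### Regular boxes with probability one -/

section Probability

variable {S : Setting} {d n : ℕ} {Ω : Type*}

/-- For every energy in `I`, one of the boxes at `x` and at `y` is regular, at a scale between
`t ^ θ` and `t`, with `t` the distance between `x` and `y`. -/
def GoodPair (V : FiniteVolume S d n Ω) (ω : Ω) (m θ : ℝ) (I : Set ℝ) (x y : Lat d) : Prop :=
  ∀ E ∈ I, ∃ L : ℕ, 0 < L ∧ 6 ∣ L ∧ ‖pt x - pt y‖ ^ θ ≤ L ∧ (L : ℝ) ≤ ‖pt x - pt y‖ ∧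
    (IsRegular V ω m E x L ∨ IsRegular V ω m E y L)

theorem IsRegular.mono {V : FiniteVolume S d n Ω} {ω : Ω} {m m' E : ℝ} (hm : m' ≤ m)
    {x : Lat d} {L : ℕ} (h : IsRegular V ω m E x L) : IsRegular V ω m' E x L := by
  obtain ⟨R, h1, h2⟩ := h
  refine ⟨R, h1, h2.trans (Real.exp_le_exp.2 ?_)⟩
  have : (0 : ℝ) ≤ L := Nat.cast_nonneg L
  nlinarith

theorem GoodPair.mono {V : FiniteVolume S d n Ω} {ω : Ω} {m m' θ : ℝ} (hm : m' ≤ m) {I I' : Set ℝ}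
    (hI : I' ⊆ I) {x y : Lat d} (h : GoodPair V ω m θ I x y) : GoodPair V ω m' θ I' x y := by
  intro E hE
  obtain ⟨L, h1, h2, h3, h4, h5⟩ := h E (hI hE)
  exact ⟨L, h1, h2, h3, h4, h5.imp (fun h => h.mono hm) (fun h => h.mono hm)⟩

theorem six_dvd_scale {α : ℝ} {L₀ : ℕ} (h : 6 ∣ L₀) (k : ℕ) : 6 ∣ scale α L₀ k := by
  cases k with
  | zero => exact h
  | succ k => exact Dvd.intro _ rfl

theorem scale_succ_le (α : ℝ) (L₀ k : ℕ) :
    (scale α L₀ (k + 1) : ℝ) ≤ (scale α L₀ k : ℝ) ^ α := by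
  rw [scale]
  have h := Nat.floor_le (show 0 ≤ (scale α L₀ k : ℝ) ^ α / 6 by positivity)
  push_cast
  linarith

variable [MeasurableSpace Ω]

/-- Near an energy in the region of complete localization, pairs of boxes fail to be good with at
most stretched exponential probability in their distance. -/
theorem exists_isOpen_measure_not_goodPair_le (hd : 1 ≤ d) {ℙ : Measure Ω}
    {V : FiniteVolume S d n Ω} {J : Set ℝ} {ϱ : ℝ} (hϱ : 0 < ϱ) {E₀ : ℝ}
    (hE : E₀ ∈ completeLocalization ℙ V J ϱ) {θ : ℝ} (hθ : θ ∈ Ioo (0 : ℝ) 1) :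
    ∃ I : Set ℝ, IsOpen I ∧ E₀ ∈ I ∧ ∃ m : ℝ, 0 < m ∧ ∃ r₀ : ℝ, ∀ x y : Lat d,
      r₀ ≤ ‖pt x - pt y‖ → ℙ {ω | ¬ GoodPair V ω m θ I x y} ≤
        ENNReal.ofReal (Real.exp (-(‖pt x - pt y‖ ^ θ))) := by
  obtain ⟨-, I, hIo, -, -, hEI, hI⟩ := hE
  obtain ⟨hθ0, hθ1⟩ := hθ
  refine ⟨I, hIo, hEI, ?_⟩
  set ζ : ℝ := (1 + θ) / 2 with hζ
  have hζ0 : 0 < ζ := by linarith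
  have hζ1 : ζ < 1 := by linarith
  have hθζ : θ < ζ := by linarith
  obtain ⟨α, hα1, hα2⟩ : ∃ α : ℝ, 1 < α ∧ α < min ζ⁻¹ (ζ / θ) :=
    exists_between (lt_min ((one_lt_inv₀ hζ0).2 hζ1) ((one_lt_div hθ0).2 hθζ))
  obtain ⟨L₀, hL₀, h6, hlim, m, hm, hprob⟩ :=
    hI ζ ⟨hζ0, hζ1⟩ α ⟨hα1, hα2.trans_le (min_le_left _ _)⟩
  have hα0 : 0 < α := by linarith
  set β : ℝ := θ / ζ with hβ
  have hβ0 : 0 < β := by positivity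
  have hβα : β * α < 1 := by
    have h1 : α < ζ / θ := hα2.trans_le (min_le_right _ _)
    rw [hβ, div_mul_eq_mul_div, div_lt_one hζ0]
    rw [lt_div_iff₀ hθ0] at h1
    linarith
  have hd' : (1 : ℝ) ≤ d := by exact_mod_cast hd
  have hev : ∀ᶠ t : ℝ in atTop, 2 * (d : ℝ) ≤ t ^ (1 - β * α) :=
    (tendsto_rpow_atTop (by linarith)).eventually_ge_atTop _
  obtain ⟨r₁, hr₁⟩ := Filter.eventually_atTop.1 hev
  refine ⟨m, hm, max (max r₁ 1) (max (2 * d * ϱ) (d * (L₀ + ϱ) + 1)), fun x y hxy => ?_⟩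
  set t := ‖pt x - pt y‖ with ht
  have ht1 : r₁ ≤ t := ((le_max_left _ _).trans (le_max_left _ _)).trans hxy
  have ht2 : 1 ≤ t := ((le_max_right _ _).trans (le_max_left _ _)).trans hxy
  have ht3 : 2 * d * ϱ ≤ t := ((le_max_left _ _).trans (le_max_right _ _)).trans hxy
  have ht4 : d * (L₀ + ϱ) + 1 ≤ t := ((le_max_right _ _).trans (le_max_right _ _)).trans hxy
  have ht0 : 0 < t := by linarith
  have hd0 : (0 : ℝ) < d := by linarith
  have hsup : t / d ≤ ‖x - y‖ := by
    rw [div_le_iff₀ hd0, mul_comm, ht, ← pt_sub]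
    exact norm_pt_le (x - y)
  -- the largest scale below the distance
  have hex : ∃ k, t / d ≤ scale α L₀ k + ϱ := by
    obtain ⟨k, hk⟩ := (hlim.eventually_ge_atTop ⌈t / d - ϱ⌉₊).exists
    refine ⟨k, ?_⟩
    have h1 := Nat.le_ceil (t / d - ϱ)
    have h2 : (⌈t / d - ϱ⌉₊ : ℝ) ≤ scale α L₀ k := by exact_mod_cast hk
    linarith
  have hk0 : Nat.find hex ≠ 0 := by
    intro h0
    have h1 := Nat.find_spec hex
    rw [h0, scale, div_le_iff₀ hd0] at h1
    linarith
  obtain ⟨k, hk⟩ := Nat.exists_eq_succ_of_ne_zero hk0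
  have hk1 : t / d ≤ scale α L₀ (k + 1) + ϱ := by
    have := Nat.find_spec hex
    rwa [hk] at this
  have hk2 : scale α L₀ k + ϱ < t / d := by
    have := Nat.find_min hex (m := k) (by omega)
    exact not_le.1 this
  set L := scale α L₀ k with hL
  have hLα : t / (2 * d) ≤ (L : ℝ) ^ α := by
    have h1 := scale_succ_le α L₀ k
    have h2 : ϱ ≤ t / (2 * d) := by
      rw [le_div_iff₀ (by linarith)]; linarith
    have h3 : t / d = t / (2 * d) + t / (2 * d) := by field_simp; ring
    linarith
  have hLβ : t ^ β ≤ L := by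
    rw [← Real.rpow_le_rpow_iff (by positivity) (Nat.cast_nonneg _) hα0, ← Real.rpow_mul ht0.le]
    refine le_trans ?_ hLα
    rw [le_div_iff₀ (by linarith)]
    calc t ^ (β * α) * (2 * d) ≤ t ^ (β * α) * t ^ (1 - β * α) := by
          gcongr
          exact hr₁ t ht1
      _ = t := by rw [← Real.rpow_add ht0, add_sub_cancel, Real.rpow_one]
  have hLθ : t ^ θ ≤ L := by
    refine le_trans (Real.rpow_le_rpow_of_exponent_le ht2 ?_) hLβ
    rw [hβ, le_div_iff₀ hζ0]
    nlinarith
  have hLζ : t ^ θ ≤ (L : ℝ) ^ ζ := by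
    have h1 := Real.rpow_le_rpow (by positivity) hLβ hζ0.le
    rwa [← Real.rpow_mul ht0.le, hβ, div_mul_cancel₀ _ hζ0.ne'] at h1
  have hL0 : 0 < L := by
    have : (0 : ℝ) < L := lt_of_lt_of_le (by positivity) hLβ
    exact_mod_cast this
  have hLt : (L : ℝ) ≤ t := by
    have h1 : t / d ≤ t := div_le_self ht0.le hd'
    linarith
  refine le_trans (measure_mono fun ω hω => ?_) ((hprob k x y (by linarith)).trans
    (ENNReal.ofReal_le_ofReal (Real.exp_le_exp.2 (neg_le_neg hLζ))))
  intro hreg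
  exact hω fun E hE => ⟨L, hL0, six_dvd_scale h6 k, hLθ, hLt, hreg E hE⟩

theorem exists_measure_not_goodPair_le (hd : 1 ≤ d) {ℙ : Measure Ω}
    {V : FiniteVolume S d n Ω} {J : Set ℝ} {ϱ : ℝ} (hϱ : 0 < ϱ) {s : Set ℝ} (hs : IsCompact s)
    (hsub : s ⊆ completeLocalization ℙ V J ϱ) {θ : ℝ} (hθ : θ ∈ Ioo (0 : ℝ) 1) :
    ∃ m : ℝ, 0 < m ∧ ∃ r₀ : ℝ, ∃ q : ℝ≥0, ∀ x y : Lat d,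
      r₀ ≤ ‖pt x - pt y‖ → ℙ {ω | ¬ GoodPair V ω m θ s x y} ≤
        q * ENNReal.ofReal (Real.exp (-(‖pt x - pt y‖ ^ θ))) := by
  -- localization on a neighborhood of each point, then finitely many neighborhoods
  refine hs.induction_on (p := fun s => ∃ m : ℝ, 0 < m ∧ ∃ r₀ : ℝ, ∃ q : ℝ≥0, ∀ x y : Lat d,
      r₀ ≤ ‖pt x - pt y‖ → ℙ {ω | ¬ GoodPair V ω m θ s x y} ≤
        q * ENNReal.ofReal (Real.exp (-(‖pt x - pt y‖ ^ θ)))) ?_ ?_ ?_ ?_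
  · refine ⟨1, one_pos, 0, 0, fun x y _ => ?_⟩
    have : {ω | ¬ GoodPair V ω 1 θ ∅ x y} = ∅ := by
      ext ω; simp [GoodPair]
    rw [this]; simp
  · rintro s t hst ⟨m, hm, r₀, q, h⟩
    refine ⟨m, hm, r₀, q, fun x y hxy => (measure_mono fun ω hω hg => ?_).trans (h x y hxy)⟩
    exact hω (hg.mono le_rfl hst)
  · rintro s t ⟨m, hm, r₀, q, h⟩ ⟨m', hm', r₀', q', h'⟩
    refine ⟨min m m', lt_min hm hm', max r₀ r₀', q + q', fun x y hxy => ?_⟩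
    have h1 := h x y ((le_max_left _ _).trans hxy)
    have h2 := h' x y ((le_max_right _ _).trans hxy)
    rw [ENNReal.coe_add, add_mul]
    refine le_trans (measure_mono fun ω hω => ?_) ((measure_union_le _ _).trans (add_le_add h1 h2))
    by_contra hcon
    simp only [Set.mem_union, Set.mem_ofPred_eq, not_or, not_not] at hcon
    apply hω
    rintro E (hE | hE)
    · exact (hcon.1.mono (min_le_left m m') subset_rfl) E hE
    · exact (hcon.2.mono (min_le_right m m') subset_rfl) E hE
  · intro E hE
    obtain ⟨I, hIo, hEI, m, hm, r₀, h⟩ :=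
      exists_isOpen_measure_not_goodPair_le hd hϱ (hsub hE) hθ
    exact ⟨I, mem_nhdsWithin_of_mem_nhds (hIo.mem_nhds hEI), m, hm, r₀, 1, by simpa using h⟩

theorem summable_exp_mul_jap {θ : ℝ} (hθ : 0 < θ) :
    Summable fun p : Lat d × Lat d => Real.exp (-(1 / 2 * ‖pt p.1 - pt p.2‖ ^ θ)) *
      jap (pt p.2) ^ (-((d : ℝ) + 1)) := by
  have h1 := summable_exp_neg_rpow (d := d) (c := 1 / 2) (by norm_num) hθ
  have h2 := summable_jap_rpow (d := d) (s := (d : ℝ) + 1) (by linarith)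
  have h3 := h1.mul_of_nonneg h2 (fun _ => (Real.exp_pos _).le)
    (fun x => Real.rpow_nonneg (jap_pos (pt x)).le _)
  have hinj : Function.Injective fun p : Lat d × Lat d => (p.1 - p.2, p.2) := by
    rintro ⟨x, y⟩ ⟨x', y'⟩ h
    simp only [Prod.mk.injEq] at h
    obtain ⟨h, rfl⟩ := h
    rw [sub_left_inj] at h
    rw [h]
  refine (h3.comp_injective hinj).congr fun p => ?_
  simp [pt_sub]

/-- Almost surely, all pairs of points whose distance is large compared to a power of the logarithm
of their position are good. -/
theorem ae_exists_goodPair (hd : 1 ≤ d) {ℙ : Measure Ω}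
    {V : FiniteVolume S d n Ω} {J : Set ℝ} {ϱ : ℝ} (hϱ : 0 < ϱ) {s : Set ℝ} (hs : IsCompact s)
    (hsub : s ⊆ completeLocalization ℙ V J ϱ) {θ : ℝ} (hθ : θ ∈ Ioo (0 : ℝ) 1) :
    ∀ᵐ ω ∂ℙ, ∃ m : ℝ, 0 < m ∧ ∃ R : ℝ, ∀ x y : Lat d, R ≤ ‖pt x - pt y‖ →
      2 * (d + 1) * Real.log (jap (pt y)) ≤ ‖pt x - pt y‖ ^ θ → GoodPair V ω m θ s x y := by
  obtain ⟨m, hm, r₀, q, h⟩ := exists_measure_not_goodPair_le hd hϱ hs hsub hθ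
  let bad : Lat d × Lat d → Set Ω := fun p => {ω | r₀ ≤ ‖pt p.1 - pt p.2‖ ∧
    2 * (d + 1) * Real.log (jap (pt p.2)) ≤ ‖pt p.1 - pt p.2‖ ^ θ ∧
      ¬ GoodPair V ω m θ s p.1 p.2}
  have hbad : ∀ p, ℙ (bad p) ≤ q * ENNReal.ofReal
      (Real.exp (-(1 / 2 * ‖pt p.1 - pt p.2‖ ^ θ)) * jap (pt p.2) ^ (-((d : ℝ) + 1))) := by
    rintro ⟨x, y⟩
    by_cases hp : r₀ ≤ ‖pt x - pt y‖ ∧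
        2 * (d + 1) * Real.log (jap (pt y)) ≤ ‖pt x - pt y‖ ^ θ
    · refine ((measure_mono fun ω hω => hω.2.2).trans (h x y hp.1)).trans ?_
      gcongr
      rw [Real.rpow_def_of_pos (jap_pos _), ← Real.exp_add]
      apply Real.exp_le_exp.2
      simp only
      nlinarith [hp.2]
    · have : bad (x, y) = ∅ := by
        rw [Set.eq_empty_iff_forall_notMem]
        exact fun ω hω => hp ⟨hω.1, hω.2.1⟩
      rw [this, measure_empty]
      exact zero_le
  have hsum : ∑' p, ℙ (bad p) ≠ ⊤ := by
    refine ne_top_of_le_ne_top ?_ (ENNReal.tsum_le_tsum hbad)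
    rw [ENNReal.tsum_mul_left]
    exact ENNReal.mul_ne_top ENNReal.coe_ne_top
      (summable_exp_mul_jap hθ.1).tsum_ofReal_lt_top.ne
  filter_upwards [ae_finite_setOfPred_mem hsum] with ω hω
  obtain ⟨M, hM⟩ := (hω.image fun p : Lat d × Lat d => ‖pt p.1 - pt p.2‖).bddAbove
  refine ⟨m, hm, max r₀ (M + 1), fun x y h1 h2 => ?_⟩
  by_contra hcon
  have h3 : ‖pt x - pt y‖ ≤ M :=
    hM ⟨(x, y), ⟨(le_max_left _ _).trans h1, h2, hcon⟩, rfl⟩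
  have h4 := (le_max_right r₀ (M + 1)).trans h1
  linarith

end Probability

/-! ### Decay of generalized eigenfunctions -/

section Decay

variable {S : Setting} {d n : ℕ} {Ω : Type*}

/-- The realization `ω` is localized on the set `K` of energies: pairs of distant points are good,
and generalized eigenfunctions with energy in `K` satisfy the decay inequality. -/
structure Localized (V : FiniteVolume S d n Ω) (ω : Ω) (A : Hilb S d n →ₗ.[ℂ] Hilb S d n) (κ₀ : ℝ)
    (K : Set ℝ) : Prop where
  good : ∀ θ ∈ Ioo (0 : ℝ) 1, ∃ m : ℝ, 0 < m ∧ ∃ R : ℝ, ∀ x y : Lat d, R ≤ ‖pt x - pt y‖ →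
    2 * (d + 1) * Real.log (jap (pt y)) ≤ ‖pt x - pt y‖ ^ θ → GoodPair V ω m θ K x y
  edi : ∃ γ : ℝ, ∀ E ∈ K, ∀ ψ : Sp d → Fib n, IsGenEigenfunction κ₀ A E ψ →
    ∀ (x : Lat d) (L : ℕ), 0 < L → 6 ∣ L → ∀ R, IsResolvent (V.H ω x L) E R →
      chiNorm S x ψ ≤ γ * ‖beltOp x L R‖ * normOn S (S.belt x L) ψ

theorem jap_rpow_eq_exp (u : Sp d) (s : ℝ) : jap u ^ s = Real.exp (s * Real.log (jap u)) := by
  rw [Real.rpow_def_of_pos (jap_pos u), mul_comm]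

theorem chiNorm_le_of_isRegular {V : FiniteVolume S d n Ω} {ω : Ω}
    {E γ m : ℝ} {ψ : Sp d → Fib n} {x : Lat d} {L : ℕ}
    (hedi : ∀ R, IsResolvent (V.H ω x L) E R →
      chiNorm S x ψ ≤ γ * ‖beltOp x L R‖ * normOn S (S.belt x L) ψ)
    (hreg : IsRegular V ω m E x L) {κ : ℝ} (hκ : 0 ≤ κ) (hψ : MemW S (-κ) ψ) :
    chiNorm S x ψ ≤ |γ| * Real.exp (-(m * (L : ℝ) / 2)) *
      (((1 + d * L) * jap (pt x)) ^ κ * TinvNorm S κ ψ) := by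
  obtain ⟨R, h1, h2⟩ := hreg
  refine (hedi R h1).trans ?_
  have h3 := normOn_belt_le hκ x (Nat.cast_nonneg L) hψ
  have h0 : 0 ≤ normOn S (S.belt x L) ψ := ENNReal.toReal_nonneg
  calc γ * ‖beltOp x L R‖ * normOn S (S.belt x L) ψ
      ≤ |γ| * ‖beltOp x L R‖ * normOn S (S.belt x L) ψ := by gcongr; exact le_abs_self γ
    _ ≤ _ := by gcongr

/-- At distant points `x` and `y`, generalized eigenfunctions with the same energy decay either all
at `x` or all at `y`; when the points are close relative to the position of `y`, the a priori bound
by the weighted norm is as good as the claimed bound at `x`. -/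
theorem Localized.dichotomy {V : FiniteVolume S d n Ω} {ω : Ω}
    {A : Hilb S d n →ₗ.[ℂ] Hilb S d n} {κ₀ : ℝ} {K : Set ℝ} (h : Localized V ω A κ₀ K)
    {ζ κ κ' η N : ℝ} (hζ : ζ ∈ Ioo (0 : ℝ) 1) (hκ : 0 ≤ κ) (hκ' : 0 ≤ κ') (hη : 0 < η)
    (hN : 0 ≤ N) : ∃ C : ℝ, 0 < C ∧ ∀ E ∈ K, ∀ x y : Lat d,
      (∀ ψ : Sp d → Fib n, IsGenEigenfunction κ₀ A E ψ → MemW S (-κ) ψ → chiNorm S x ψ ≤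
        C * (jap (pt y) ^ (κ + η) * (1 + ‖pt x - pt y‖) ^ (-N) * subexp ζ x y) *
          TinvNorm S κ ψ) ∨
      (∀ ψ : Sp d → Fib n, IsGenEigenfunction κ₀ A E ψ → MemW S (-κ') ψ → chiNorm S y ψ ≤
        C * (jap (pt y) ^ (-N) * (1 + ‖pt x - pt y‖) ^ (-N) * subexp ζ x y) *
          TinvNorm S κ' ψ) := by
  obtain ⟨hζ0, hζ1⟩ := hζ
  obtain ⟨θ, hζθ, hθ1⟩ := exists_between hζ1
  obtain ⟨ξ, hζξ, hξθ⟩ := exists_between hζθ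
  have hξ0 : 0 < ξ := hζ0.trans hζξ
  have hθ0 : 0 < θ := hζ0.trans hζθ
  obtain ⟨m, hm, R, hR⟩ := h.good θ ⟨hθ0, hθ1⟩
  obtain ⟨γ, hγ⟩ := h.edi
  obtain ⟨R', hR'⟩ := Filter.eventually_atTop.1
    ((tendsto_rpow_atTop (sub_pos.2 hξθ)).eventually_ge_atTop (2 * ((d : ℝ) + 1)))
  set r := max (max R R') 1 with hr
  -- constants for distant points
  obtain ⟨C₁, -, hC₁⟩ := exists_log_le (2 * (κ + κ') + N) (show 0 < m / 6 by positivity) hθ0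
  obtain ⟨C₂, -, hC₂⟩ := exists_mul_rpow_le (κ + κ' + N) (show 0 < m / 6 by positivity) hξ0 hξθ
  obtain ⟨C₃, -, hC₃⟩ := exists_mul_rpow_le 1 (show 0 < m / 6 by positivity) hζ0 hζθ
  -- constants for close points
  obtain ⟨C₄, hC₄0, hC₄⟩ := exists_log_le (κ + N) (half_pos hη) hξ0
  obtain ⟨C₅, hC₅0, hC₅⟩ := exists_mul_rpow_le 1 (half_pos hη) hζ0 hζξ
  set F : ℝ := |γ| * (1 + d) ^ (κ + κ') * Real.exp (C₁ + C₂ + C₃) with hF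
  set G : ℝ := (1 + d) ^ κ * Real.exp (C₄ + C₅ + η * r ^ ξ) with hG
  have hr1 : 1 ≤ r := le_max_right _ _
  have hF0 : 0 ≤ F := by positivity
  have hG0 : 0 < G := by positivity
  refine ⟨F + G, by positivity, fun E hE x y => ?_⟩
  set t := ‖pt x - pt y‖ with ht
  have ht0 : 0 ≤ t := norm_nonneg _
  have hjx := jap_pos (pt x)
  have hjy := jap_pos (pt y)
  have hlog : 0 ≤ Real.log (jap (pt y)) := Real.log_nonneg (one_le_jap _)
  have hsub : subexp ζ x y = Real.exp (-(t ^ ζ)) := rfl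
  have h1t : (1 + t) ^ (-N) = Real.exp (-N * Real.log (1 + t)) := by
    rw [Real.rpow_def_of_pos (by linarith), mul_comm]
  have hlt : 0 ≤ Real.log (1 + t) := Real.log_nonneg (by linarith)
  by_cases hfar : r ≤ t ∧ Real.log (jap (pt y)) ≤ t ^ ξ
  · obtain ⟨hrt, hly⟩ := hfar
    have ht1 : 1 ≤ t := hr1.trans hrt
    have hgood := hR x y (((le_max_left _ _).trans (le_max_left _ _)).trans hrt) (by
      have h1 := hR' t (((le_max_right _ _).trans (le_max_left _ _)).trans hrt)
      calc 2 * ((d : ℝ) + 1) * Real.log (jap (pt y)) ≤ t ^ (θ - ξ) * t ^ ξ := by gcongr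
        _ = t ^ θ := by rw [← Real.rpow_add (by linarith), sub_add_cancel])
    obtain ⟨L, hL0, h6, hL1, hL2, hreg⟩ := hgood E hE
    -- the decay estimate at a point `z` whose box is regular
    have key : ∀ z : Lat d, IsRegular V ω m E z L → jap (pt z) ≤ (1 + t) * jap (pt y) →
        ∀ k : ℝ, 0 ≤ k → k ≤ κ + κ' → ∀ ψ : Sp d → Fib n, IsGenEigenfunction κ₀ A E ψ →
        MemW S (-k) ψ → chiNorm S z ψ ≤
          F * (jap (pt y) ^ (-N) * (1 + t) ^ (-N) * subexp ζ x y) * TinvNorm S k ψ := by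
      intro z hz hzy k hk hkκ ψ hψ hψk
      have hjz := jap_pos (pt z)
      refine (chiNorm_le_of_isRegular (hγ E hE ψ hψ z L hL0 h6) hz hk hψk).trans ?_
      rw [← mul_assoc]
      refine mul_le_mul_of_nonneg_right ?_ (TinvNorm_nonneg _ _)
      have e1 : ((1 + d * (L : ℝ)) * jap (pt z)) ^ k
          ≤ (1 + d) ^ (κ + κ') * ((1 + t) ^ (2 * (κ + κ')) * jap (pt y) ^ (κ + κ')) := by
        have h1 : (1 + d * (L : ℝ)) * jap (pt z)
            ≤ (1 + d) * ((1 + t) ^ (2 : ℝ) * jap (pt y)) := by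
          rw [Real.rpow_two]
          have h2 : (1 + d * (L : ℝ)) ≤ (1 + d) * (1 + t) := by
            have : (0 : ℝ) ≤ d := Nat.cast_nonneg d
            nlinarith
          calc (1 + d * (L : ℝ)) * jap (pt z)
              ≤ ((1 + d) * (1 + t)) * ((1 + t) * jap (pt y)) := by gcongr
            _ = _ := by ring
        have h3 : 1 ≤ (1 + (d : ℝ)) * ((1 + t) ^ (2 : ℝ) * jap (pt y)) := by
          refine one_le_mul_of_one_le_of_one_le ?_ (one_le_mul_of_one_le_of_one_le
            (Real.one_le_rpow (by linarith) (by norm_num)) (one_le_jap _))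
          have : (0 : ℝ) ≤ d := Nat.cast_nonneg d
          linarith
        calc _ ≤ ((1 + d) * ((1 + t) ^ (2 : ℝ) * jap (pt y))) ^ k :=
              Real.rpow_le_rpow (by positivity) h1 hk
          _ ≤ ((1 + d) * ((1 + t) ^ (2 : ℝ) * jap (pt y))) ^ (κ + κ') :=
              Real.rpow_le_rpow_of_exponent_le h3 hkκ
          _ = _ := by
              rw [Real.mul_rpow (by positivity) (by positivity),
                Real.mul_rpow (by positivity) hjy.le, ← Real.rpow_mul (by positivity)]
      have e2 : Real.exp (-(m * (L : ℝ) / 2)) *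
          ((1 + t) ^ (2 * (κ + κ')) * jap (pt y) ^ (κ + κ')) ≤
          Real.exp (C₁ + C₂ + C₃) * (jap (pt y) ^ (-N) * (1 + t) ^ (-N) * subexp ζ x y) := by
        rw [hsub, h1t, jap_rpow_eq_exp, jap_rpow_eq_exp, Real.rpow_def_of_pos (by linarith)]
        simp only [← Real.exp_add]
        apply Real.exp_le_exp.2
        have b1 := hC₁ t ht0
        have b2 := hC₂ t ht0
        have b3 := hC₃ t ht0
        have b4 : (κ + κ' + N) * Real.log (jap (pt y)) ≤ (κ + κ' + N) * t ^ ξ := by gcongr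
        have b5 : m * t ^ θ ≤ m * L := by gcongr
        linarith
      calc |γ| * Real.exp (-(m * (L : ℝ) / 2)) * ((1 + d * (L : ℝ)) * jap (pt z)) ^ k
          ≤ |γ| * Real.exp (-(m * (L : ℝ) / 2)) *
            ((1 + d) ^ (κ + κ') * ((1 + t) ^ (2 * (κ + κ')) * jap (pt y) ^ (κ + κ'))) := by gcongr
        _ = |γ| * (1 + d) ^ (κ + κ') * (Real.exp (-(m * (L : ℝ) / 2)) *
            ((1 + t) ^ (2 * (κ + κ')) * jap (pt y) ^ (κ + κ'))) := by ring
        _ ≤ |γ| * (1 + d) ^ (κ + κ') * (Real.exp (C₁ + C₂ + C₃) *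
            (jap (pt y) ^ (-N) * (1 + t) ^ (-N) * subexp ζ x y)) := by gcongr
        _ = _ := by rw [hF]; ring
    have hs0 := subexp_pos ζ x y
    rcases hreg with hreg | hreg
    · left
      intro ψ hψ hψκ
      refine (key x hreg (jap_le_mul _ _) κ hκ (by linarith) ψ hψ hψκ).trans ?_
      refine mul_le_mul_of_nonneg_right ?_ (TinvNorm_nonneg _ _)
      have : jap (pt y) ^ (-N) ≤ jap (pt y) ^ (κ + η) :=
        Real.rpow_le_rpow_of_exponent_le (one_le_jap _) (by linarith)
      gcongr
      linarith
    · right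
      intro ψ hψ hψκ
      refine (key y hreg (le_mul_of_one_le_left hjy.le (by linarith)) κ' hκ' (by linarith)
        ψ hψ hψκ).trans ?_
      refine mul_le_mul_of_nonneg_right ?_ (TinvNorm_nonneg _ _)
      gcongr
      linarith
  · left
    intro ψ _ hψκ
    refine (chiNorm_le hκ x hψκ).trans ?_
    refine mul_le_mul_of_nonneg_right ?_ (TinvNorm_nonneg _ _)
    have e1 : (1 + t) ^ κ * jap (pt y) ^ κ ≤ Real.exp (C₄ + C₅ + η * r ^ ξ) *
        (jap (pt y) ^ (κ + η) * (1 + t) ^ (-N) * subexp ζ x y) := by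
      rw [hsub, h1t, jap_rpow_eq_exp, jap_rpow_eq_exp, Real.rpow_def_of_pos (by linarith)]
      simp only [← Real.exp_add]
      apply Real.exp_le_exp.2
      have b1 := hC₄ t ht0
      have b2 := hC₅ t ht0
      have b3 : η * t ^ ξ ≤ η * r ^ ξ + η * Real.log (jap (pt y)) := by
        rw [← mul_add]
        refine mul_le_mul_of_nonneg_left ?_ hη.le
        have b4 : 0 ≤ r ^ ξ := by positivity
        rcases lt_or_ge t r with hlt | hge
        · have : t ^ ξ ≤ r ^ ξ := Real.rpow_le_rpow ht0 hlt.le hξ0.le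
          linarith
        · have : ¬ Real.log (jap (pt y)) ≤ t ^ ξ := fun hc => hfar ⟨hge, hc⟩
          linarith [not_le.1 this]
      linarith
    have hs0 := subexp_pos ζ x y
    calc (1 + (d : ℝ)) ^ κ * jap (pt x) ^ κ
        ≤ (1 + (d : ℝ)) ^ κ * ((1 + t) ^ κ * jap (pt y) ^ κ) := by
          gcongr
          exact jap_rpow_le_mul hκ _ _
      _ ≤ (1 + (d : ℝ)) ^ κ * (Real.exp (C₄ + C₅ + η * r ^ ξ) *
          (jap (pt y) ^ (κ + η) * (1 + t) ^ (-N) * subexp ζ x y)) := by gcongr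
      _ = G * (jap (pt y) ^ (κ + η) * (1 + t) ^ (-N) * subexp ζ x y) := by rw [hG]; ring
      _ ≤ _ := by gcongr; linarith

/-- A generalized eigenfunction which is not small at `y` compared to its weighted norm forces all
generalized eigenfunctions with the same energy to be localized around `y`. -/
theorem Localized.chiNorm_le_of_center {V : FiniteVolume S d n Ω} {ω : Ω}
    {A : Hilb S d n →ₗ.[ℂ] Hilb S d n} {κ₀ : ℝ} {K : Set ℝ} (h : Localized V ω A κ₀ K)
    {ζ κ κ' η : ℝ} (hζ : ζ ∈ Ioo (0 : ℝ) 1) (hκ : 0 ≤ κ) (hκ' : 0 ≤ κ') (hη : 0 < η) :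
    ∃ C : ℝ, 0 < C ∧ ∀ E ∈ K, ∀ y : Lat d, ∀ B : ℝ, 0 ≤ B → ∀ ψ : Sp d → Fib n,
      IsGenEigenfunction κ₀ A E ψ → MemW S (-κ') ψ → 0 < chiNorm S y ψ →
      TinvNorm S κ' ψ ≤ B * chiNorm S y ψ → ∀ φ : Sp d → Fib n, IsGenEigenfunction κ₀ A E φ →
      MemW S (-κ) φ → ∀ x : Lat d,
      chiNorm S x φ ≤ C * (1 + B) * TinvNorm S κ φ * jap (pt y) ^ (κ + η) * subexp ζ x y := by
  obtain ⟨C, hC, hdich⟩ := h.dichotomy hζ hκ hκ' hη hκ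
  refine ⟨C * (1 + d) ^ κ, by positivity, fun E hE y B hB ψ hψ hψκ hpos hψB φ hφ hφκ x => ?_⟩
  have hs0 := subexp_pos ζ x y
  have hjy := jap_pos (pt y)
  have hT := TinvNorm_nonneg (S := S) κ φ
  set t := ‖pt x - pt y‖ with ht
  have ht0 : 0 ≤ t := norm_nonneg _
  have hd1 : 1 ≤ (1 + (d : ℝ)) ^ κ :=
    Real.one_le_rpow (by have : (0 : ℝ) ≤ d := Nat.cast_nonneg d; linarith) hκ
  have h1t : (1 + t) ^ (-κ) ≤ 1 :=
    Real.rpow_le_one_of_one_le_of_nonpos (by linarith) (by linarith)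
  have hjη : 1 ≤ jap (pt y) ^ (κ + η) := Real.one_le_rpow (one_le_jap _) (by linarith)
  rcases hdich E hE x y with h1 | h1
  · calc chiNorm S x φ ≤ C * (jap (pt y) ^ (κ + η) * (1 + t) ^ (-κ) * subexp ζ x y) *
          TinvNorm S κ φ := h1 φ hφ hφκ
      _ ≤ C * (jap (pt y) ^ (κ + η) * 1 * subexp ζ x y) * TinvNorm S κ φ := by gcongr
      _ = C * 1 * 1 * TinvNorm S κ φ * jap (pt y) ^ (κ + η) * subexp ζ x y := by ring
      _ ≤ C * (1 + d) ^ κ * (1 + B) * TinvNorm S κ φ * jap (pt y) ^ (κ + η) * subexp ζ x y := by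
          gcongr
          linarith
  · have h2 := h1 ψ hψ hψκ
    have h3 : 1 ≤ C * (jap (pt y) ^ (-κ) * (1 + t) ^ (-κ) * subexp ζ x y) * B := by
      refine le_of_mul_le_mul_right ?_ hpos
      rw [one_mul, mul_assoc _ B]
      exact h2.trans (by gcongr)
    have h4 : jap (pt x) ^ κ ≤ (1 + t) ^ κ * jap (pt y) ^ κ := jap_rpow_le_mul hκ _ _
    have e1 : jap (pt y) ^ κ * jap (pt y) ^ (-κ) = 1 := by
      rw [← Real.rpow_add hjy, add_neg_cancel, Real.rpow_zero]
    have e2 : (1 + t) ^ κ * (1 + t) ^ (-κ) = 1 := by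
      rw [← Real.rpow_add (by linarith), add_neg_cancel, Real.rpow_zero]
    calc chiNorm S x φ ≤ (1 + d) ^ κ * jap (pt x) ^ κ * TinvNorm S κ φ * 1 := by
          rw [mul_one]; exact chiNorm_le hκ x hφκ
      _ ≤ (1 + d) ^ κ * ((1 + t) ^ κ * jap (pt y) ^ κ) * TinvNorm S κ φ *
          (C * (jap (pt y) ^ (-κ) * (1 + t) ^ (-κ) * subexp ζ x y) * B) := by gcongr
      _ = C * (1 + d) ^ κ * B * TinvNorm S κ φ * 1 * subexp ζ x y *
          ((jap (pt y) ^ κ * jap (pt y) ^ (-κ)) * ((1 + t) ^ κ * (1 + t) ^ (-κ))) := by ring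
      _ = C * (1 + d) ^ κ * B * TinvNorm S κ φ * 1 * subexp ζ x y := by
          rw [e1, e2]; ring
      _ ≤ C * (1 + d) ^ κ * (1 + B) * TinvNorm S κ φ * jap (pt y) ^ (κ + η) * subexp ζ x y := by
          gcongr
          linarith

theorem Localized.memLp {V : FiniteVolume S d n Ω} {ω : Ω}
    {A : Hilb S d n →ₗ.[ℂ] Hilb S d n} {κ₀ : ℝ} {K : Set ℝ} (h : Localized V ω A κ₀ K)
    (hκ₀ : 0 ≤ κ₀) {E : ℝ} (hE : E ∈ K) {ψ : Sp d → Fib n} (hψ : IsGenEigenfunction κ₀ A E ψ) :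
    MemLp ψ 2 (S.vol d) := by
  obtain ⟨y, hy⟩ := exists_chiNorm_pos hκ₀ hψ.1 hψ.2.1
  obtain ⟨C, -, hC⟩ := h.chiNorm_le_of_center (ζ := 1 / 2) (η := 1) (by norm_num) hκ₀ hκ₀ one_pos
  refine memLp_of_chiNorm_le hκ₀ (show (0 : ℝ) < 1 / 2 by norm_num) hψ.1 y fun x =>
    hC E hE y (TinvNorm S κ₀ ψ / chiNorm S y ψ)
      (div_nonneg (TinvNorm_nonneg _ _) hy.le) ψ hψ hψ.1 hy ?_ ψ hψ hψ.1 x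
  rw [div_mul_cancel₀ _ hy.ne']

theorem chiNorm_zero (x : Lat d) : chiNorm S x ((0 : Hilb S d n) : Sp d → Fib n) = 0 := by
  rw [chiNorm, normOn_congr _ (Lp.coeFn_zero (Fib n) 2 (S.vol d)), normOn]
  simp

/-- Bookkeeping for a product whose first factor `a` decays: `s` is the stretched exponential, `T` a
negative power of the distance, `Y` and `Y₁` powers of the bracket, `p` and `q` weighted norms. -/
theorem mul_le_of_decay_left {a b C D Y Y₁ Z T T₁ s p q : ℝ} (ha : a ≤ C * (Y₁ * T * s) * p)
    (hb : b ≤ D * Y * q) (hT : T ≤ T₁) (hY : Y₁ * Y = Z) (hb0 : 0 ≤ b) (hp : 0 ≤ p) (hq : 0 ≤ q)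
    (hC : 0 ≤ C) (hD : 0 ≤ D) (hY0 : 0 ≤ Y) (hY1 : 0 ≤ Y₁) (hT0 : 0 ≤ T) (hs : 0 ≤ s) :
    a * b ≤ C * D * p * q * (Z * T₁) * s := by
  subst hY
  calc a * b ≤ (C * (Y₁ * T * s) * p) * (D * Y * q) := mul_le_mul ha hb hb0 (by positivity)
    _ = C * D * p * q * (Y₁ * Y * T) * s := by ring
    _ ≤ _ := by gcongr

/-- Bookkeeping for a product whose second factor `b` decays: the negative power `T₁` of the distance
pays for the factor `T` that turns the power `X` of the bracket at `x` into the power `Y` at `y`. -/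
theorem mul_le_of_decay_right {a b C D X Y Y₁ Z T T₁ T₂ s p q : ℝ} (ha : a ≤ D * X * p)
    (hb : b ≤ C * (Y₁ * T₁ * s) * q) (hX : X ≤ T * Y) (hT : T * T₁ = T₂) (hY : Y * Y₁ ≤ Z)
    (hb0 : 0 ≤ b) (hp : 0 ≤ p) (hq : 0 ≤ q) (hC : 0 ≤ C) (hD : 0 ≤ D) (hX0 : 0 ≤ X)
    (hY1 : 0 ≤ Y₁) (hT2 : 0 ≤ T ∧ 0 ≤ T₁) (hs : 0 ≤ s) :
    a * b ≤ C * D * p * q * (Z * T₂) * s := by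
  subst hT
  obtain ⟨hT0, hT1⟩ := hT2
  calc a * b ≤ (D * X * p) * (C * (Y₁ * T₁ * s) * q) := mul_le_mul ha hb hb0 (by positivity)
    _ ≤ (D * (T * Y) * p) * (C * (Y₁ * T₁ * s) * q) := by gcongr
    _ = C * D * p * q * ((Y * Y₁) * (T * T₁)) * s := by ring
    _ ≤ _ := by gcongr

/-- The correlation bound behind SUDEC. -/
theorem Localized.chiNorm_mul_chiNorm_le {V : FiniteVolume S d n Ω} {ω : Ω}
    {A : Hilb S d n →ₗ.[ℂ] Hilb S d n} {κ₀ : ℝ} {K : Set ℝ} (h : Localized V ω A κ₀ K)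
    (hκ₀ : 0 ≤ κ₀) {ζ κ η M : ℝ} (hζ : ζ ∈ Ioo (0 : ℝ) 1) (hκ : 0 ≤ κ) (hη : 0 < η)
    (hM : 0 ≤ M) : ∃ C : ℝ, 0 < C ∧ ∀ E ∈ K, ∀ φ ∈ eigenspace A E, ∀ ψ ∈ eigenspace A E,
      ∀ x y : Lat d, chiNorm S x φ * chiNorm S y ψ ≤ C * TinvNorm S κ φ * TinvNorm S κ ψ *
        (jap (pt y) ^ (2 * κ + η) * (1 + ‖pt x - pt y‖) ^ (-M)) * subexp ζ x y := by
  obtain ⟨C, hC, hdich⟩ := h.dichotomy hζ hκ hκ hη (add_nonneg hκ hM)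
  refine ⟨C * (1 + d) ^ κ, by positivity, fun E hE φ hφ ψ hψ x y => ?_⟩
  have hs0 := subexp_pos ζ x y
  have hjy := jap_pos (pt y)
  have hTφ := TinvNorm_nonneg (S := S) κ φ
  have hTψ := TinvNorm_nonneg (S := S) κ ψ
  set t := ‖pt x - pt y‖ with ht
  have ht0 : 0 ≤ t := norm_nonneg _
  by_cases hφ0 : φ = 0
  · rw [hφ0, chiNorm_zero, zero_mul]
    have := TinvNorm_nonneg (S := S) κ ((0 : Hilb S d n) : Sp d → Fib n)
    positivity
  by_cases hψ0 : ψ = 0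
  · rw [hψ0, chiNorm_zero, mul_zero]
    have := TinvNorm_nonneg (S := S) κ ((0 : Hilb S d n) : Sp d → Fib n)
    positivity
  have hgφ := isGenEigenfunction_of_mem_eigenspace hκ₀ hφ hφ0
  have hgψ := isGenEigenfunction_of_mem_eigenspace hκ₀ hψ hψ0
  have hcx := chiNorm_le hκ x (memW_coe (S := S) hκ φ)
  have hcy := chiNorm_le hκ y (memW_coe (S := S) hκ ψ)
  have e3 : (1 + t) ^ (-(κ + M)) ≤ (1 + t) ^ (-M) :=
    Real.rpow_le_rpow_of_exponent_le (by linarith) (by linarith)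
  rcases hdich E hE x y with h1 | h1
  · refine mul_le_of_decay_left (h1 φ hgφ (memW_coe hκ φ)) hcy e3 ?_ (chiNorm_nonneg _ _) hTφ hTψ
      hC.le (by positivity) (by positivity) (by positivity) (by positivity) hs0.le
    rw [← Real.rpow_add hjy]
    congr 1
    ring
  · have hjx := jap_pos (pt x)
    refine mul_le_of_decay_right hcx (h1 ψ hgψ (memW_coe hκ ψ))
      (jap_rpow_le_mul hκ (pt x) (pt y)) ?_ ?_ (chiNorm_nonneg _ _) hTφ hTψ
      hC.le (by positivity) (by positivity) (by positivity)
      ⟨by positivity, by positivity⟩ hs0.le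
    · rw [← Real.rpow_add (by linarith)]
      congr 1
      ring
    · rw [← Real.rpow_add hjy]
      exact Real.rpow_le_rpow_of_exponent_le (one_le_jap _) (by linarith)

/-- Summable uniform decay of eigenfunction correlations (SUDEC). -/
theorem Localized.sudec {V : FiniteVolume S d n Ω} {ω : Ω}
    {A : Hilb S d n →ₗ.[ℂ] Hilb S d n} {κ₀ : ℝ} {K : Set ℝ} (h : Localized V ω A κ₀ K)
    (hκ₀ : 0 ≤ κ₀) {ζ ε κ : ℝ} (hζ : ζ ∈ Ioo (0 : ℝ) 1) (hε : 0 < ε) (hκ : (d : ℝ) / 2 < κ)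
    (hκε : κ < (d + ε) / 2) : ∃ C : ℝ, ∀ E ∈ K, ∀ φ ∈ eigenspace A E, ∀ ψ ∈ eigenspace A E,
      ∀ x y : Lat d,
        chiNorm S x φ * chiNorm S y ψ ≤ C * TinvNorm S κ φ * TinvNorm S κ ψ *
          jap (pt y) ^ (d + ε) * subexp ζ x y ∧
        chiNorm S x φ * chiNorm S y ψ ≤ C * TinvNorm S κ φ * TinvNorm S κ ψ *
          jap (pt x) ^ ((d + ε) / 2) * jap (pt y) ^ ((d + ε) / 2) * subexp ζ x y := by
  have hd0 : (0 : ℝ) ≤ d := Nat.cast_nonneg d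
  have hκ0 : 0 ≤ κ := le_trans (by positivity) hκ.le
  set M : ℝ := (d + ε) / 2 with hM
  have hM0 : 0 ≤ M := by positivity
  obtain ⟨C, hC, hb⟩ := h.chiNorm_mul_chiNorm_le hκ₀ hζ hκ0 (η := d + ε - 2 * κ)
    (by linarith) hM0
  refine ⟨C, fun E hE φ hφ ψ hψ x y => ?_⟩
  have hs0 := subexp_pos ζ x y
  have hjy := jap_pos (pt y)
  have hTφ := TinvNorm_nonneg (S := S) κ φ
  have hTψ := TinvNorm_nonneg (S := S) κ ψ
  have h1 := hb E hE φ hφ ψ hψ x y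
  rw [add_sub_cancel] at h1
  set t := ‖pt x - pt y‖ with ht
  have ht0 : 0 ≤ t := norm_nonneg _
  constructor
  · refine h1.trans ?_
    have : (1 + t) ^ (-M) ≤ 1 :=
      Real.rpow_le_one_of_one_le_of_nonpos (by linarith) (by linarith)
    gcongr
    exact mul_le_of_le_one_right (by positivity) this
  · refine h1.trans ?_
    have h2 : jap (pt y) ^ M ≤ (1 + t) ^ M * jap (pt x) ^ M := by
      have := jap_rpow_le_mul hM0 (pt y) (pt x)
      rwa [norm_sub_rev] at this
    have e1 : (1 + t) ^ M * (1 + t) ^ (-M) = 1 := by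
      rw [← Real.rpow_add (by linarith), add_neg_cancel, Real.rpow_zero]
    have e2 : jap (pt y) ^ ((d : ℝ) + ε) = jap (pt y) ^ M * jap (pt y) ^ M := by
      rw [← Real.rpow_add hjy]; congr 1; rw [hM]; ring
    have h3 : jap (pt y) ^ ((d : ℝ) + ε) * (1 + t) ^ (-M) ≤ jap (pt x) ^ M * jap (pt y) ^ M := by
      rw [e2]
      calc jap (pt y) ^ M * jap (pt y) ^ M * (1 + t) ^ (-M)
          ≤ ((1 + t) ^ M * jap (pt x) ^ M) * jap (pt y) ^ M * (1 + t) ^ (-M) := by gcongr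
        _ = ((1 + t) ^ M * (1 + t) ^ (-M)) * (jap (pt x) ^ M * jap (pt y) ^ M) := by ring
        _ = _ := by rw [e1, one_mul]
    calc _ ≤ C * TinvNorm S κ φ * TinvNorm S κ ψ * (jap (pt x) ^ M * jap (pt y) ^ M) *
          subexp ζ x y := by gcongr
      _ = _ := by ring

end Decay

/-! ### Translations and the uniform local trace bound -/

section Translation

variable {S : Setting} {d n : ℕ}

theorem measurePreserving_sub_pt (S : Setting) (a : Lat d) :
    MeasurePreserving (fun u : Sp d => u - pt a) (S.vol d) (S.vol d) := by
  cases S with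
  | continuum => exact measurePreserving_sub_right volume (pt a)
  | lattice =>
    refine ⟨by fun_prop, ?_⟩
    ext s hs
    have hm : Measurable fun u : Sp d => u - pt a := by fun_prop
    rw [Measure.map_apply hm hs, Setting.vol, Measure.sum_apply _ (hm hs), Measure.sum_apply _ hs,
      ← (Equiv.subRight a).tsum_eq (fun x : Lat d => Measure.dirac (pt x) s)]
    refine tsum_congr fun x => ?_
    rw [Measure.dirac_apply' _ (hm hs), Measure.dirac_apply' _ hs]
    simp only [Equiv.subRight_apply, pt_sub]
    rfl

theorem norm_phase_smul (t : ℝ) (v : Fib n) : ‖Complex.exp (Complex.I * t) • v‖ = ‖v‖ := by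
  rw [norm_smul, mul_comm Complex.I, Complex.norm_exp_ofReal_mul_I, one_mul]

theorem memLp_translate (a : Lat d) {θ : Sp d → ℝ} (hθ : Measurable θ) (φ : Hilb S d n) :
    MemLp (fun u => Complex.exp (Complex.I * θ u) • φ (u - pt a)) 2 (S.vol d) := by
  have h := (Lp.memLp φ).comp_measurePreserving (measurePreserving_sub_pt S a)
  refine h.of_le ?_ (ae_of_all _ fun u => (norm_phase_smul _ _).le)
  have hm : Measurable fun u => Complex.exp (Complex.I * θ u) := by fun_prop
  exact hm.aestronglyMeasurable.smul h.1

/-- The (magnetic) translation `U(a)`. -/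
def translate (a : Lat d) {θ : Sp d → ℝ} (hθ : Measurable θ) (φ : Hilb S d n) : Hilb S d n :=
  (memLp_translate a hθ φ).toLp _

theorem isTranslate_translate (a : Lat d) {θ : Sp d → ℝ} (hθ : Measurable θ) (φ : Hilb S d n) :
    IsTranslate a θ φ (translate a hθ φ) :=
  (memLp_translate a hθ φ).coeFn_toLp

theorem isTranslate_smul {a : Lat d} {θ : Sp d → ℝ} {φ φ' : Hilb S d n} (c : ℂ)
    (h : IsTranslate a θ φ φ') : IsTranslate a θ (c • φ) (c • φ') := by
  have h1 := (measurePreserving_sub_pt S a).quasiMeasurePreserving.ae (Lp.coeFn_smul c φ)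
  rw [IsTranslate] at h ⊢
  filter_upwards [h, h1, Lp.coeFn_smul c φ'] with u e1 e2 e3
  rw [e3, e2, Pi.smul_apply, Pi.smul_apply, e1, smul_comm]

theorem inner_translate (a : Lat d) {θ : Sp d → ℝ} (hθ : Measurable θ) (φ ψ : Hilb S d n) :
    ⟪translate a hθ φ, translate a hθ ψ⟫_ℂ = ⟪φ, ψ⟫_ℂ := by
  rw [L2.inner_def, L2.inner_def]
  have hemb : MeasurableEmbedding fun u : Sp d => u - pt a :=
    (MeasurableEquiv.subRight (pt a)).measurableEmbedding
  rw [← (measurePreserving_sub_pt S a).integral_comp hemb (fun u => ⟪φ u, ψ u⟫_ℂ)]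
  refine integral_congr_ae ?_
  filter_upwards [isTranslate_translate a hθ φ, isTranslate_translate a hθ ψ] with u e1 e2
  rw [e1, e2, inner_smul_left, inner_smul_right, ← mul_assoc, Complex.conj_mul', mul_comm Complex.I,
    Complex.norm_exp_ofReal_mul_I]
  simp

theorem chiE_translate (a x : Lat d) {θ : Sp d → ℝ} (hθ : Measurable θ) (φ : Hilb S d n) :
    chiE S (x + a) (translate a hθ φ) = chiE S x φ := by
  have hm : AEStronglyMeasurable ((cube x 1).indicator φ) (S.vol d) :=
    (Lp.aestronglyMeasurable φ).indicator (measurableSet_cube x 1)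
  rw [chiE, chiE, ← eLpNorm_comp_measurePreserving hm (measurePreserving_sub_pt S a)]
  refine eLpNorm_congr_norm_ae ?_
  filter_upwards [isTranslate_translate a hθ φ] with u hu
  have hiff : u ∈ cube (x + a) 1 ↔ u - pt a ∈ cube x 1 := by
    simp only [cube, Set.mem_ofPred_eq, pt, PiLp.sub_apply, Pi.add_apply, Int.cast_add]
    refine forall_congr' fun i => ?_
    rw [show u i - ((x i : ℝ) + a i) = u i - a i - x i by ring]
  by_cases h : u ∈ cube (x + a) 1
  · rw [Set.indicator_of_mem h, Function.comp_apply, Set.indicator_of_mem (hiff.1 h), hu,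
      norm_phase_smul]
  · rw [Set.indicator_of_notMem h, Function.comp_apply,
      Set.indicator_of_notMem (fun h' => h (hiff.2 h'))]

variable {Ω : Type*} [MeasurableSpace Ω] {ℙ : Measure Ω}

/-- Eigenfunctions are covariant. -/
theorem RandomOperator.translate_mem_eigenspace (X : RandomOperator S d n ℙ) {a : Lat d} {ω : Ω}
    (hcov : ∀ φ ψ φ' ψ' : Hilb S d n, IsTranslate a (X.θ a) φ φ' → IsTranslate a (X.θ a) ψ ψ' →
      ((φ, ψ) ∈ (X.H ω).graph ↔ (φ', ψ') ∈ (X.H (X.τ a ω)).graph))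
    {E : ℝ} {φ : Hilb S d n} (hφ : φ ∈ eigenspace (X.H ω) E) :
    translate a (X.measurable_θ a) φ ∈ eigenspace (X.H (X.τ a ω)) E := by
  obtain ⟨hd, he⟩ := hφ
  have hg : (φ, (E : ℂ) • φ) ∈ (X.H ω).graph :=
    (LinearPMap.mem_graph_iff _).2 ⟨⟨φ, hd⟩, rfl, he⟩
  have ht := isTranslate_translate a (X.measurable_θ a) φ
  obtain ⟨⟨ψ, hd'⟩, h1, h2⟩ := (LinearPMap.mem_graph_iff _).1
    ((hcov _ _ _ _ ht (isTranslate_smul (E : ℂ) ht)).1 hg)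
  simp only at h1 h2
  subst h1
  exact ⟨hd', h2⟩

/-- By covariance, the trace estimate at the origin gives a trace estimate at every point: any
orthonormal family of eigenfunctions has uniformly bounded local mass. -/
theorem RandomOperator.ae_tsum_chiE_sq_le (X : RandomOperator S d n ℙ) {κ₀ : ℝ} (hκ₀ : 0 ≤ κ₀)
    {B : Set ℝ} (hB : MeasurableSet B) {C : ℝ≥0} (hC : ∀ᵐ ω ∂ℙ, X.mu κ₀ ω B ≤ C) :
    ∃ C' : ℝ≥0, ∀ᵐ ω ∂ℙ, ∀ (ι : Type) (e : ι → Hilb S d n), Orthonormal ℂ e →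
      (∀ i, ∃ E ∈ B, e i ∈ eigenspace (X.H ω) E) → ∀ x : Lat d,
        ∑' i, chiE S x (e i) ^ 2 ≤ C' := by
  refine ⟨(Real.toNNReal ((1 + d) ^ κ₀)) ^ 2 * C, ?_⟩
  have h1 : ∀ᵐ ω ∂ℙ, ∀ a : Lat d, X.mu κ₀ (X.τ a ω) B ≤ C :=
    ae_all_iff.2 fun a => (X.measurePreserving a).quasiMeasurePreserving.ae hC
  filter_upwards [h1, ae_all_iff.2 X.covariant] with ω hω hcov ι e he hE x
  set e' : ι → Hilb S d n := fun i => translate (-x) (X.measurable_θ (-x)) (e i) with he'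
  have ho : Orthonormal ℂ e' := by
    classical
    rw [orthonormal_iff_ite] at he ⊢
    intro i j
    rw [he', inner_translate]
    exact he i j
  have hP : ∀ i, (X.P (X.τ (-x) ω)).proj B (e' i) = e' i := by
    intro i
    obtain ⟨E, hEB, hEe⟩ := hE i
    exact (X.spectral _).proj_of_mem_eigenspace (X.selfAdjoint _)
      (X.translate_mem_eigenspace (hcov (-x)) hEe) hB hEB
  have hterm : ∀ i, chiE S x (e i) ^ 2 ≤ (Real.toNNReal ((1 + d) ^ κ₀) : ℝ≥0∞) ^ 2 *
      ‖(tinv S d n hκ₀ ∘L (X.P (X.τ (-x) ω)).proj B) (e' i)‖ₑ ^ 2 := by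
    intro i
    rw [ContinuousLinearMap.comp_apply, hP, ← mul_pow]
    gcongr
    have h2 : chiE S x (e i) = chiE S 0 (e' i) := by
      rw [← chiE_translate (-x) x (X.measurable_θ (-x)) (e i), add_neg_cancel]
    have h3 := chiNorm_le hκ₀ 0 (memW_coe (S := S) hκ₀ (e' i))
    have h4 : jap (pt (0 : Lat d)) = 1 := by rw [pt_zero, jap]; simp
    rw [h4, Real.one_rpow, mul_one, ← norm_tinv hκ₀] at h3
    rw [h2, ← ofReal_chiNorm hκ₀ (memW_coe hκ₀ (e' i)), ← ofReal_norm, ← ENNReal.ofReal,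
      ← ENNReal.ofReal_mul (by positivity)]
    exact ENNReal.ofReal_le_ofReal h3
  calc ∑' i, chiE S x (e i) ^ 2
      ≤ ∑' i, (Real.toNNReal ((1 + d) ^ κ₀) : ℝ≥0∞) ^ 2 *
        ‖(tinv S d n hκ₀ ∘L (X.P (X.τ (-x) ω)).proj B) (e' i)‖ₑ ^ 2 :=
        ENNReal.tsum_le_tsum hterm
    _ ≤ (Real.toNNReal ((1 + d) ^ κ₀) : ℝ≥0∞) ^ 2 * C := by
        rw [ENNReal.tsum_mul_left]
        gcongr
        refine (tsum_enorm_sq_le_hsSq _ ho).trans ?_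
        rw [← X.mu_eq_hsSq hκ₀]
        exact hω (-x)
    _ = _ := by push_cast; rfl

end Translation

/-! ### Counting eigenvalues by their centers of localization -/

section Counting

variable {S : Setting} {d n : ℕ} {A : Hilb S d n →ₗ.[ℂ] Hilb S d n} {K : Set ℝ}

theorem TinvNorm_le_norm {κ : ℝ} (hκ : 0 ≤ κ) (φ : Hilb S d n) : TinvNorm S κ φ ≤ ‖φ‖ := by
  rw [Lp.norm_def]
  exact ENNReal.toReal_mono (Lp.memLp φ).eLpNorm_ne_top (eLpNorm_mono (norm_weighted_le hκ φ))

/-- Eigenfunctions localized around a center carry at least half of their mass in a ball around the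
origin of radius proportional to the distance of the center from the origin. -/
theorem exists_half_le_sum_chiNorm_sq {c : ℝ → Lat d} {κ p C₁ : ℝ} (hκ : 0 ≤ κ) (hp : 0 ≤ p)
    (hC₁ : 0 ≤ C₁) (hsule : ∀ E ∈ K, ∀ φ ∈ eigenspace A E, ∀ x : Lat d, chiNorm S x φ ≤
      C₁ * TinvNorm S κ φ * jap (pt (c E)) ^ p * subexp (1 / 2) x (c E)) :
    ∃ r : ℝ, 1 ≤ r ∧ ∀ L : ℝ, 1 ≤ L → ∀ F : Finset (Lat d), (∀ x, ‖pt x‖ ≤ r * L → x ∈ F) →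
      ∀ E ∈ K, ‖pt (c E)‖ ≤ L → ∀ φ ∈ eigenspace A E, ‖φ‖ = 1 →
        1 / 2 ≤ ∑ x ∈ F, chiNorm S x φ ^ 2 := by
  have hsum := summable_exp_neg_rpow (d := d) one_pos (show (0 : ℝ) < 1 / 2 by norm_num)
  set Q : ℝ := ∑' z : Lat d, Real.exp (-(1 * ‖pt z‖ ^ (1 / 2 : ℝ))) with hQ
  have hQ0 : 0 ≤ Q := tsum_nonneg fun _ => (Real.exp_pos _).le
  obtain ⟨C₂, hC₂, hexp⟩ := exists_rpow_le_exp (2 * p + 1) one_pos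
    (show (0 : ℝ) < 1 / 2 by norm_num)
  -- the radius is chosen to beat the polynomial prefactor of the decay estimate
  set M : ℝ := C₁ ^ 2 * 2 ^ (2 * p) * C₂ * Q with hM
  have hM0 : 0 ≤ M := by positivity
  refine ⟨2 + 2 * M, by linarith, fun L hL F hF E hE hcL φ hφ hφ1 => ?_⟩
  set u : ℝ := (1 + 2 * M) * L with hu
  have hu0 : 0 ≤ u := by positivity
  set D : ℝ := C₁ ^ 2 * (2 * L) ^ (2 * p) * Real.exp (-(u ^ (1 / 2 : ℝ))) with hD
  have hDQ : D * Q ≤ 1 / 2 := by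
    have h1 := hexp u hu0
    rw [one_mul] at h1
    have h2 : L ^ (2 * p) * (1 + 2 * M) ≤ (1 + u) ^ (2 * p + 1) := by
      rw [Real.rpow_add_one (by positivity)]
      have h3 : L ≤ 1 + u := by nlinarith
      have h4 : 1 + 2 * M ≤ 1 + u := by nlinarith
      gcongr
    have h5 : L ^ (2 * p) * (1 + 2 * M) * Real.exp (-(u ^ (1 / 2 : ℝ))) ≤ C₂ := by
      rw [Real.exp_neg, ← div_eq_mul_inv, div_le_iff₀ (Real.exp_pos _)]
      exact h2.trans h1
    have h6 : D * Q * (1 + 2 * M) ≤ M := by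
      rw [hD, Real.mul_rpow two_pos.le (by linarith)]
      calc _ = C₁ ^ 2 * 2 ^ (2 * p) * (L ^ (2 * p) * (1 + 2 * M) *
            Real.exp (-(u ^ (1 / 2 : ℝ)))) * Q := by ring
        _ ≤ C₁ ^ 2 * 2 ^ (2 * p) * C₂ * Q := by gcongr
    nlinarith [show 0 ≤ D * Q by positivity]
  have hbound : ∀ x : Lat d, chiNorm S x φ ^ 2 ≤ (if x ∈ F then chiNorm S x φ ^ 2 else 0) +
      D * Real.exp (-(1 * ‖pt (x - c E)‖ ^ (1 / 2 : ℝ))) := by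
    intro x
    have hD0 : 0 ≤ D * Real.exp (-(1 * ‖pt (x - c E)‖ ^ (1 / 2 : ℝ))) := by positivity
    split_ifs with hx
    · linarith
    · rw [zero_add]
      have hxr : (2 + 2 * M) * L < ‖pt x‖ := by
        by_contra hcon
        exact hx (hF x (not_lt.1 hcon))
      have hxc : u ≤ ‖pt x - pt (c E)‖ := by
        have := norm_sub_norm_le (pt x) (pt (c E))
        rw [hu]
        linarith
      have h1 := hsule E hE φ hφ x
      have h2 : TinvNorm S κ φ ≤ 1 := hφ1 ▸ TinvNorm_le_norm hκ φ
      have h3 := jap_le_of_norm_le hL hcL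
      have hj := jap_pos (pt (c E))
      have hs := subexp_pos (1 / 2) x (c E)
      have h4 : chiNorm S x φ ≤ C₁ * 1 * (2 * L) ^ p * subexp (1 / 2) x (c E) := by
        refine h1.trans ?_
        have := TinvNorm_nonneg (S := S) κ φ
        gcongr
      have h5 : subexp (1 / 2) x (c E) ^ 2 ≤ Real.exp (-(u ^ (1 / 2 : ℝ))) *
          Real.exp (-(1 * ‖pt (x - c E)‖ ^ (1 / 2 : ℝ))) := by
        rw [subexp, ← Real.exp_nat_mul, ← Real.exp_add, pt_sub]
        apply Real.exp_le_exp.2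
        have : u ^ (1 / 2 : ℝ) ≤ ‖pt x - pt (c E)‖ ^ (1 / 2 : ℝ) := by gcongr
        push_cast
        linarith
      calc chiNorm S x φ ^ 2 ≤ (C₁ * 1 * (2 * L) ^ p * subexp (1 / 2) x (c E)) ^ 2 :=
            pow_le_pow_left₀ (chiNorm_nonneg _ _) h4 2
        _ = C₁ ^ 2 * ((2 * L) ^ p * (2 * L) ^ p) * subexp (1 / 2) x (c E) ^ 2 := by ring
        _ = C₁ ^ 2 * (2 * L) ^ (2 * p) * subexp (1 / 2) x (c E) ^ 2 := by
            rw [← Real.rpow_add (by linarith), ← two_mul]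
        _ ≤ C₁ ^ 2 * (2 * L) ^ (2 * p) * (Real.exp (-(u ^ (1 / 2 : ℝ))) *
            Real.exp (-(1 * ‖pt (x - c E)‖ ^ (1 / 2 : ℝ)))) := by gcongr
        _ = _ := by rw [hD]; ring
  have hs1 := hasSum_chiNorm_sq φ
  have hs2 : HasSum (fun x => if x ∈ F then chiNorm S x φ ^ 2 else 0)
      (∑ x ∈ F, chiNorm S x φ ^ 2) := by
    rw [← Finset.sum_congr rfl fun x hx => if_pos hx]
    exact hasSum_sum_of_ne_finset_zero fun x hx => if_neg hx
  have hs3 : HasSum (fun x : Lat d => D * Real.exp (-(1 * ‖pt (x - c E)‖ ^ (1 / 2 : ℝ))))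
      (D * Q) := by
    have h1 := (Equiv.subRight (c E)).hasSum_iff.2 hsum.hasSum
    exact h1.mul_left D
  have h := hasSum_le hbound hs1 (hs2.add hs3)
  rw [hφ1] at h
  linarith

theorem exists_finset_card_le (r : ℝ) (hr : 1 ≤ r) {L : ℝ} (hL : 1 ≤ L) :
    ∃ F : Finset (Lat d), (∀ x, ‖pt x‖ ≤ r * L → x ∈ F) ∧ (F.card : ℝ) ≤ (3 * r * L) ^ d := by
  have hrL : 1 ≤ r * L := one_le_mul_of_one_le_of_one_le hr hL
  refine ⟨Fintype.piFinset fun _ => Finset.Icc (-⌊r * L⌋) ⌊r * L⌋, fun x hx => ?_, ?_⟩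
  · rw [Fintype.mem_piFinset]
    intro i
    have h1 : |(x i : ℝ)| ≤ r * L := by
      have := (PiLp.norm_apply_le (pt x) i).trans hx
      simpa [pt] using this
    have h2 : |x i| ≤ ⌊r * L⌋ := Int.le_floor.2 (by push_cast; exact h1)
    exact Finset.mem_Icc.2 (abs_le.1 h2)
  · rw [Fintype.card_piFinset, Finset.prod_const, Finset.card_univ, Fintype.card_fin,
      Int.card_Icc, Nat.cast_pow]
    have h0 : 0 ≤ ⌊r * L⌋ := Int.floor_nonneg.2 (by linarith)
    have h1 : (((⌊r * L⌋ + 1 - -⌊r * L⌋).toNat : ℕ) : ℝ) = 2 * (⌊r * L⌋ : ℝ) + 1 := by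
      have h2 : (((⌊r * L⌋ + 1 - -⌊r * L⌋).toNat : ℕ) : ℤ) = 2 * ⌊r * L⌋ + 1 := by
        rw [Int.toNat_of_nonneg (by omega)]; ring
      exact_mod_cast h2
    rw [h1]
    have h2 := Int.floor_le (r * L)
    have h3 : (0 : ℝ) ≤ (⌊r * L⌋ : ℝ) := by exact_mod_cast h0
    gcongr
    linarith

/-- The number of orthonormal eigenfunctions with centers within distance `L` of the origin is at
most of the order of `L ^ d`. -/
theorem exists_tsum_one_le {c : ℝ → Lat d} {κ p C₁ : ℝ} (hκ : 0 ≤ κ) (hp : 0 ≤ p)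
    (hC₁ : 0 ≤ C₁) (hsule : ∀ E ∈ K, ∀ φ ∈ eigenspace A E, ∀ x : Lat d, chiNorm S x φ ≤
      C₁ * TinvNorm S κ φ * jap (pt (c E)) ^ p * subexp (1 / 2) x (c E)) {C' : ℝ≥0}
    (htr : ∀ (ι : Type) (e : ι → Hilb S d n), Orthonormal ℂ e →
      (∀ i, ∃ E ∈ K, e i ∈ eigenspace A E) → ∀ x : Lat d, ∑' i, chiE S x (e i) ^ 2 ≤ C') :
    ∃ C : ℝ, ∀ L : ℝ, 1 ≤ L → ∀ (ι : Type) (e : ι → Hilb S d n), Orthonormal ℂ e →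
      (∀ i, ∃ E ∈ K, e i ∈ eigenspace A E ∧ ‖pt (c E)‖ ≤ L) →
        ∑' _ : ι, (1 : ℝ≥0∞) ≤ ENNReal.ofReal (C * L ^ d) := by
  obtain ⟨r, hr, hhalf⟩ := exists_half_le_sum_chiNorm_sq hκ hp hC₁ hsule
  refine ⟨2 * (3 * r) ^ d * C', fun L hL ι e he hE => ?_⟩
  obtain ⟨F, hF, hcard⟩ := exists_finset_card_le (d := d) r hr hL
  have h1 : ∀ i, (1 : ℝ≥0∞) ≤ 2 * ∑ x ∈ F, chiE S x (e i) ^ 2 := by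
    intro i
    obtain ⟨E, hEK, hei, hc⟩ := hE i
    have h2 := hhalf L hL F hF E hEK hc (e i) hei (he.1 i)
    have h3 : ENNReal.ofReal 1 ≤ ENNReal.ofReal (2 * ∑ x ∈ F, chiNorm S x (e i) ^ 2) :=
      ENNReal.ofReal_le_ofReal (by linarith)
    rw [ENNReal.ofReal_one, ENNReal.ofReal_mul two_pos.le,
      ENNReal.ofReal_sum_of_nonneg (fun _ _ => sq_nonneg _), ENNReal.ofReal_ofNat] at h3
    refine h3.trans (le_of_eq ?_)
    congr 1
    refine Finset.sum_congr rfl fun x _ => ?_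
    rw [ENNReal.ofReal_pow (chiNorm_nonneg _ _), ofReal_chiNorm le_rfl (memW_coe le_rfl (e i))]
  calc ∑' _ : ι, (1 : ℝ≥0∞) ≤ ∑' i, 2 * ∑ x ∈ F, chiE S x (e i) ^ 2 := ENNReal.tsum_le_tsum h1
    _ = 2 * ∑ x ∈ F, ∑' i, chiE S x (e i) ^ 2 := by
        rw [ENNReal.tsum_mul_left, Summable.tsum_finsetSum fun _ _ => ENNReal.summable]
    _ ≤ 2 * ∑ x ∈ F, (C' : ℝ≥0∞) := by
        gcongr with x
        exact htr ι e he (fun i => (hE i).imp fun E h => ⟨h.1, h.2.1⟩) x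
    _ = ENNReal.ofReal (2 * (F.card * C')) := by
        rw [Finset.sum_const, nsmul_eq_mul, ENNReal.ofReal_mul two_pos.le,
          ENNReal.ofReal_mul (Nat.cast_nonneg _), ENNReal.ofReal_natCast,
          ENNReal.ofReal_coe_nnreal, ENNReal.ofReal_ofNat]
    _ ≤ _ := by
        apply ENNReal.ofReal_le_ofReal
        calc 2 * ((F.card : ℝ) * C') ≤ 2 * ((3 * r * L) ^ d * C') := by gcongr
          _ = _ := by rw [mul_pow]; ring

/-- An inner product space in which orthonormal families have bounded length is finite
dimensional. -/
theorem finiteDimensional_of_tsum_one_ne_top {W : Type} [NormedAddCommGroup W]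
    [InnerProductSpace ℂ W] [CompleteSpace W]
    (h : ∀ (ι : Type) (e : ι → W), Orthonormal ℂ e → ∑' _ : ι, (1 : ℝ≥0∞) ≠ ⊤) :
    FiniteDimensional ℂ W := by
  obtain ⟨w, f, hf⟩ := exists_hilbertBasis ℂ W
  have h1 := h w f f.orthonormal
  have h2 : Finite w := by
    by_contra hc
    rw [not_finite_iff_infinite] at hc
    exact h1 (ENNReal.tsum_const_eq_top_of_ne_zero one_ne_zero)
  have := Fintype.ofFinite w
  exact Module.Basis.finiteDimensional_of_finite f.toOrthonormalBasis.toBasis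

theorem tsum_enorm_tinv_sq_lt_top {κ : ℝ} (hκ : (d : ℝ) / 2 < κ) (hκ0 : 0 ≤ κ) {ι : Type}
    {e : ι → Hilb S d n} {C' : ℝ≥0} (htr : ∀ x : Lat d, ∑' i, chiE S x (e i) ^ 2 ≤ C') :
    ∑' i, ‖tinv S d n hκ0 (e i)‖ₑ ^ 2 < ⊤ := by
  have hs := (summable_jap_rpow (d := d) (s := 2 * κ) (by linarith)).mul_left
    ((1 + (d : ℝ)) ^ (2 * κ))
  have h1 : ∀ i, ‖tinv S d n hκ0 (e i)‖ₑ ^ 2 ≤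
      ∑' x : Lat d, ENNReal.ofReal ((1 + d) ^ (2 * κ) * jap (pt x) ^ (-(2 * κ))) *
        chiE S x (e i) ^ 2 := by
    intro i
    rw [Lp.enorm_def, eLpNorm_congr_ae (coeFn_tinv hκ0 (e i))]
    exact eLpNorm_weighted_sq_le hκ0 _
  calc _ ≤ ∑' i, ∑' x : Lat d, ENNReal.ofReal ((1 + d) ^ (2 * κ) * jap (pt x) ^ (-(2 * κ))) *
        chiE S x (e i) ^ 2 := ENNReal.tsum_le_tsum h1
    _ = ∑' x : Lat d, ENNReal.ofReal ((1 + d) ^ (2 * κ) * jap (pt x) ^ (-(2 * κ))) *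
        ∑' i, chiE S x (e i) ^ 2 := by
        rw [ENNReal.tsum_comm]
        simp_rw [ENNReal.tsum_mul_left]
    _ ≤ ∑' x : Lat d, ENNReal.ofReal ((1 + d) ^ (2 * κ) * jap (pt x) ^ (-(2 * κ))) * C' := by
        gcongr with x
        exact htr x
    _ < ⊤ := by
        rw [ENNReal.tsum_mul_right]
        exact ENNReal.mul_lt_top hs.tsum_ofReal_lt_top ENNReal.coe_lt_top

end Counting

/-! ### Centers of localization and the almost sure statements -/

section Centers

variable {S : Setting} {d n : ℕ} {Ω : Type*}

/-- Semi-uniform localization of eigenfunctions (SULE). The center for the energy `E` is a point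
where the local norm of one fixed eigenfunction is maximal. -/
theorem Localized.exists_sule {V : FiniteVolume S d n Ω} {ω : Ω}
    {A : Hilb S d n →ₗ.[ℂ] Hilb S d n} {κ₀ : ℝ} {K : Set ℝ} (h : Localized V ω A κ₀ K)
    (hκ₀ : 0 ≤ κ₀) : ∃ c : ℝ → Lat d, ∀ ζ ∈ Ioo (0 : ℝ) 1, ∀ p κ : ℝ, 0 ≤ κ → κ < p →
      ∃ C : ℝ, 0 ≤ C ∧ ∀ E ∈ K, ∀ φ ∈ eigenspace A E, ∀ x : Lat d, chiNorm S x φ ≤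
        C * TinvNorm S κ φ * jap (pt (c E)) ^ p * subexp ζ x (c E) := by
  have hex : ∀ E : ℝ, ∃ y : Lat d, eigenspace A E ≠ ⊥ → ∃ ψ ∈ eigenspace A E, ψ ≠ 0 ∧
      ∀ x : Lat d, chiNorm S x ψ ≤ chiNorm S y ψ := by
    intro E
    by_cases hE : eigenspace A E = ⊥
    · exact ⟨0, fun h => absurd hE h⟩
    · obtain ⟨ψ, hψ, h0⟩ := Submodule.exists_mem_ne_zero_of_ne_bot hE
      obtain ⟨y, hy⟩ := exists_chiNorm_max ψ
      exact ⟨y, fun _ => ⟨ψ, hψ, h0, hy⟩⟩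
  choose c hc using hex
  have hd0 : (0 : ℝ) ≤ d := Nat.cast_nonneg d
  obtain ⟨B, hB, hmax⟩ := exists_TinvNorm_le S d n (κ := d / 2 + 1) (by linarith)
  refine ⟨c, fun ζ hζ p κ hκ hκp => ?_⟩
  obtain ⟨C, hC, hdec⟩ := h.chiNorm_le_of_center hζ hκ (κ' := d / 2 + 1) (by positivity)
    (sub_pos.2 hκp)
  refine ⟨C * (1 + B), by positivity, fun E hE φ hφ x => ?_⟩
  have hT := TinvNorm_nonneg (S := S) κ φ
  have hj := jap_pos (pt (c E))
  have hs := subexp_pos ζ x (c E)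
  by_cases hφ0 : φ = 0
  · rw [hφ0, chiNorm_zero]
    have := TinvNorm_nonneg (S := S) κ ((0 : Hilb S d n) : Sp d → Fib n)
    positivity
  obtain ⟨ψ, hψ, hψ0, hψmax⟩ := hc E ((Submodule.ne_bot_iff _).2 ⟨φ, hφ, hφ0⟩)
  have hκ'0 : (0 : ℝ) ≤ d / 2 + 1 := by positivity
  have hgψ := isGenEigenfunction_of_mem_eigenspace hκ₀ hψ hψ0
  obtain ⟨z, hz⟩ := exists_chiNorm_pos hκ'0 (memW_coe hκ'0 ψ) hgψ.2.1
  have h1 := hdec E hE (c E) B hB.le ψ hgψ (memW_coe hκ'0 ψ) (hz.trans_le (hψmax z))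
    (hmax ψ (memW_coe hκ'0 ψ) _ (chiNorm_nonneg _ _) hψmax) φ
    (isGenEigenfunction_of_mem_eigenspace hκ₀ hφ hφ0) (memW_coe hκ φ) x
  rwa [add_sub_cancel] at h1

variable [MeasurableSpace Ω]

/-- Almost every realization is localized on compact subsets of the region of complete
localization. -/
theorem ae_localized (hd : 1 ≤ d) {ℙ : Measure Ω} {X : RandomOperator S d n ℙ}
    {V : FiniteVolume S d n Ω} {J : Set ℝ} {κ₀ ϱ : ℝ} (hX : Assumptions X V J κ₀ ϱ) {a b : ℝ}
    (hI : Icc a b ⊆ completeLocalization ℙ V J ϱ) :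
    ∀ᵐ ω ∂ℙ, Localized V ω (X.H ω) κ₀ (Icc a b) := by
  have hJ : Icc a b ⊆ J := fun E hE => (hI hE).1
  obtain ⟨γ, hγ⟩ := hX.edi a b hJ
  have hθ : ∀ j : ℕ, 1 - 1 / ((j : ℝ) + 2) ∈ Ioo (0 : ℝ) 1 := by
    intro j
    have h1 : (0 : ℝ) < 1 / ((j : ℝ) + 2) := by positivity
    have h2 : 1 / ((j : ℝ) + 2) < 1 := by
      rw [div_lt_one (by positivity)]
      have : (0 : ℝ) ≤ j := Nat.cast_nonneg j
      linarith
    constructor <;> linarith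
  have hg := ae_all_iff.2 fun j : ℕ => ae_exists_goodPair hd hX.rho isCompact_Icc hI (hθ j)
  filter_upwards [hγ, hg] with ω h1 h2
  refine ⟨fun θ hθ' => ?_, γ, h1⟩
  -- a larger exponent of the form `1 - 1 / (j + 2)`
  obtain ⟨j, hj⟩ := exists_nat_one_div_lt (sub_pos.2 hθ'.2)
  have hj' : θ ≤ 1 - 1 / ((j : ℝ) + 2) := by
    have : 1 / ((j : ℝ) + 2) ≤ 1 / ((j : ℝ) + 1) := by
      apply one_div_le_one_div_of_le (by positivity); linarith
    linarith
  obtain ⟨m, hm, R, hR⟩ := h2 j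
  refine ⟨m, hm, max R 1, fun x y hxy hlog => ?_⟩
  have hpow : ‖pt x - pt y‖ ^ θ ≤ ‖pt x - pt y‖ ^ (1 - 1 / ((j : ℝ) + 2)) :=
    Real.rpow_le_rpow_of_exponent_le ((le_max_right _ _).trans hxy) hj'
  intro E hE
  obtain ⟨L, l1, l2, l3, l4, l5⟩ := hR x y ((le_max_left _ _).trans hxy) (hlog.trans hpow) E hE
  exact ⟨L, l1, l2, hpow.trans l3, l4, l5⟩

variable {ℙ : Measure Ω} {X : RandomOperator S d n ℙ}

/-- Localization implies pure point spectrum. -/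
theorem RandomOperator.closure_iSup_eigenspace_eq (X : RandomOperator S d n ℙ)
    {V : FiniteVolume S d n Ω} {κ₀ : ℝ} (hκ₀ : 0 ≤ κ₀) {ω : Ω} {a b : ℝ}
    (hloc : Localized V ω (X.H ω) κ₀ (Icc a b)) (htr : X.mu κ₀ ω (Icc a b) < ⊤)
    (hcore : ∀ φ : (X.H ω).domain, ∀ δ > 0, ∃ v ∈ Dplus κ₀ (X.H ω),
      ‖(v : Hilb S d n) - φ‖ < δ ∧ ‖X.H ω v - X.H ω φ‖ < δ) :
    (eigenvaluesIn (X.H ω) (Ioo a b)).Countable ∧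
    (⨆ E ∈ Ioo a b, eigenspace (X.H ω) E).topologicalClosure
        = LinearMap.range ((X.P ω).proj (Ioo a b)).toLinearMap := by
  have hA := X.selfAdjoint ω
  rw [X.mu_eq_hsSq hκ₀] at htr
  have hc := (X.spectral ω).countable_eigenvaluesIn hA (tinv_injective hκ₀) measurableSet_Icc
    Ioo_subset_Icc_self htr
  refine ⟨hc, (X.spectral ω).closure_iSup_eigenspace hA measurableSet_Ioo hc fun φ =>
    (X.spectral ω).proj_diff_eigenvaluesIn_eq_zero hA (isSelfAdjoint_tinv hκ₀)
      (tinv_injective hκ₀) htr (fun l hl => ?_) φ⟩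
  rintro ⟨w, hw, u, hu1, hu2⟩
  have hgen := isGenEigenfunction_weighted hκ₀ hw hu1 hu2
  have hmem := hloc.memLp hκ₀ (Ioo_subset_Icc_self hl) hgen
  -- the generalized eigenfunction is an element of the Hilbert space
  set ψ : Hilb S d n := hmem.toLp _ with hψ
  have hae : (ψ : Sp d → Fib n) =ᵐ[S.vol d] weighted κ₀ w := hmem.coeFn_toLp
  have hgenψ : IsGenEigenfunction κ₀ (X.H ω) l ψ := by
    obtain ⟨g1, g2, φ, g3, g4⟩ := hgen
    refine ⟨memW_coe hκ₀ ψ, fun h0 => g2 (hae.symm.trans h0), φ, g3.congr fun k => ?_,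
      g4.congr fun k => ?_⟩
    · refine TinvNorm_congr κ₀ ?_
      filter_upwards [hae] with u hu
      rw [hu]
    · refine TinvNorm_congr κ₀ ?_
      filter_upwards [hae] with u hu
      rw [hu]
  have h1 := mem_eigenspace_of_isGenEigenfunction hκ₀ hA hcore hgenψ
  refine (Submodule.ne_bot_iff _).2 ⟨ψ, h1, fun h0 => hgenψ.2.1 ?_⟩
  rw [h0]
  exact Lp.coeFn_zero _ _ _

theorem RandomOperator.finiteDimensional_eigenspace (X : RandomOperator S d n ℙ) {ω : Ω}
    {E C : ℝ} (h : ∀ (ι : Type) (e : ι → Hilb S d n), Orthonormal ℂ e →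
      (∀ i, e i ∈ eigenspace (X.H ω) E) → ∑' _ : ι, (1 : ℝ≥0∞) ≤ ENNReal.ofReal C) :
    FiniteDimensional ℂ (eigenspace (X.H ω) E) := by
  have hclosed : IsClosed (eigenspace (X.H ω) E : Set (Hilb S d n)) := by
    have : (eigenspace (X.H ω) E : Set (Hilb S d n)) = {φ | (X.P ω).proj {E} φ = φ} := by
      ext φ
      exact (X.spectral ω).mem_eigenspace_iff (X.selfAdjoint ω)
    rw [this]
    exact isClosed_eq ((X.P ω).proj {E}).continuous continuous_id
  have : CompleteSpace (eigenspace (X.H ω) E) := hclosed.completeSpace_coe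
  refine finiteDimensional_of_tsum_one_ne_top fun ι e he => ?_
  have ho : Orthonormal ℂ fun i => (e i : Hilb S d n) :=
    he.comp_linearIsometry (eigenspace (X.H ω) E).subtypeₗᵢ
  exact ne_top_of_le_ne_top ENNReal.ofReal_ne_top (h ι _ ho fun i => (e i).2)

end Centers

/-! ### Complete orthonormal sets of eigenfunctions -/

section CompleteSets

variable {S : Setting} {d n : ℕ} {A : Hilb S d n →ₗ.[ℂ] Hilb S d n} {I : Set ℝ}

theorem EigenBases.vec_mem (v : EigenBases A I) (E : eigenvaluesIn A I)
    (j : Fin (Module.finrank ℂ (eigenspace A (E : ℝ)))) : v.vec E j ∈ eigenspace A (E : ℝ) :=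
  (v E j).2

theorem EigenBases.orthonormal_vec (v : EigenBases A I) (E : eigenvaluesIn A I) :
    Orthonormal ℂ (v.vec E) :=
  (v E).orthonormal.comp_linearIsometry (eigenspace A (E : ℝ)).subtypeₗᵢ

theorem EigenBases.mem_span_vec (v : EigenBases A I) (E : eigenvaluesIn A I) {φ : Hilb S d n}
    (hφ : φ ∈ eigenspace A (E : ℝ)) : φ ∈ Submodule.span ℂ (Set.range (v.vec E)) := by
  have h := (v E).sum_repr ⟨φ, hφ⟩
  have h1 := congrArg Subtype.val h
  simp only [Submodule.coe_sum, Submodule.coe_smul] at h1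
  rw [← h1]
  exact Submodule.sum_mem _ fun j _ => Submodule.smul_mem _ _ (Submodule.subset_span ⟨j, rfl⟩)

/-- Orthonormal families in the eigenspaces of distinct eigenvalues combine to an orthonormal
family. -/
theorem orthonormal_sigma (hA : IsSelfAdjoint A) {s : Type} {E : s → ℝ}
    (hE : Function.Injective E) {m : s → Type} {e : ∀ i, m i → Hilb S d n}
    (he : ∀ i, Orthonormal ℂ (e i)) (hmem : ∀ i j, e i j ∈ eigenspace A (E i)) :
    Orthonormal ℂ fun p : (i : s) × m i => e p.1 p.2 := by
  refine ⟨fun p => (he p.1).1 p.2, ?_⟩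
  rintro ⟨i, j⟩ ⟨i', j'⟩ hne
  by_cases h : i = i'
  · subst h
    exact (he i).2 fun h' => hne (congrArg (Sigma.mk i) h')
  · exact inner_eq_zero_of_mem_eigenspace hA (fun h' => h (hE h')) (hmem i j) (hmem i' j')

theorem EigenBases.orthonormal (hA : IsSelfAdjoint A) (v : EigenBases A I) :
    Orthonormal ℂ fun p : (E : eigenvaluesIn A I) ×
      Fin (Module.finrank ℂ (eigenspace A (E : ℝ))) => v.vec p.1 p.2 :=
  orthonormal_sigma hA (E := fun E : eigenvaluesIn A I => (E : ℝ)) Subtype.val_injective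
    (fun E => v.orthonormal_vec E) fun E j => v.vec_mem E j

theorem EigenBases.span_eq (v : EigenBases A I) :
    Submodule.span ℂ {φ | ∃ E j, φ = v.vec E j} = ⨆ E ∈ I, eigenspace A E := by
  apply le_antisymm
  · rw [Submodule.span_le]
    rintro _ ⟨E, j, rfl⟩
    exact (le_iSup₂_of_le (f := fun E (_ : E ∈ I) => eigenspace A E) (E : ℝ) E.2.1 le_rfl)
      (v.vec_mem E j)
  · refine iSup₂_le fun E hE => ?_
    by_cases h0 : eigenspace A E = ⊥
    · rw [h0]; exact bot_le
    · intro φ hφ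
      refine Submodule.span_mono ?_ (v.mem_span_vec ⟨E, hE, h0⟩ hφ)
      rintro _ ⟨j, rfl⟩
      exact ⟨⟨E, hE, h0⟩, j, rfl⟩

theorem EigenBases.range_eq (v : EigenBases A I) :
    (Set.range fun p : (E : eigenvaluesIn A I) ×
      Fin (Module.finrank ℂ (eigenspace A (E : ℝ))) => v.vec p.1 p.2)
      = {φ | ∃ E j, φ = v.vec E j} := by
  ext φ
  constructor
  · rintro ⟨⟨E, j⟩, rfl⟩
    exact ⟨E, j, rfl⟩
  · rintro ⟨E, j, rfl⟩
    exact ⟨⟨E, j⟩, rfl⟩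

theorem ofReal_alpha {κ : ℝ} (hκ : 0 ≤ κ) (φ : Hilb S d n) :
    ENNReal.ofReal (alpha S κ φ) = ‖tinv S d n hκ φ‖ₑ ^ 2 := by
  rw [alpha, ENNReal.ofReal_pow (TinvNorm_nonneg _ _), ← norm_tinv hκ, ofReal_norm]

theorem sqrt_alpha (κ : ℝ) (φ : Hilb S d n) : √(alpha S κ φ) = TinvNorm S κ φ :=
  Real.sqrt_sq (TinvNorm_nonneg _ _)

variable {Ω : Type*} [MeasurableSpace Ω] {ℙ : Measure Ω}

theorem RandomOperator.sum_alpha_eq (X : RandomOperator S d n ℙ) {ω : Ω} {κ : ℝ} (hκ : 0 ≤ κ)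
    (v : EigenBases (X.H ω) I) (E : eigenvaluesIn (X.H ω) I) :
    ∑ j, ENNReal.ofReal (alpha S κ (v.vec E j)) = X.mu κ ω {(E : ℝ)} := by
  have hE := measurableSet_singleton (E : ℝ)
  have hmem := fun φ => (X.spectral ω).mem_eigenspace_iff (X.selfAdjoint ω) (E := (E : ℝ)) (φ := φ)
  rw [X.mu_eq_hsSq hκ, hsSq_comp_eq_tsum _ _ ((X.P ω).selfAdjoint _ hE) (v.orthonormal_vec E)
    (fun j => (hmem _).1 (v.vec_mem E j)), tsum_fintype]
  · exact Finset.sum_congr rfl fun j _ => ofReal_alpha hκ _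
  · intro x
    exact Submodule.le_topologicalClosure _
      (v.mem_span_vec E ((hmem _).2 ((X.P ω).proj_idem hE x)))

theorem RandomOperator.tsum_alpha_eq (X : RandomOperator S d n ℙ) {ω : Ω} {κ : ℝ} (hκ : 0 ≤ κ)
    (hI : MeasurableSet I) (hpp : (⨆ E ∈ I, eigenspace (X.H ω) E).topologicalClosure
        = LinearMap.range ((X.P ω).proj I).toLinearMap) (v : EigenBases (X.H ω) I) :
    X.mu κ ω I = ∑' p : (E : eigenvaluesIn (X.H ω) I) ×
      Fin (Module.finrank ℂ (eigenspace (X.H ω) (E : ℝ))), ‖tinv S d n hκ (v.vec p.1 p.2)‖ₑ ^ 2 := by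
  have hA := X.selfAdjoint ω
  rw [X.mu_eq_hsSq hκ]
  refine hsSq_comp_eq_tsum _ _ ((X.P ω).selfAdjoint _ hI) (v.orthonormal hA) ?_ ?_
  · rintro ⟨E, j⟩
    exact (X.spectral ω).proj_of_mem_eigenspace hA (v.vec_mem E j) hI E.2.1
  · intro x
    rw [v.range_eq, v.span_eq, hpp]
    exact ⟨x, rfl⟩

end CompleteSets

end RandomLoc

end

open RandomLoc in
theorem corollary3p7 {S : Setting} {d n : ℕ} (hd : 1 ≤ d) {Ω : Type*} [MeasurableSpace Ω]
    (ℙ : Measure Ω) [IsProbabilityMeasure ℙ] (X : RandomOperator S d n ℙ)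
    (V : FiniteVolume S d n Ω) (J : Set ℝ) (κ₀ ϱ : ℝ) (hX : Assumptions X V J κ₀ ϱ)
    (a b : ℝ) (hab : a < b) (hI : closure (Ioo a b) ⊆ completeLocalization ℙ V J ϱ) :
    ∀ᵐ ω ∂ℙ,
      -- pure point spectrum in `I = (a, b)`, with (countably many) eigenvalues of finite multiplicity
      (⨆ E ∈ Ioo a b, eigenspace (X.H ω) E).topologicalClosure
        = LinearMap.range ((X.P ω).proj (Ioo a b)).toLinearMap ∧
      (eigenvaluesIn (X.H ω) (Ioo a b)).Countable ∧
      (∀ E ∈ Ioo a b, FiniteDimensional ℂ (eigenspace (X.H ω) E)) ∧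
      -- (i) SUDEC
      (∀ ζ ∈ Ioo (0 : ℝ) 1, ∀ ε : ℝ, 0 < ε → ∀ κ : ℝ, (d : ℝ) / 2 < κ → κ < (d + ε) / 2 →
        ∃ C : ℝ, ∀ E ∈ Ioo a b, ∀ φ ∈ eigenspace (X.H ω) E, ∀ ψ ∈ eigenspace (X.H ω) E,
          ∀ x y : Lat d,
            chiNorm S x φ * chiNorm S y ψ ≤ C * TinvNorm S κ φ * TinvNorm S κ ψ *
              jap (pt y) ^ (d + ε) * subexp ζ x y ∧
            chiNorm S x φ * chiNorm S y ψ ≤ C * TinvNorm S κ φ * TinvNorm S κ ψ *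
              jap (pt x) ^ ((d + ε) / 2) * jap (pt y) ^ ((d + ε) / 2) * subexp ζ x y) ∧
      -- (ii) SULE, with centers of localization `c E`
      ∃ c : ℝ → Lat d,
        (∀ ζ ∈ Ioo (0 : ℝ) 1, ∀ ε : ℝ, 0 < ε → ∀ κ : ℝ, (d : ℝ) / 2 < κ → κ < 2 * (d + ε) →
          ∃ C : ℝ, ∀ E ∈ Ioo a b, ∀ φ ∈ eigenspace (X.H ω) E, ∀ x : Lat d,
            chiNorm S x φ ≤ C * TinvNorm S κ φ * jap (pt (c E)) ^ (2 * (d + ε)) *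
              subexp ζ x (c E)) ∧
        (∃ C : ℝ, ∀ L : ℝ, 1 ≤ L →
          ∑' E : {E : ℝ // E ∈ eigenvaluesIn (X.H ω) (Ioo a b) ∧ ‖pt (c E)‖ ≤ L},
            (Module.finrank ℂ (eigenspace (X.H ω) (E : ℝ)) : ℝ≥0∞) ≤
              ENNReal.ofReal (C * L ^ d)) ∧
        -- (iii) complete orthonormal sets of eigenfunctions
        (∀ v : EigenBases (X.H ω) (Ioo a b),
          Orthonormal ℂ (fun p : (E : eigenvaluesIn (X.H ω) (Ioo a b)) ×
              Fin (Module.finrank ℂ (eigenspace (X.H ω) (E : ℝ))) => v.vec p.1 p.2) ∧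
          (Submodule.span ℂ {φ | ∃ E j, φ = v.vec E j}).topologicalClosure
            = LinearMap.range ((X.P ω).proj (Ioo a b)).toLinearMap) ∧
        (∀ ζ ∈ Ioo (0 : ℝ) 1, ∀ ε : ℝ, 0 < ε → ∀ κ : ℝ, (d : ℝ) / 2 < κ → κ < (d + ε) / 2 →
          ∃ C : ℝ, ∀ (v : EigenBases (X.H ω) (Ioo a b)) (E : eigenvaluesIn (X.H ω) (Ioo a b))
            (i j : Fin (Module.finrank ℂ (eigenspace (X.H ω) (E : ℝ)))) (x y : Lat d),
            chiNorm S x (v.vec E i) * chiNorm S y (v.vec E j) ≤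
              C * √(alpha S κ (v.vec E i)) * √(alpha S κ (v.vec E j)) *
                jap (pt y) ^ (d + ε) * subexp ζ x y ∧
            chiNorm S x (v.vec E i) * chiNorm S y (v.vec E j) ≤
              C * √(alpha S κ (v.vec E i)) * √(alpha S κ (v.vec E j)) *
                jap (pt x) ^ ((d + ε) / 2) * jap (pt y) ^ ((d + ε) / 2) * subexp ζ x y) ∧
        (∀ ζ ∈ Ioo (0 : ℝ) 1, ∀ ε : ℝ, 0 < ε → ∀ κ : ℝ, (d : ℝ) / 2 < κ → κ < 2 * (d + ε) →
          ∃ C : ℝ, ∀ (v : EigenBases (X.H ω) (Ioo a b)) (E : eigenvaluesIn (X.H ω) (Ioo a b))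
            (j : Fin (Module.finrank ℂ (eigenspace (X.H ω) (E : ℝ)))) (x : Lat d),
            chiNorm S x (v.vec E j) ≤ C * √(alpha S κ (v.vec E j)) *
              jap (pt (c E)) ^ (2 * (d + ε)) * subexp ζ x (c E)) ∧
        (∀ κ : ℝ, (d : ℝ) / 2 < κ → ∀ v : EigenBases (X.H ω) (Ioo a b),
          (∀ E, ∑ j, ENNReal.ofReal (alpha S κ (v.vec E j)) = X.mu κ ω {(E : ℝ)}) ∧
          ∑' E, ∑ j, ENNReal.ofReal (alpha S κ (v.vec E j))
            = ∑' E : eigenvaluesIn (X.H ω) (Ioo a b), X.mu κ ω {(E : ℝ)} ∧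
          ∑' E : eigenvaluesIn (X.H ω) (Ioo a b), X.mu κ ω {(E : ℝ)} = X.mu κ ω (Ioo a b) ∧
          X.mu κ ω (Ioo a b) < ⊤) := by
  have hcl : closure (Ioo a b) = Icc a b := closure_Ioo hab.ne
  rw [hcl] at hI
  have hJ : Icc a b ⊆ J := fun E hE => (hI hE).1
  have hd0 : (0 : ℝ) ≤ d := Nat.cast_nonneg d
  have hκ₀ : 0 ≤ κ₀ := le_trans (by positivity) hX.kappa.le
  have hsub : Ioo a b ⊆ Icc a b := Ioo_subset_Icc_self
  obtain ⟨C₀, hC₀⟩ := hX.trace_estimate a b hJ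
  obtain ⟨C', hC'⟩ := X.ae_tsum_chiE_sq_le hκ₀ measurableSet_Icc hC₀
  filter_upwards [ae_localized hd hX hI, hC₀, hC', hX.core] with ω hloc htr0 htr hcore
  have hA := X.selfAdjoint ω
  obtain ⟨hcount, hpp⟩ := X.closure_iSup_eigenspace_eq hκ₀ hloc
    (htr0.trans_lt ENNReal.coe_lt_top) hcore
  obtain ⟨c, hsule⟩ := hloc.exists_sule hκ₀
  -- counting works with any admissible decay estimate
  obtain ⟨C₁, hC₁, hsule₁⟩ := hsule (1 / 2) (by norm_num) 1 0 le_rfl one_pos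
  obtain ⟨C₂, hC₂⟩ := exists_tsum_one_le le_rfl zero_le_one hC₁ hsule₁ htr
  have hfin : ∀ E ∈ Ioo a b, FiniteDimensional ℂ (eigenspace (X.H ω) E) := fun E hE =>
    X.finiteDimensional_eigenspace (C := C₂ * (max 1 ‖pt (c E)‖) ^ d) fun ι e he hmem =>
      hC₂ _ (le_max_left _ _) ι e he fun i => ⟨E, hsub hE, hmem i, le_max_right _ _⟩
  refine ⟨hpp, hcount, hfin, ?_, c, ?_, ?_, ?_, ?_, ?_, ?_⟩
  · intro ζ hζ ε hε κ hκ hκε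
    obtain ⟨C, hC⟩ := hloc.sudec hκ₀ hζ hε hκ hκε
    exact ⟨C, fun E hE => hC E (hsub hE)⟩
  · intro ζ hζ ε hε κ hκ hκε
    obtain ⟨C, -, hC⟩ := hsule ζ hζ (2 * (d + ε)) κ (le_trans (by positivity) hκ.le) hκε
    exact ⟨C, fun E hE => hC E (hsub hE)⟩
  · refine ⟨C₂, fun L hL => ?_⟩
    have hfd : ∀ E : {E : ℝ // E ∈ eigenvaluesIn (X.H ω) (Ioo a b) ∧ ‖pt (c E)‖ ≤ L},
        FiniteDimensional ℂ (eigenspace (X.H ω) (E : ℝ)) := fun E => hfin E E.2.1.1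
    have ho := orthonormal_sigma hA
      (E := fun E : {E : ℝ // E ∈ eigenvaluesIn (X.H ω) (Ioo a b) ∧ ‖pt (c E)‖ ≤ L} => (E : ℝ))
      Subtype.val_injective
      (e := fun E j => (stdOrthonormalBasis ℂ (eigenspace (X.H ω) (E : ℝ)) j : Hilb S d n))
      (fun E => (stdOrthonormalBasis ℂ (eigenspace (X.H ω) (E : ℝ))).orthonormal.comp_linearIsometry
        (eigenspace (X.H ω) (E : ℝ)).subtypeₗᵢ)
      (fun E j => (stdOrthonormalBasis ℂ (eigenspace (X.H ω) (E : ℝ)) j).2)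
    have h1 := hC₂ L hL _ _ ho (fun p => ⟨p.1, hsub p.1.2.1.1,
      (stdOrthonormalBasis ℂ (eigenspace (X.H ω) (p.1 : ℝ)) p.2).2, p.1.2.2⟩)
    rw [ENNReal.tsum_sigma'] at h1
    simpa using h1
  · intro v
    exact ⟨v.orthonormal hA, by rw [v.span_eq, hpp]⟩
  · intro ζ hζ ε hε κ hκ hκε
    obtain ⟨C, hC⟩ := hloc.sudec hκ₀ hζ hε hκ hκε
    refine ⟨C, fun v E i j x y => ?_⟩
    rw [sqrt_alpha, sqrt_alpha]
    exact hC E (hsub E.2.1) _ (v.vec_mem E i) _ (v.vec_mem E j) x y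
  · intro ζ hζ ε hε κ hκ hκε
    obtain ⟨C, -, hC⟩ := hsule ζ hζ (2 * (d + ε)) κ (le_trans (by positivity) hκ.le) hκε
    refine ⟨C, fun v E j x => ?_⟩
    rw [sqrt_alpha]
    exact hC E (hsub E.2.1) _ (v.vec_mem E j) x
  · intro κ hκ v
    have hκ0 : 0 ≤ κ := le_trans (by positivity) hκ.le
    have h1 : ∀ E, ∑ j, ENNReal.ofReal (alpha S κ (v.vec E j)) = X.mu κ ω {(E : ℝ)} :=
      X.sum_alpha_eq hκ0 v
    have h2 := X.tsum_alpha_eq hκ0 measurableSet_Ioo hpp v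
    have h3 : X.mu κ ω (Ioo a b) < ⊤ := by
      rw [h2]
      exact tsum_enorm_tinv_sq_lt_top hκ hκ0 (htr _ _ (v.orthonormal hA)
        fun p => ⟨p.1, hsub p.1.2.1, v.vec_mem p.1 p.2⟩)
    refine ⟨h1, tsum_congr h1, ?_, h3⟩
    rw [h2, ENNReal.tsum_sigma']
    refine tsum_congr fun E => ?_
    rw [← h1 E, tsum_fintype]
    exact Finset.sum_congr rfl fun j _ => ofReal_alpha hκ0 _
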